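/- Let $k$ be an algebraically closed field of arbitrary characteristic, and let $n \le m \le N-1$ be non-negative integers. Write $V = k^{N+1}$, let $\mathbb{P}^N$ be the space of lines in $V$, and let $\mathbb{G}(d,\mathbb{P}^N)$ be the Grassmannian of $d$-planes in $\mathbb{P}^N$, i.e. of $(d+1)$-dimensional linear subspaces of $V$, with universal family $\mathcal{U}_{\mathbb{G}(d,\mathbb{P}^N)} = \{(L,x) \in \mathbb{G}(d,\mathbb{P}^N)\times\mathbb{P}^N \mid x\in L\}$ (for $d=-1$ the Grassmannian is a point and the universal family is empty). Varieties are irreducible and reduced. A morphism from a variety is called separable if the function field of the variety is a separable (that is, separably generated) extension of the function field of the closure of its image. Let $X \subset \mathbb{P}^N$ be an $n$-dimensional projective variety with smooth locus $X^{sm}$, and for $x\in X^{sm}$ let $\mathbb{T}_xX\subset\mathbb{P}^N$ be the embedded tangent space. Put $$P_m^X = \overline{\{(L,x)\in \mathbb{G}(m,\mathbb{P}^N)\times X^{sm} \mid \mathbb{T}_xX\subset L\}} \subset \mathbb{G}(m,\mathbb{P}^N)\times\mathbb{P}^N,$$ and let $\gamma_m : P_m^X\to\mathbb{G}(m,\mathbb{P}^N)$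 (the $m$-th Gauss map) be the first projection. Let $Y\subset\mathbb{G}(m,\mathbb{P}^N)$ be a projective variety. For a smooth point $L$ of $Y$, regarded as a linear subspace of $V$, the tangent space $T_LY$ is a subspace of $T_L\mathbb{G}(m,\mathbb{P}^N)=\mathrm{Hom}(L,V/L)$; let $$\Phi_L : L \to \mathrm{Hom}(T_LY, V/L),\qquad w\mapsto (t\mapsto t(w)).$$ Let $m^-$, with $-1\le m^-\le m$, be the integer such that $\dim\ker\Phi_L = m^-+1$ for a general point $L\in Y$. The shrinking map of $Y$ is the rational map $\sigma_Y : Y\dashrightarrow\mathbb{G}(m^-,\mathbb{P}^N)$, $L\mapsto \ker\Phi_L$, defined on the open set $Y^\circ$ of smooth points $L$ of $Y$ with $\dim\ker\Phi_L=m^-+1$. Let $$\sigma_Y^*\mathcal{U} = \overline{\{(L,x)\in Y^\circ\times\mathbb{P}^N \mid x\in\sigma_Y(L)\}} \subset \mathbb{G}(m,\mathbb{P}^N)\times\mathbb{P}^N$$ be the pull-back of $\mathcal{U}_{\mathbb{G}(m^-,\mathbb{P}^N)}$. Then the following conditions are equivalent: 1. $\gamma_m$ is separable, and $Y=\gamma_m(P_m^X)$;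 2. $P_m^X=\sigma_Y^*\mathcal{U}$ in $\mathbb{G}(m,\mathbb{P}^N)\times\mathbb{P}^N$; 3. $\dim\sigma_Y^*\mathcal{U}=n+(m-n)(N-m)$, the second projection $\sigma_Y^*\mathcal{U}\to\mathbb{P}^N$ is separable, and its image is equal to $X$. -/

import Mathlib

open MvPolynomial Filter
open scoped LinearAlgebra.Projectivization

noncomputable section

namespace GaussMap

/-! ## Zariski topology through homogeneous coordinates

All varieties are over an algebraically closed field `k` and are identified with their sets of
`k`-points. -/

/-- A set `P` of points, each of which is described by a non-empty set of coordinate vectors in the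
affine space `ι → k` (its systems of homogeneous coordinates), with the Zariski closed sets below.
It is used for projective space, for Grassmannians, and for products of these. -/
class HomogCoords (k : outParam Type*) (P : Type*) (ι : outParam Type) where
  /-- The coordinate vectors of a point. -/
  coords : P → Set (ι → k)
  coords_nonempty : ∀ x, (coords x).Nonempty

open HomogCoords

section Zariski

variable {k P Q : Type*} {ι κ : Type} [Field k] [HomogCoords k P ι] [HomogCoords k Q κ]

/-- `Z` is Zariski closed if it is cut out by polynomials in the homogeneous coordinates, i.e. if
its preimage in the space of coordinate vectors is cut out there by polynomials. -/
def IsZariskiClosed (Z : Set P) : Prop :=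
  ∃ S : Set (MvPolynomial ι k), ∀ x : P, ∀ v ∈ coords x, x ∈ Z ↔ ∀ p ∈ S, eval v p = 0

/-- The Zariski topology. It is deliberately not a global instance (the Zariski topology of a
product is not the product topology). -/
@[reducible] def zariski (P : Type*) [HomogCoords k P ι] : TopologicalSpace P :=
  TopologicalSpace.ofClosed {Z : Set P | IsZariskiClosed Z}
    ⟨{1}, by simp⟩
    (by
      intro A hA
      have hA' : ∀ Z ∈ A, ∃ S : Set (MvPolynomial ι k),
          ∀ x : P, ∀ v ∈ coords x, x ∈ Z ↔ ∀ p ∈ S, eval v p = 0 := fun Z hZ => hA hZ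
      choose! S hS using hA'
      refine ⟨⋃ Z ∈ A, S Z, fun x v hv => ?_⟩
      simp only [Set.mem_sInter, Set.mem_iUnion]
      constructor
      · rintro h p ⟨Z, hZ, hp⟩
        exact (hS Z hZ x v hv).1 (h Z hZ) p hp
      · intro h Z hZ
        exact (hS Z hZ x v hv).2 fun p hp => h p ⟨Z, hZ, hp⟩)
    (by
      rintro A ⟨S, hS⟩ B ⟨T, hT⟩
      refine ⟨{r | ∃ p ∈ S, ∃ q ∈ T, r = p * q}, fun x v hv => ?_⟩
      rw [Set.mem_union, hS x v hv, hT x v hv]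
      constructor
      · rintro (h | h) r ⟨p, hp, q, hq, rfl⟩
        · simp [h p hp]
        · simp [h q hq]
      · intro h
        by_contra! hcon
        obtain ⟨⟨p, hp, hp0⟩, q, hq, hq0⟩ := hcon
        have := h (p * q) ⟨p, hp, q, hq, rfl⟩
        simp [hp0, hq0] at this)

attribute [local instance] zariski

theorem isClosed_iff {Z : Set P} : IsClosed Z ↔ IsZariskiClosed Z := by
  rw [← isOpen_compl_iff]
  change Zᶜᶜ ∈ {Z : Set P | IsZariskiClosed Z} ↔ _
  rw [compl_compl]
  rfl

/-- The Zariski closure. -/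
def zclosure (Z : Set P) : Set P := closure Z

/-- A projective variety in `P`: an irreducible (in particular non-empty) Zariski closed subset. -/
def IsVariety (Z : Set P) : Prop := IsClosed Z ∧ IsIrreducible Z

/-- The dimension of `Z` (Krull dimension of its Zariski topology; `⊥` for the empty set). -/
def zdim (Z : Set P) : WithBot ℕ∞ := topologicalKrullDim Z

/-- The filter of sets that contain a dense open subset of `Z`: "a general point of `Z` has the
property `p`" is `∀ᶠ x in generic Z, p x`. -/
def generic (Z : Set P) : Filter P where
  sets := {S | ∃ U : Set P, IsOpen U ∧ Z ⊆ closure (U ∩ Z) ∧ U ∩ Z ⊆ S}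
  univ_sets := ⟨Set.univ, isOpen_univ, by simpa using subset_closure, Set.subset_univ _⟩
  sets_of_superset := by
    rintro S T ⟨U, hU, hd, hs⟩ hST
    exact ⟨U, hU, hd, hs.trans hST⟩
  inter_sets := by
    rintro S T ⟨U, hU, hdU, hsU⟩ ⟨V, hV, hdV, hsV⟩
    refine ⟨U ∩ V, hU.inter hV, ?_, fun x hx => ⟨hsU ⟨hx.1.1, hx.2⟩, hsV ⟨hx.1.2, hx.2⟩⟩⟩
    intro x hx
    rw [mem_closure_iff]
    intro O hO hxO
    obtain ⟨y, hyO, hyU, hyZ⟩ := mem_closure_iff.1 (hdU hx) O hO hxO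
    obtain ⟨z, ⟨hzO, hzU⟩, hzV, hzZ⟩ :=
      mem_closure_iff.1 (hdV hyZ) (O ∩ U) (hO.inter hU) ⟨hyO, hyU⟩
    exact ⟨z, hzO, ⟨hzU, hzV⟩, hzZ⟩

theorem mem_generic {Z S : Set P} :
    S ∈ generic Z ↔ ∃ U : Set P, IsOpen U ∧ Z ⊆ closure (U ∩ Z) ∧ U ∩ Z ⊆ S := Iff.rfl

theorem dense_of_irreducible {Z U : Set P} (hZ : IsIrreducible Z) (hU : IsOpen U)
    (h : (U ∩ Z).Nonempty) : Z ⊆ closure (U ∩ Z) := by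
  intro x hx
  rw [mem_closure_iff]
  intro O hO hxO
  obtain ⟨y, hy⟩ := h
  obtain ⟨z, hzZ, hzO, hzU⟩ := hZ.2 O U hO hU ⟨x, hx, hxO⟩ ⟨y, hy.2, hy.1⟩
  exact ⟨z, hzO, hzU, hzZ⟩

theorem generic_neBot {Z : Set P} (hZ : Z.Nonempty) : (generic Z).NeBot := by
  refine ⟨fun h => ?_⟩
  obtain ⟨U, -, hd, hs⟩ := mem_generic.1 (h ▸ mem_bot : (∅ : Set P) ∈ generic Z)
  obtain ⟨x, hx⟩ := hZ
  have := hd hx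
  rw [Set.subset_empty_iff.1 hs, closure_empty] at this
  exact this

/-! ## Function fields and separable morphisms -/

/-- `φ` is a rational function on `Z`: on a dense open subset it is the quotient of two polynomials
in the homogeneous coordinates. -/
def IsRational (Z : Set P) (φ : P → k) : Prop :=
  ∃ p q : MvPolynomial ι k, ∀ᶠ x in generic Z, ∀ v ∈ coords x,
    eval v q ≠ 0 ∧ φ x * eval v q = eval v p

/-- The function field of a variety `Z`: rational functions on `Z`, two of them being identified
if they agree on a dense open subset. -/
def functionField (Z : Set P) : Subring (Germ (generic Z) k) where
  carrier := {g | ∃ φ : P → k, IsRational Z φ ∧ g = (φ : Germ (generic Z) k)}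
  zero_mem' := ⟨0, ⟨0, 1, by simp⟩, rfl⟩
  one_mem' := ⟨1, ⟨1, 1, by simp⟩, rfl⟩
  add_mem' := by
    rintro _ _ ⟨φ, ⟨p, q, h⟩, rfl⟩ ⟨ψ, ⟨p', q', h'⟩, rfl⟩
    refine ⟨φ + ψ, ⟨p * q' + p' * q, q * q', ?_⟩, rfl⟩
    filter_upwards [h, h'] with x hx hx' v hv
    obtain ⟨h1, h2⟩ := hx v hv
    obtain ⟨h3, h4⟩ := hx' v hv
    refine ⟨by simp [h1, h3], ?_⟩
    simp only [map_add, map_mul, ← h2, ← h4, Pi.add_apply]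
    ring
  mul_mem' := by
    rintro _ _ ⟨φ, ⟨p, q, h⟩, rfl⟩ ⟨ψ, ⟨p', q', h'⟩, rfl⟩
    refine ⟨φ * ψ, ⟨p * p', q * q', ?_⟩, rfl⟩
    filter_upwards [h, h'] with x hx hx' v hv
    obtain ⟨h1, h2⟩ := hx v hv
    obtain ⟨h3, h4⟩ := hx' v hv
    refine ⟨by simp [h1, h3], ?_⟩
    simp only [map_mul, ← h2, ← h4, Pi.mul_apply]
    ring
  neg_mem' := by
    rintro _ ⟨φ, ⟨p, q, h⟩, rfl⟩
    refine ⟨-φ, ⟨-p, q, ?_⟩, rfl⟩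
    filter_upwards [h] with x hx v hv
    obtain ⟨h1, h2⟩ := hx v hv
    exact ⟨h1, by simp [← h2]⟩

theorem isField_functionField {Z : Set P} (hZ : IsVariety Z) : IsField (functionField Z) := by
  have hne := generic_neBot hZ.2.1
  refine ⟨⟨0, 1, zero_ne_one⟩, mul_comm, ?_⟩
  rintro ⟨_, φ, ⟨p, q, h⟩, rfl⟩ hφ
  obtain ⟨U, hU, hd, hs⟩ := mem_generic.1 h
  obtain ⟨S, hS⟩ := isClosed_iff.1 hZ.1
  obtain ⟨T, hT⟩ := isClosed_iff.1 hU.isClosed_compl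
  -- the closed subset of `Z` outside which `φ` is a non-vanishing regular function
  set C : Set P := {x | x ∈ Z ∧ (x ∈ Uᶜ ∨ φ x = 0)} with hC
  have hCc : IsClosed C := by
    refine isClosed_iff.2 ⟨S ∪ {r | ∃ t ∈ T, r = t * p}, fun x v hv => ?_⟩
    have key : x ∈ C ↔ x ∈ Z ∧ (x ∈ Uᶜ ∨ eval v p = 0) := by
      rw [hC, Set.mem_ofPred_eq]
      refine and_congr_right fun hxZ => ?_
      by_cases hxU : x ∈ U
      · obtain ⟨h1, h2⟩ := hs ⟨hxU, hxZ⟩ v hv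
        simp [hxU, ← h2, h1]
      · simp [hxU]
    rw [key, hS x v hv, hT x v hv]
    constructor
    · rintro ⟨h1, h2⟩ r (hr | ⟨t, ht, rfl⟩)
      · exact h1 r hr
      · rcases h2 with h2 | h2
        · simp [h2 t ht]
        · simp [h2]
    · intro hr
      refine ⟨fun r h => hr r (Or.inl h), ?_⟩
      by_contra! hcon
      obtain ⟨⟨t, ht, ht0⟩, hp0⟩ := hcon
      have := hr (t * p) (Or.inr ⟨t, ht, rfl⟩)
      simp [ht0, hp0] at this
  have hCne : (Cᶜ ∩ Z).Nonempty := by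
    by_contra hcon
    apply hφ
    refine Subtype.ext (Germ.coe_eq.2 (mem_generic.2 ⟨U, hU, hd, fun x hx => ?_⟩))
    by_contra h0
    refine hcon ⟨x, fun hxC => ?_, hx.2⟩
    rcases hxC.2 with h1 | h1
    · exact h1 hx.1
    · exact h0 h1
  have hev : ∀ᶠ x in generic Z, φ x ≠ 0 := by
    refine mem_generic.2 ⟨Cᶜ, hCc.isOpen_compl, dense_of_irreducible hZ.2 hCc.isOpen_compl hCne,
      fun x hx h0 => hx.1 ⟨hx.2, Or.inr h0⟩⟩
  refine ⟨⟨_, fun x => (φ x)⁻¹, ⟨q, p, ?_⟩, rfl⟩, ?_⟩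
  · filter_upwards [h, hev] with x hx h0 v hv
    obtain ⟨h1, h2⟩ := hx v hv
    refine ⟨by rw [← h2]; exact mul_ne_zero h0 h1, ?_⟩
    rw [← h2, inv_mul_cancel_left₀ h0]
  · refine Subtype.ext (Germ.coe_eq.2 ?_)
    filter_upwards [hev] with x h0
    exact mul_inv_cancel₀ h0

/-- `f` is given by polynomials in the homogeneous coordinates. -/
def IsPolyMap (f : P → Q) : Prop :=
  ∃ F : κ → MvPolynomial ι k, ∀ x : P, ∀ v ∈ coords x, (fun j => eval v (F j)) ∈ coords (f x)

theorem IsPolyMap.continuous {f : P → Q} (hf : IsPolyMap f) : Continuous f := by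
  obtain ⟨F, hF⟩ := hf
  refine continuous_iff_isClosed.2 fun Z hZ => ?_
  obtain ⟨S, hS⟩ := isClosed_iff.1 hZ
  refine isClosed_iff.2 ⟨(fun p => bind₁ F p) '' S, fun x v hv => ?_⟩
  rw [Set.mem_preimage, hS (f x) _ (hF x v hv)]
  simp only [Set.forall_mem_image, eval, eval₂Hom_bind₁]

/-- The (closure of the) image of `Z` under `f`. -/
def imageVariety (f : P → Q) (Z : Set P) : Set Q := zclosure (f '' Z)

theorem IsPolyMap.isVariety {f : P → Q} (hf : IsPolyMap f) {Z : Set P} (hZ : IsVariety Z) :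
    IsVariety (imageVariety f Z) :=
  ⟨isClosed_closure, (hZ.2.image f hf.continuous.continuousOn).closure⟩

theorem IsPolyMap.tendsto {f : P → Q} (hf : IsPolyMap f) {Z : Set P} (hZ : IsVariety Z) :
    Tendsto f (generic Z) (generic (imageVariety f Z)) := by
  intro S hS
  obtain ⟨U, hU, hd, hs⟩ := mem_generic.1 hS
  refine mem_map.2 (mem_generic.2 ⟨f ⁻¹' U, hU.preimage hf.continuous, ?_, fun x hx =>
    hs ⟨hx.1, subset_closure ⟨x, hx.2, rfl⟩⟩⟩)
  refine dense_of_irreducible hZ.2 (hU.preimage hf.continuous) ?_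
  obtain ⟨x, hx⟩ := hZ.2.1
  have h1 : f x ∈ imageVariety f Z := subset_closure ⟨x, hx, rfl⟩
  obtain ⟨y, -, hyU, hyW⟩ := mem_closure_iff.1 (hd h1) Set.univ isOpen_univ trivial
  obtain ⟨_, hzU, z, hz, rfl⟩ := mem_closure_iff.1 hyW U hU hyU
  exact ⟨z, hzU, hz⟩

/-- The homomorphism of function fields `φ ↦ φ ∘ f` induced by `f : Z → f(Z)`. -/
def pullback {f : P → Q} (hf : IsPolyMap f) {Z : Set P} (hZ : IsVariety Z) :
    functionField (imageVariety f Z) →+* functionField Z where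
  toFun g := ⟨g.1.compTendsto f (hf.tendsto hZ), by
    obtain ⟨_, φ, ⟨p, q, h⟩, rfl⟩ := g
    obtain ⟨F, hF⟩ := id hf
    refine ⟨φ ∘ f, ⟨bind₁ F p, bind₁ F q, ?_⟩, rfl⟩
    filter_upwards [(hf.tendsto hZ).eventually h] with x hx v hv
    simp only [eval, eval₂Hom_bind₁]
    exact hx _ (hF x v hv)⟩
  map_one' := rfl
  map_zero' := rfl
  map_mul' := by
    rintro ⟨_, φ, hφ, rfl⟩ ⟨_, ψ, hψ, rfl⟩
    rfl
  map_add' := by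
    rintro ⟨_, φ, hφ, rfl⟩ ⟨_, ψ, hψ, rfl⟩
    rfl

/-- A field extension is separably generated if it has a transcendence basis over which it is
separable algebraic. For finitely generated extensions, this is what separable means. -/
def IsSeparablyGenerated (K L : Type*) [Field K] [Field L] [Algebra K L] : Prop :=
  ∃ s : Set L, IsTranscendenceBasis K ((↑) : s → L) ∧
    Algebra.IsSeparable (IntermediateField.adjoin K s) L

/-- The morphism `f : Z → Q` from the variety `Z` is separable: the function field of `Z` is a
separable extension of the function field of the image of `Z`. -/
def IsSeparableMorphism (f : P → Q) (Z : Set P) : Prop :=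
  ∃ (hf : IsPolyMap f) (hZ : IsVariety Z),
    letI := (isField_functionField hZ).toField
    letI := (isField_functionField (hf.isVariety hZ)).toField
    letI := (pullback hf hZ).toAlgebra
    IsSeparablyGenerated (functionField (imageVariety f Z)) (functionField Z)

/-! ## Tangent spaces of the cone of coordinate vectors -/

/-- The ideal of polynomials in the homogeneous coordinates which vanish on `Z`. -/
def vanishing (Z : Set P) : Ideal (MvPolynomial ι k) where
  carrier := {p | ∀ x ∈ Z, ∀ v ∈ coords x, eval v p = 0}
  zero_mem' := by simp
  add_mem' := by
    intro p q hp hq x hx v hv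
    simp [hp x hx v hv, hq x hx v hv]
  smul_mem' := by
    intro c p hp x hx v hv
    simp [hp x hx v hv]

/-- The Zariski tangent space, at the coordinate vector `v`, of the set of coordinate vectors of
the points of `Z`: the vectors that are killed by the differentials of all equations of `Z`. -/
def coneTangent [Fintype ι] (Z : Set P) (v : ι → k) : Submodule k (ι → k) where
  carrier := {w | ∀ p ∈ vanishing Z, ∑ i, eval v (pderiv i p) * w i = 0}
  zero_mem' := by simp
  add_mem' := by
    intro a b ha hb p hp
    simp [mul_add, Finset.sum_add_distrib, ha p hp, hb p hp]
  smul_mem' := by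
    intro c a ha p hp
    have : ∑ i, eval v (pderiv i p) * (c • a) i = c * ∑ i, eval v (pderiv i p) * a i := by
      rw [Finset.mul_sum]
      exact Finset.sum_congr rfl fun i _ => by simp only [Pi.smul_apply, smul_eq_mul]; ring
    rw [this, ha p hp, mul_zero]

end Zariski

/-! ## Projective space, Grassmannians, products -/

section Spaces

variable (k : Type*) [Field k] (N : ℕ)

/-- The vector space of which `ℙ^N` is the space of lines. -/
abbrev V : Type _ := Fin (N + 1) → k

/-- `ℙ^N`. -/
abbrev PN : Type _ := ℙ k (V k N)

/-- The set of linear subspaces of `V` of dimension `r`, i.e. the Grassmannian `𝔾(r - 1, ℙ^N)` of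
`(r - 1)`-planes in `ℙ^N`. Thus `𝔾(m, ℙ^N)` is `Gr k N (m + 1)`. -/
def Gr (r : ℕ) : Type _ := {L : Submodule k (V k N) // Module.finrank k L = r}

/-- The homogeneous coordinates of a point of `ℙ^N`: the non-zero vectors on the line. -/
instance : HomogCoords k (PN k N) (Fin (N + 1)) where
  coords x := {v | ∃ hv : v ≠ 0, Projectivization.mk k v hv = x}
  coords_nonempty x := ⟨x.rep, x.rep_nonzero, x.mk_rep⟩

/-- The coordinates of a point `L` of the Grassmannian: the `r × (N + 1)` matrices whose rows form a
basis of `L`. Two such matrices differ by an element of `GL_r`, so that the Zariski topology is the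
one of the quotient of the space of matrices of rank `r` by `GL_r`. -/
instance (r : ℕ) : HomogCoords k (Gr k N r) (Fin r × Fin (N + 1)) where
  coords L := {F | Submodule.span k (Set.range fun i : Fin r => fun j => F (i, j)) = L.1}
  coords_nonempty L := by
    let b := (Module.finBasis k L.1).reindex (finCongr L.2)
    refine ⟨fun ij => (b ij.1 : V k N) ij.2, ?_⟩
    have h : Submodule.map L.1.subtype (Submodule.span k (Set.range b)) =
        Submodule.map L.1.subtype ⊤ := congrArg _ b.span_eq
    rw [Submodule.map_span, Submodule.map_top, Submodule.range_subtype, ← Set.range_comp] at h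
    exact h

/-- The coordinates of a point of a product: a coordinate vector for each factor. -/
instance {k P Q : Type*} {ι κ : Type} [HomogCoords k P ι] [HomogCoords k Q κ] :
    HomogCoords k (P × Q) (ι ⊕ κ) where
  coords z := {v | v ∘ Sum.inl ∈ HomogCoords.coords z.1 ∧ v ∘ Sum.inr ∈ HomogCoords.coords z.2}
  coords_nonempty z := by
    obtain ⟨v, hv⟩ := HomogCoords.coords_nonempty z.1
    obtain ⟨w, hw⟩ := HomogCoords.coords_nonempty z.2
    exact ⟨Sum.elim v w, by simpa using hv, by simpa using hw⟩

theorem isPolyMap_fst {k P Q : Type*} {ι κ : Type} [Field k] [HomogCoords k P ι]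
    [HomogCoords k Q κ] : IsPolyMap (Prod.fst : P × Q → P) :=
  ⟨fun i => X (Sum.inl i), fun x v hv => by simpa [Function.comp_def] using hv.1⟩

theorem isPolyMap_snd {k P Q : Type*} {ι κ : Type} [Field k] [HomogCoords k P ι]
    [HomogCoords k Q κ] : IsPolyMap (Prod.snd : P × Q → Q) :=
  ⟨fun i => X (Sum.inr i), fun x v hv => by simpa [Function.comp_def] using hv.2⟩

variable {k N}

/-- The universal family `{(L, x) | x ∈ L}`. -/
def universalFamily (r : ℕ) : Set (Gr k N r × PN k N) := {z | z.2.submodule ≤ z.1.1}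

/-! ## The incidence variety `P_m^X` -/

/-- The linear subspace of `V` whose projectivization is the embedded tangent space `𝕋_x X`. -/
def embTangent (X : Set (PN k N)) (x : PN k N) : Submodule k (V k N) := coneTangent X x.rep

/-- The smooth locus of `X ⊆ ℙ^N`. -/
def smoothLocus (X : Set (PN k N)) : Set (PN k N) :=
  {x ∈ X | ((Module.finrank k (embTangent X x) : ℕ) : WithBot ℕ∞) = zdim X + 1}

/-- `P_m^X`, the closure of the set of `(L, x)` with `x` a smooth point of `X` and `𝕋_x X ⊆ L`.
The `m`-th Gauss map is its first projection. -/
def incidence (X : Set (PN k N)) (m : ℕ) : Set (Gr k N (m + 1) × PN k N) :=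
  zclosure {z | z.2 ∈ smoothLocus X ∧ embTangent X z.2 ≤ z.1.1}

/-! ## The shrinking map -/

variable {r : ℕ}

/-- The tangent space of `Y` at `L`, inside the tangent space `Hom(L, V / L)` of the Grassmannian:
`t` is tangent to `Y` if, for a lift `A` of `t`, moving the vectors of a basis of `L` with
velocity `A` is tangent to the set of bases of the members of `Y`. -/
def grTangent (Y : Set (Gr k N r)) (L : Gr k N r) : Submodule k (L.1 →ₗ[k] V k N ⧸ L.1) where
  carrier := {t | ∃ A : L.1 →ₗ[k] V k N, L.1.mkQ ∘ₗ A = t ∧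
    ∀ b : Module.Basis (Fin r) k L.1,
      (fun ij : Fin r × Fin (N + 1) => A (b ij.1) ij.2) ∈
        coneTangent Y fun ij : Fin r × Fin (N + 1) => (b ij.1 : V k N) ij.2}
  zero_mem' := ⟨0, LinearMap.comp_zero _, fun _ => Submodule.zero_mem _⟩
  add_mem' := by
    rintro _ _ ⟨A, rfl, hA⟩ ⟨B, rfl, hB⟩
    exact ⟨A + B, LinearMap.comp_add _ _ _, fun b => Submodule.add_mem _ (hA b) (hB b)⟩
  smul_mem' := by
    rintro c _ ⟨A, rfl, hA⟩
    exact ⟨c • A, LinearMap.comp_smul _ _ _, fun b => Submodule.smul_mem _ c (hA b)⟩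

/-- The smooth locus of `Y`. -/
def grSmoothLocus (Y : Set (Gr k N r)) : Set (Gr k N r) :=
  {L ∈ Y | ((Module.finrank k (grTangent Y L) : ℕ) : WithBot ℕ∞) = zdim Y}

/-- The fibre at `L ∈ Y` of the homomorphism `Φ : 𝒬^∨ → Hom(T_Y, 𝒮^∨)` for the inclusion of `Y`
into the Grassmannian. The fibres of `𝒬^∨` and `𝒮^∨` are `L` and `V / L`, and
`Φ(w) = (t ↦ t(w))`. -/
def Phi (Y : Set (Gr k N r)) (L : Gr k N r) : L.1 →ₗ[k] grTangent Y L →ₗ[k] V k N ⧸ L.1 :=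
  (grTangent Y L).subtype.flip

/-- The kernel of `Φ` at `L`, as a subspace of `V`. -/
def kerPhi (Y : Set (Gr k N r)) (L : Gr k N r) : Submodule k (V k N) :=
  (LinearMap.ker (Phi Y L)).map L.1.subtype

/-- The number `m⁻ + 1`, i.e. the dimension of the kernel of `Φ` at a general point of `Y` (the
set is a singleton when `Y` is a variety). -/
def shrinkRank (Y : Set (Gr k N r)) : ℕ :=
  sInf {d | ∀ᶠ L in generic Y, Module.finrank k (kerPhi Y L) = d}

/-- The open subset of the smooth locus of `Y` on which the shrinking map is defined. -/
def shrinkDomain (Y : Set (Gr k N r)) : Set (Gr k N r) :=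
  {L ∈ grSmoothLocus Y | Module.finrank k (kerPhi Y L) = shrinkRank Y}

/-- The shrinking map `σ_Y : Y ⇢ 𝔾(m⁻, ℙ^N)`. -/
def shrinkingMap (Y : Set (Gr k N r)) (L : shrinkDomain Y) : Gr k N (shrinkRank Y) :=
  ⟨kerPhi Y L, L.2.2⟩

/-- The pull-back `σ_Y^* 𝒰` of the universal family of `𝔾(m⁻, ℙ^N)`, i.e. the closure of the
pull-back to the domain of `σ_Y`. -/
def shrinkPullback (Y : Set (Gr k N r)) : Set (Gr k N r × PN k N) :=
  zclosure {z | ∃ h : z.1 ∈ shrinkDomain Y,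
    (shrinkingMap Y ⟨z.1, h⟩, z.2) ∈ universalFamily (shrinkRank Y)}

end Spaces

end GaussMap

end

open GaussMap

/-!
The proof works with tangent spaces at general points. All points are described by matrices of
homogeneous coordinates, up to block diagonal changes of basis (`Rows`), and tangent vectors are
points with values in the dual numbers (`isPt_dual`).

The facts about varieties that are needed are the following.
* The dimension of a variety is the transcendence degree of its function field (`Rows.zdim_eq`), and
  at a general point the tangent space has this dimension
  (`Rows.eventually_finrank_coneTangent`). This is proved at the generic point, where tangent
  vectors are derivations of the function field, and transferred to general points since the rank
  of a matrix of polynomials is generically constant.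
* A projection is separable if and only if its differential is surjective at general points
  (`Rows.RowMap.isSeparableMorphism_iff`): in any characteristic, a finitely generated extension
  is separably generated if and only if the dimension of its Kähler differentials is its
  transcendence degree.
* Projections along Grassmannians are closed (`Rows.isClosed_fst_image`), by specialization along a
  valuation ring.

Write `P` for the incidence variety and `S` for the pull-back of the universal family along the
shrinking map. Both are parametrized locally by polynomial families over open sets of `X` and of
`Y` (`LocalFamily`). Hence they are irreducible (`S` unless it is empty), the projections `P → X`
and `S → Y` are separable with dense image, and the dimension of `P` is the one in the third
condition (`dimN_incidence`). Thus `P = S` implies the other two conditions.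

Let `(L, x)` be a general point of `P`, and suppose that `P → Y` is dominant and separable. Every
tangent vector of `Y` at `L` lifts to `P`; the velocity of `x` is then in `𝕋_x X ⊆ L`, so that
`x` is in the kernel of `Φ` (`mem_shrinkFamily_of_map_restr`). Hence `P ⊆ S`. Conversely, the kernel
of `Φ` is contained in `𝕋_x X` because `L` may be moved freely as long as it contains `𝕋_x X`
(`kerPhi_le_embTangent`; here `L ≠ V` is used), and it is tangent to the fibre of `P → Y` because
the second fundamental form of `X` is symmetric (`rowComb_sub_mem`, `elim_zero_mem_coneTangent`).
Therefore `dim S ≤ dim P`, and `P = S`.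

Finally, suppose that `S → X` is dominant and separable, and let `(L, x)` be a general point of `S`.
Every tangent vector of `X` at `x` is the velocity of `x` for a motion of `(L, x)` in `S`. Since `x`
is in the kernel of `Φ`, it stays in `L` to first order, so that `𝕋_x X ⊆ L`
(`shrinkPullback_subset_incidence`). Hence `S ⊆ P`, with equality if the dimensions agree.
-/

open MvPolynomial Filter
open scoped LinearAlgebra.Projectivization

noncomputable section

set_option linter.unusedSectionVars false

namespace GaussMap

open HomogCoords

attribute [local instance] zariski

/-! ### Dimension, differentials and separability of finitely generated extensions -/

/-- Integral injective extensions preserve the Krull dimension, by going up and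
incomparability. -/
theorem ringKrullDim_eq_of_integral (B A : Type*) [CommRing B] [CommRing A] [Algebra B A]
    [IsDomain A] [Algebra.IsIntegral B A] (hinj : Function.Injective (algebraMap B A)) :
    ringKrullDim A = ringKrullDim B := by
  apply le_antisymm
  · refine Order.krullDim_le_of_strictMono (PrimeSpectrum.comap (algebraMap B A)) ?_
    intro P Q hPQ
    have h : P.asIdeal < Q.asIdeal := hPQ
    have := Ideal.IsIntegral.comap_lt_comap (R := B) h
    exact this
  · refine iSup_le fun l => ?_
    obtain ⟨P, hP, hPl⟩ := Ideal.exists_ideal_over_prime_of_isIntegral_of_isDomain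
      (S := A) (RelSeries.head l).asIdeal (by
        rw [(RingHom.injective_iff_ker_eq_bot _).1 hinj]; exact bot_le)
    have : P.LiesOver (RelSeries.head l).asIdeal := ⟨hPl.symm⟩
    obtain ⟨L, hL, -, -⟩ := Ideal.exists_ltSeries_of_hasGoingUp l P
    rw [← hL]
    exact le_iSup (fun p : LTSeries (PrimeSpectrum A) => ((p.length : ℕ) : WithBot ℕ∞)) L

/-- The Krull dimension of an affine domain is its transcendence degree. -/
theorem ringKrullDim_eq_trdeg (k A : Type*) [Field k] [CommRing A] [IsDomain A] [Algebra k A]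
    [Algebra.FiniteType k A] :
    ringKrullDim A = ((Cardinal.toNat (Algebra.trdeg k A) : ℕ) : WithBot ℕ∞) := by
  obtain ⟨s, g, hg, hint⟩ := exists_integral_inj_algHom_of_fg k A
  let _ := g.toRingHom.toAlgebra
  have : IsScalarTower k (MvPolynomial (Fin s) k) A := .of_algebraMap_eq fun x =>
    (g.commutes x).symm
  have hI : Algebra.IsIntegral (MvPolynomial (Fin s) k) A := ⟨hint⟩
  have hinj : Function.Injective (algebraMap (MvPolynomial (Fin s) k) A) := hg
  have hF : FaithfulSMul (MvPolynomial (Fin s) k) A :=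
    (faithfulSMul_iff_algebraMap_injective _ _).2 hg
  rw [ringKrullDim_eq_of_integral _ _ hinj, MvPolynomial.ringKrullDim_of_isNoetherianRing,
    ringKrullDim_eq_zero_of_field]
  have h := lift_trdeg_add_eq k (MvPolynomial (Fin s) k) A
  rw [MvPolynomial.trdeg_of_isDomain,
    _root_.trdeg_eq_zero] at h
  simp only [Cardinal.mk_fin, Cardinal.lift_natCast, Cardinal.lift_zero, add_zero] at h
  have h2 := congrArg Cardinal.toNat h
  simp only [Cardinal.toNat_lift, Cardinal.toNat_natCast] at h2
  simp [← h2]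

open scoped IntermediateField.algebraAdjoinAdjoin in
/-- The Kähler differentials of a separably generated extension have the transcendence degree
as their dimension: the extension is formally étale over a polynomial ring. -/
theorem finrank_kaehler_of_separable {K L : Type*} [Field K] [Field L] [Algebra K L]
    {s : Set L} (hs : IsTranscendenceBasis K ((↑) : s → L))
    (hsep : Algebra.IsSeparable (IntermediateField.adjoin K s) L) :
    Module.finrank L (Ω[L⁄K]) = Cardinal.toNat (Algebra.trdeg K L) := by
  have hb := hs.1
  let S := Algebra.adjoin K (Set.range ((↑) : s → L))
  have hr : Set.range ((↑) : s → L) = s := Subtype.range_coe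
  rw [← hr] at hsep
  let F := IntermediateField.adjoin K (Set.range ((↑) : s → L))
  let _ : Algebra (MvPolynomial s K) S := hb.aevalEquiv.toRingHom.toAlgebra
  have e : MvPolynomial s K ≃ₐ[MvPolynomial s K] S :=
    AlgEquiv.ofRingEquiv (f := hb.aevalEquiv.toRingEquiv) fun x => rfl
  let _ : Algebra (MvPolynomial s K) F :=
    ((algebraMap S F).comp (algebraMap (MvPolynomial s K) S)).toAlgebra
  let _ : Algebra (MvPolynomial s K) L :=
    ((algebraMap S L).comp (algebraMap (MvPolynomial s K) S)).toAlgebra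
  have t1 : IsScalarTower (MvPolynomial s K) S F := .of_algebraMap_eq fun _ => rfl
  have t2 : IsScalarTower (MvPolynomial s K) F L := .of_algebraMap_eq fun _ => rfl
  have t3 : IsScalarTower K (MvPolynomial s K) L := .of_algebraMap_eq fun x => by
    change _ = ((hb.aevalEquiv (algebraMap K _ x) : S) : L)
    rw [AlgEquiv.commutes]; rfl
  -- `L` is formally étale over `K[s]` through the localization `F = K(s)` of `S = K[s]`
  have e1 : Algebra.FormallyEtale (MvPolynomial s K) S := .of_equiv e
  have e2 : Algebra.FormallyEtale S F := .of_isLocalization (nonZeroDivisors _)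
  have e3 : Algebra.FormallyEtale F L := Algebra.FormallyEtale.of_isSeparable _ L
  have e4 : Algebra.FormallyEtale (MvPolynomial s K) F := .comp _ S _
  have e5 : Algebra.FormallyEtale (MvPolynomial s K) L := .comp _ F _
  rw [← (KaehlerDifferential.tensorKaehlerEquivOfFormallyEtale K (MvPolynomial s K) L).finrank_eq,
    Module.finrank_eq_nat_card_basis
      (Algebra.TensorProduct.basis L (KaehlerDifferential.mvPolynomialBasis K s)),
    ← hs.cardinalMk_eq_trdeg]
  rfl

theorem finrank_kaehler_of_perfect (K L : Type*) [Field K] [PerfectField K] [Field L]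
    [Algebra K L] [Algebra.EssFiniteType K L] :
    Module.finrank L (Ω[L⁄K]) = Cardinal.toNat (Algebra.trdeg K L) := by
  obtain ⟨s, hs, H⟩ := exists_isTranscendenceBasis_and_isSeparable_of_perfectField K L
  exact finrank_kaehler_of_separable (s := (s : Set L)) hs H

/-- If there are at most as many independent differentials as the transcendence degree, then
elements whose differentials form a basis are a separating transcendence basis. -/
theorem isSeparablyGenerated_of_finrank_kaehler {K L : Type*} [Field K] [Field L] [Algebra K L]
    [Algebra.EssFiniteType K L]
    (h : Module.finrank L (Ω[L⁄K]) ≤ Cardinal.toNat (Algebra.trdeg K L)) :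
    IsSeparablyGenerated K L := by
  obtain ⟨κ, a, -, hspan, hli⟩ := exists_linearIndependent' L (KaehlerDifferential.D K L)
  rw [KaehlerDifferential.span_range_derivation] at hspan
  have hfin : Finite κ := hli.finite
  have hcard : Nat.card κ = Module.finrank L (Ω[L⁄K]) :=
    (Module.finrank_eq_nat_card_basis (Module.Basis.mk hli hspan.ge)).symm
  -- the differentials of the `a i` form a basis, so that `L` is unramified over `F = K(a)`
  let F := IntermediateField.adjoin K (Set.range a)
  have hu : Algebra.FormallyUnramified F L := by
    refine ⟨?_⟩
    have htop : (⊤ : Submodule L (Ω[L⁄F])) = ⊥ := by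
      rw [← LinearMap.range_eq_top.2 (KaehlerDifferential.map_surjective K F L),
        LinearMap.range_eq_map, ← hspan, Submodule.map_span, Submodule.span_eq_bot]
      rintro _ ⟨_, ⟨i, rfl⟩, rfl⟩
      have hi : a i ∈ F := IntermediateField.subset_adjoin K _ ⟨i, rfl⟩
      rw [Function.comp_apply, KaehlerDifferential.map_D]
      exact (KaehlerDifferential.D F L).map_algebraMap ⟨a i, hi⟩
    exact (Submodule.subsingleton_iff L).1 (subsingleton_of_bot_eq_top htop.symm)
  have hess : Algebra.EssFiniteType F L := Algebra.EssFiniteType.of_comp K F L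
  have hsep : Algebra.IsSeparable F L := Algebra.FormallyUnramified.isSeparable F L
  have halg : Algebra.IsAlgebraic (Algebra.adjoin K (Set.range a)) L := by
    refine ⟨fun x => ?_⟩
    have := (Algebra.IsSeparable.isAlgebraic F L).isAlgebraic x
    exact IntermediateField.isAlgebraic_adjoin_iff.1 this
  have hbas : IsTranscendenceBasis K a := by
    refine Algebra.IsAlgebraic.isTranscendenceBasis_of_lift_le_trdeg_of_finite K _ ?_
    rw [Cardinal.lift_id, Cardinal.lift_id,
      ← Cardinal.cast_toNat_of_lt_aleph0 (Cardinal.mk_lt_aleph0 (α := κ)),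
      ← Cardinal.cast_toNat_of_lt_aleph0 (trdeg_lt_aleph0 K L)]
    exact Nat.cast_le.2 (hcard.le.trans h)
  refine ⟨Set.range a, ?_, hsep⟩
  exact hbas.to_subtype_range

theorem finrank_derivation (K L : Type*) [Field K] [Field L] [Algebra K L]
    [Algebra.EssFiniteType K L] :
    Module.finrank L (Derivation K L L) = Module.finrank L (Ω[L⁄K]) := by
  rw [← (KaehlerDifferential.linearMapEquivDerivation K L (M := L)).finrank_eq]
  exact Subspace.dual_finrank_eq

/-! ### Derivations and dual numbers -/

open TrivSqZeroExt in
/-- Evaluation at a point with values in the dual numbers is evaluation together with the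
directional derivative. -/
theorem aeval_dualNumber {k A ι : Type*} [Field k] [CommRing A] [Algebra k A] [Fintype ι]
    (v w : ι → A) (p : MvPolynomial ι k) :
    aeval (fun i => (inl (v i) + inr (w i) : DualNumber A)) p =
      inl (aeval v p) + inr (∑ i, aeval v (pderiv i p) * w i) := by
  classical
  induction p using MvPolynomial.induction_on with
  | C a => simp [TrivSqZeroExt.algebraMap_eq_inl']
  | add p q hp hq =>
    rw [map_add, hp, hq]
    ext <;> simp [add_mul, Finset.sum_add_distrib]
  | mul_X p j hp =>
    rw [map_mul, hp, aeval_X]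
    ext
    · simp
    · simp only [snd_mul, fst_add, fst_inl, fst_inr, snd_add, snd_inl, snd_inr, add_zero, zero_add,
        Derivation.leibniz, map_add, smul_eq_mul, map_mul, aeval_X, pderiv_X, add_mul,
        Finset.sum_add_distrib, MulOpposite.smul_eq_mul_unop, MulOpposite.unop_op, Finset.sum_mul]
      congr 1
      · rw [Finset.sum_eq_single j]
        · simp
        · intro b _ hb; simp [Ne.symm hb]
        · simp
      · rw [zero_mul, zero_add]
        exact Finset.sum_congr rfl fun i _ => by ring

/-- The values of a derivation at polynomial expressions. -/
theorem derivation_aeval {k K M ι : Type*} [Field k] [CommRing K] [Algebra k K] [Fintype ι]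
    [AddCommGroup M] [Module K M] [Module k M] [IsScalarTower k K M]
    (D : Derivation k K M) (ξ : ι → K) (p : MvPolynomial ι k) :
    D (aeval ξ p) = ∑ i, aeval ξ (pderiv i p) • D (ξ i) := by
  classical
  induction p using MvPolynomial.induction_on with
  | C a => simp
  | add p q hp hq => simp [hp, hq, add_smul, Finset.sum_add_distrib]
  | mul_X p j hp =>
    simp only [map_mul, aeval_X, Derivation.leibniz, hp, map_add, smul_eq_mul, pderiv_X, add_smul,
      Finset.sum_add_distrib, Finset.smul_sum, smul_smul]
    congr 1
    rw [Finset.sum_eq_single j]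
    · simp
    · intro b _ hb; simp [Ne.symm hb]
    · simp

/-- A vector killed by the differentials of all relations between generators of a field extension
is the vector of values of a derivation. -/
theorem exists_derivation {k K ι : Type*} [Field k] [Field K] [Algebra k K] [Fintype ι]
    {ξ : ι → K} (hξ : IntermediateField.adjoin k (Set.range ξ) = ⊤) (w : ι → K)
    (hw : ∀ p : MvPolynomial ι k, aeval ξ p = 0 → ∑ i, aeval ξ (pderiv i p) * w i = 0) :
    ∃ D : Derivation k K K, ∀ i, D (ξ i) = w i := by
  let S := (aeval (R := k) ξ).range
  have hfrac : IsFractionRing S K := by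
    refine IsFractionRing.of_field S K fun z => ?_
    have hz : z ∈ IntermediateField.adjoin k (Set.range ξ) := by rw [hξ]; trivial
    obtain ⟨r, s, h⟩ := (IntermediateField.mem_adjoin_range_iff k ξ z).1 hz
    exact ⟨⟨aeval ξ r, r, rfl⟩, ⟨aeval ξ s, s, rfl⟩, h⟩
  -- the homomorphism `p ↦ p(ξ + ε w)` to the dual numbers factors through the image `S` of
  -- `p ↦ p(ξ)` and extends to its field of fractions `K`; the `ε`-component of the extension is the
  -- derivation
  let φ : MvPolynomial ι k →ₐ[k] DualNumber K :=
    aeval fun i => TrivSqZeroExt.inl (ξ i) + TrivSqZeroExt.inr (w i)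
  have hφ : ∀ p, φ p = TrivSqZeroExt.inl (aeval ξ p) +
      TrivSqZeroExt.inr (∑ i, aeval ξ (pderiv i p) * w i) := aeval_dualNumber ξ w
  let ρ : MvPolynomial ι k →+* S := (aeval (R := k) ξ).rangeRestrict.toRingHom
  have hρ : Function.Surjective ρ := (aeval (R := k) ξ).rangeRestrict_surjective
  have hker : RingHom.ker ρ ≤ RingHom.ker φ.toRingHom := by
    intro p hp
    have hp' : aeval ξ p = 0 := congrArg Subtype.val (RingHom.mem_ker.1 hp)
    change φ p = 0
    rw [hφ, hp', hw p hp']; simp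
  let ψ : S →+* DualNumber K := RingHom.liftOfSurjective ρ hρ ⟨φ.toRingHom, hker⟩
  have hψ : ∀ p, ψ (ρ p) = φ p := fun p => RingHom.liftOfRightInverse_comp_apply ..
  have hfst : ∀ x : S, (ψ x).fst = algebraMap S K x := by
    intro x
    obtain ⟨p, rfl⟩ := hρ x
    rw [hψ, hφ]; simp; rfl
  have hunit : ∀ y : nonZeroDivisors S, IsUnit (ψ y) := by
    intro y
    rw [TrivSqZeroExt.isUnit_iff_isUnit_fst, hfst]
    exact (IsLocalization.map_units K y)
  let Ψ : K →+* DualNumber K := IsLocalization.lift hunit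
  have hΨS : ∀ x : S, Ψ (algebraMap S K x) = ψ x := fun x => IsLocalization.lift_eq hunit x
  have hΨfst : ∀ x : K, (Ψ x).fst = x := by
    have : ((TrivSqZeroExt.fstHom K K K).toRingHom.comp Ψ) = RingHom.id K := by
      refine IsLocalization.ringHom_ext (nonZeroDivisors S) (RingHom.ext fun x => ?_)
      change (Ψ (algebraMap S K x)).fst = algebraMap S K x
      rw [hΨS, hfst]
    intro x
    exact congrArg (fun f : K →+* K => f x) this
  have hΨp : ∀ p : MvPolynomial ι k, Ψ (aeval ξ p) = φ p := fun p => by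
    rw [← hψ]; exact hΨS (ρ p)
  have hΨk : ∀ c : k, Ψ (algebraMap k K c) = TrivSqZeroExt.inl (algebraMap k K c) := by
    intro c
    have := hΨp (C c)
    rw [hφ] at this
    simpa using this
  let D : K →ₗ[k] K :=
    { toFun := fun x => (Ψ x).snd
      map_add' := fun x y => by simp
      map_smul' := fun c x => by
        rw [Algebra.smul_def, map_mul, hΨk]
        simp [Algebra.smul_def] }
  refine ⟨Derivation.mk' D fun a b => ?_, fun i => ?_⟩
  · change (Ψ (a * b)).snd = a • (Ψ b).snd + b • (Ψ a).snd
    rw [map_mul, TrivSqZeroExt.snd_mul, hΨfst, hΨfst]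
    simp [mul_comm]
  · change (Ψ (ξ i)).snd = w i
    have := hΨp (X i)
    rw [aeval_X] at this
    rw [this]
    simp [φ]

section Points

variable {k P Q : Type*} {ι κ : Type} [Field k] [HomogCoords k P ι] [HomogCoords k Q κ]

/-! ### Points with values in an algebra -/

/-- A point, with values in a `k`-algebra `A`, of the closure of the cone of coordinate vectors of
the points of `Z`. -/
def IsPt (Z : Set P) {A : Type*} [CommRing A] [Algebra k A] (v : ι → A) : Prop :=
  ∀ p ∈ vanishing Z, aeval v p = 0

theorem IsPt.map {Z : Set P} {A B : Type*} [CommRing A] [Algebra k A] [CommRing B] [Algebra k B]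
    {v : ι → A} (hv : IsPt Z v) (f : A →ₐ[k] B) : IsPt Z fun i => f (v i) := fun p hp => by
  rw [← MvPolynomial.comp_aeval_apply, hv p hp, map_zero]

theorem isPt_of_mem {Z : Set P} {x : P} (hx : x ∈ Z) {v : ι → k} (hv : v ∈ coords x) :
    IsPt Z v := fun p hp => by
  rw [MvPolynomial.aeval_eq_eval]; exact hp x hx v hv

theorem IsPt.mem {Z : Set P} (hZ : IsClosed Z) {x : P} {v : ι → k} (hv : v ∈ coords x)
    (h : IsPt Z v) : x ∈ Z := by
  obtain ⟨S, hS⟩ := isClosed_iff.1 hZ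
  refine (hS x v hv).2 fun p hp => ?_
  have := h p fun y hy w hw => (hS y w hw).1 hy p hp
  rwa [MvPolynomial.aeval_eq_eval] at this

theorem vanishing_anti {Z W : Set P} (h : Z ⊆ W) : vanishing W ≤ vanishing Z :=
  fun _ hp x hx => hp x (h hx)

theorem aeval_sumElim {τ κ : Type} {A : Type*} [CommRing A] [Algebra k A] (s : τ → A) (u : κ → A)
    (q : MvPolynomial (τ ⊕ κ) k) :
    aeval (Sum.elim s u) q =
      eval₂ (aeval u : MvPolynomial κ k →ₐ[k] A).toRingHom s (sumAlgEquiv k τ κ q) := by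
  induction q using MvPolynomial.induction_on with
  | C a => simp
  | add p q hp hq => simp [hp, hq]
  | mul_X p i hp =>
    rw [map_mul, map_mul, eval₂_mul, hp]
    congr 1
    rcases i with i | i <;> simp

/-- A polynomial in the coordinates of a point of `Y` and in free parameters which vanishes
for all points and parameters over `k` vanishes over every algebra. -/
theorem IsPt.aeval_eq_zero [Infinite k] {Y : Set Q} {τ : Type} (q : MvPolynomial (τ ⊕ κ) k)
    (hq : ∀ y ∈ Y, ∀ u ∈ coords y, ∀ s : τ → k, eval (Sum.elim s u) q = 0)
    {A : Type*} [CommRing A] [Algebra k A] {u : κ → A} (hu : IsPt Y u) (s : τ → A) :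
    aeval (Sum.elim s u) q = 0 := by
  rw [aeval_sumElim, eval₂_eq]
  refine Finset.sum_eq_zero fun m _ => ?_
  have hm : coeff m (sumAlgEquiv k τ κ q) ∈ vanishing Y := by
    intro y hy u hu
    have h0 : MvPolynomial.map (aeval u : MvPolynomial κ k →ₐ[k] k).toRingHom
        (sumAlgEquiv k τ κ q) = 0 := by
      refine MvPolynomial.funext fun s => ?_
      rw [MvPolynomial.eval_map, ← aeval_sumElim, MvPolynomial.aeval_eq_eval, hq y hy u hu s,
        map_zero]
    have := congrArg (coeff m) h0
    rwa [coeff_map, coeff_zero, AlgHom.toRingHom_eq_coe, RingHom.coe_coe,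
      MvPolynomial.aeval_eq_eval] at this
  rw [AlgHom.toRingHom_eq_coe, RingHom.coe_coe, hu _ hm, zero_mul]

/-- A polynomial family of points of `Z`, parametrized by the points of `Y` and by free parameters
subject to the non-vanishing of `h`, gives points of `Z` over every algebra. -/
theorem IsPt.of_param [Infinite k] {Z : Set P} {Y : Set Q} {τ : Type}
    (Θ : ι → MvPolynomial (τ ⊕ κ) k) (h : MvPolynomial (τ ⊕ κ) k)
    (H : ∀ y ∈ Y, ∀ u ∈ coords y, ∀ s : τ → k, eval (Sum.elim s u) h ≠ 0 →
      ∃ x ∈ Z, (fun i => eval (Sum.elim s u) (Θ i)) ∈ coords x)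
    {A : Type*} [CommRing A] [Algebra k A] {u : κ → A} (hu : IsPt Y u) (s : τ → A)
    (hh : IsUnit (aeval (Sum.elim s u) h)) :
    IsPt Z fun i => aeval (Sum.elim s u) (Θ i) := by
  intro p hp
  have := IsPt.aeval_eq_zero (Y := Y) (h * bind₁ Θ p) ?_ hu s
  · rw [map_mul, aeval_bind₁] at this
    exact (hh.mul_right_eq_zero).1 this
  · intro y hy u hu s
    by_cases h0 : eval (Sum.elim s u) h = 0
    · rw [map_mul, h0, zero_mul]
    · obtain ⟨x, hx, hc⟩ := H y hy u hu s h0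
      rw [map_mul]
      have := hp x hx _ hc
      simp only [eval, eval₂Hom_bind₁] at this ⊢
      exact mul_eq_zero_of_right _ this

/-! ### Tangent vectors over an algebra -/

section Tangent

/-- The point `v + ε w` with values in the dual numbers. -/
def dual {ι : Type*} {A : Type*} [CommRing A] (v w : ι → A) : ι → DualNumber A :=
  fun i => TrivSqZeroExt.inl (v i) + TrivSqZeroExt.inr (w i)

@[simp] theorem fst_dual {A : Type*} [CommRing A] (v w : ι → A) (i : ι) :
    (dual v w i).fst = v i := by simp [dual]

@[simp] theorem snd_dual {A : Type*} [CommRing A] (v w : ι → A) (i : ι) :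
    (dual v w i).snd = w i := by simp [dual]

theorem dual_fst_snd {A : Type*} [CommRing A] (v : ι → DualNumber A) :
    dual (fun i => (v i).fst) (fun i => (v i).snd) = v := by
  funext i; ext <;> simp

variable [Fintype ι] [Fintype κ]

/-- The Zariski tangent space of the cone over `Z` at a point with values in an algebra. -/
def tangentAt (Z : Set P) {A : Type*} [CommRing A] [Algebra k A] (v : ι → A) :
    Submodule A (ι → A) where
  carrier := {w | ∀ p ∈ vanishing Z, ∑ i, aeval v (pderiv i p) * w i = 0}
  zero_mem' := by simp
  add_mem' := by
    intro a b ha hb p hp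
    simp [mul_add, Finset.sum_add_distrib, ha p hp, hb p hp]
  smul_mem' := by
    intro c a ha p hp
    have : ∑ i, aeval v (pderiv i p) * (c • a) i = c * ∑ i, aeval v (pderiv i p) * a i := by
      rw [Finset.mul_sum]
      exact Finset.sum_congr rfl fun i _ => by simp only [Pi.smul_apply, smul_eq_mul]; ring
    rw [this, ha p hp, mul_zero]

theorem tangentAt_eq_coneTangent (Z : Set P) (v : ι → k) : tangentAt Z v = coneTangent Z v := by
  ext w
  simp only [tangentAt, coneTangent, MvPolynomial.aeval_eq_eval]

theorem aeval_dual {A : Type*} [CommRing A] [Algebra k A] (v w : ι → A) (p : MvPolynomial ι k) :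
    aeval (dual v w) p =
      TrivSqZeroExt.inl (aeval v p) + TrivSqZeroExt.inr (∑ i, aeval v (pderiv i p) * w i) :=
  aeval_dualNumber v w p

/-- Tangent vectors are points with values in the dual numbers. -/
theorem isPt_dual {Z : Set P} {A : Type*} [CommRing A] [Algebra k A] {v w : ι → A} :
    IsPt Z (dual v w) ↔ IsPt Z v ∧ w ∈ tangentAt Z v := by
  constructor
  · intro h
    refine ⟨fun p hp => ?_, fun p hp => ?_⟩
    · simpa [aeval_dual] using congrArg TrivSqZeroExt.fst (h p hp)
    · simpa [aeval_dual] using congrArg TrivSqZeroExt.snd (h p hp)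
  · rintro ⟨h1, h2⟩ p hp
    rw [aeval_dual, h1 p hp, h2 p hp]; simp

end Tangent

end Points

/-! ### Block matrices acting on rows -/

section Block

variable {R C ι : Type} [Fintype R] [DecidableEq R] {A : Type*} [CommRing A]

/-- A coordinate vector as a matrix. -/
def matOf (e : ι ≃ R × C) (v : ι → A) : Matrix R C A := Matrix.of fun i c => v (e.symm (i, c))

/-- The action of square matrices on coordinate vectors. -/
def actOn (e : ι ≃ R × C) (B : Matrix R R A) (v : ι → A) : ι → A :=
  fun a => (B * matOf e v) (e a).1 (e a).2

@[simp] theorem matOf_actOn (e : ι ≃ R × C) (B : Matrix R R A) (v : ι → A) :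
    matOf e (actOn e B v) = B * matOf e v := by
  ext i c; simp [matOf, actOn]

theorem matOf_injective (e : ι ≃ R × C) :
    Function.Injective (matOf e : (ι → A) → Matrix R C A) := by
  intro v w h
  funext a
  have := congrFun (congrFun h (e a).1) (e a).2
  simpa [matOf] using this

theorem actOn_mul (e : ι ≃ R × C) (B B' : Matrix R R A) (v : ι → A) :
    actOn e (B * B') v = actOn e B (actOn e B' v) :=
  matOf_injective e (by simp [Matrix.mul_assoc])

theorem actOn_one (e : ι ≃ R × C) (v : ι → A) : actOn e 1 v = v :=
  matOf_injective e (by simp)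

theorem actOn_add (e : ι ≃ R × C) (B B' : Matrix R R A) (v : ι → A) :
    actOn e (B + B') v = actOn e B v + actOn e B' v := by
  funext a; simp [actOn, Matrix.add_mul]

theorem actOn_smul (e : ι ≃ R × C) (c : A) (B : Matrix R R A) (v : ι → A) :
    actOn e (c • B) v = c • actOn e B v := by
  funext a; simp [actOn]

theorem actOn_apply (e : ι ≃ R × C) (B : Matrix R R A) (v : ι → A) (a : ι) :
    actOn e B v a = ∑ l, B (e a).1 l * v (e.symm (l, (e a).2)) := by
  simp [actOn, Matrix.mul_apply, matOf]

/-- The matrix is block diagonal, the blocks being the fibres of `lbl`. -/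
def IsBlock (lbl : R → ℕ) (B : Matrix R R A) : Prop := ∀ i j, lbl i ≠ lbl j → B i j = 0

/-- The block diagonal part of the square matrix of the columns selected by `J`. -/
def blockOf (lbl : R → ℕ) (J : R → C) (M : Matrix R C A) : Matrix R R A :=
  Matrix.of fun i l => if lbl i = lbl l then M i (J l) else 0

theorem isBlock_blockOf (lbl : R → ℕ) (J : R → C) (M : Matrix R C A) :
    IsBlock lbl (blockOf lbl J M) := fun i j h => by simp [blockOf, h]

theorem IsBlock.blockOf_mul {lbl : R → ℕ} {B : Matrix R R A} (hB : IsBlock lbl B) (J : R → C)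
    (M : Matrix R C A) : blockOf lbl J (B * M) = B * blockOf lbl J M := by
  ext i l
  simp only [blockOf, Matrix.of_apply, Matrix.mul_apply]
  split_ifs with h
  · refine Finset.sum_congr rfl fun j _ => ?_
    by_cases hj : lbl i = lbl j
    · rw [if_pos (hj.symm.trans h)]
    · rw [hB i j hj, zero_mul, zero_mul]
  · refine (Finset.sum_eq_zero fun j _ => ?_).symm
    by_cases hj : lbl i = lbl j
    · rw [if_neg (fun h' => h (hj.trans h')), mul_zero]
    · rw [hB i j hj, zero_mul]

theorem IsBlock.one (lbl : R → ℕ) : IsBlock lbl (1 : Matrix R R A) := fun _ _ h =>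
  Matrix.one_apply_ne fun h' => h (h' ▸ rfl)

theorem IsBlock.map {lbl : R → ℕ} {B : Matrix R R A} (hB : IsBlock lbl B) {A' : Type*}
    [CommRing A'] (f : A →+* A') : IsBlock lbl (B.map f) := fun i j h => by
  rw [Matrix.map_apply, hB i j h, map_zero]

/-- A block diagonal matrix commutes with the projections to the blocks, and so does its
inverse. -/
theorem IsBlock.inv {lbl : R → ℕ} {B : Matrix R R A} (hB : IsBlock lbl B)
    (hu : IsUnit B.det) : IsBlock lbl B⁻¹ := fun i j h => by
  let D : Matrix R R A := Matrix.diagonal fun l => if lbl l = lbl i then 1 else 0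
  have hDB : D * B = B * D := by
    ext a b
    rw [Matrix.diagonal_mul, Matrix.mul_diagonal]
    by_cases hab : lbl a = lbl b
    · rw [hab, mul_comm]
    · rw [hB a b hab, mul_zero, zero_mul]
  have h1 : D * B⁻¹ = B⁻¹ * D := by
    calc D * B⁻¹ = B⁻¹ * (B * D) * B⁻¹ := by
          rw [← Matrix.mul_assoc, Matrix.nonsing_inv_mul _ hu, Matrix.one_mul]
      _ = B⁻¹ * D := by
          rw [← hDB, Matrix.mul_assoc, Matrix.mul_assoc, Matrix.mul_nonsing_inv _ hu,
            Matrix.mul_one]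
  have h2 := congrFun (congrFun h1 i) j
  rw [Matrix.diagonal_mul, Matrix.mul_diagonal, if_pos rfl, if_neg (Ne.symm h), one_mul,
    mul_zero] at h2
  exact h2

end Block

/-! ### Coordinate vectors as matrices -/

/-- A description of the coordinate vectors of the points of `P` as matrices with rows `R` and
columns `C`, determined up to an invertible block diagonal matrix acting on the rows. The blocks
are the fibres of `lbl`; for a product of Grassmannians there is one block for each factor. -/
structure Rows (P : Type*) {k : Type*} {ι : Type} [Field k] [HomogCoords k P ι] (R C : Type)
    [Fintype R] [DecidableEq R] where
  /-- The block of a row. -/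
  lbl : R → ℕ
  /-- The coordinates as entries of a matrix. -/
  idx : ι ≃ R × C
  coords_iff : ∀ (x : P) (v w : ι → k), v ∈ coords x →
    (w ∈ coords x ↔ ∃ B : Matrix R R k, IsBlock lbl B ∧ IsUnit B.det ∧ w = actOn idx B v)
  exists_chart : ∀ (x : P) (v : ι → k), v ∈ coords x →
    ∃ J : R → C, IsUnit (blockOf lbl J (matOf idx v)).det
  exists_point : ∀ (J : R → C) (v : ι → k), IsUnit (blockOf lbl J (matOf idx v)).det →
    ∃ x : P, v ∈ coords x

namespace Rows

variable {k P Q : Type*} {ι κ : Type} [Field k] [HomogCoords k P ι] [HomogCoords k Q κ]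
  {R C : Type} [Fintype R] [DecidableEq R] (ρ : Rows P R C)

/-- The block diagonal part of the square matrix formed by the columns in `J`. -/
def N (J : R → C) {A : Type*} [CommRing A] (v : ι → A) : Matrix R R A :=
  blockOf ρ.lbl J (matOf ρ.idx v)

/-- The action of square matrices on coordinate vectors. -/
def act {A : Type*} [CommRing A] (B : Matrix R R A) (v : ι → A) : ι → A := actOn ρ.idx B v

/-- The coordinate vector of the same point in which the columns in `J` are normalized. It is
meaningful if the determinant of `N` is a unit. -/
def nrm (J : R → C) {A : Type*} [CommRing A] (v : ι → A) : ι → A := ρ.act (ρ.N J v)⁻¹ v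

theorem act_mem {x : P} {v : ι → k} (hv : v ∈ coords x) {B : Matrix R R k}
    (hB : IsBlock ρ.lbl B) (hu : IsUnit B.det) : ρ.act B v ∈ coords x :=
  (ρ.coords_iff x v _ hv).2 ⟨B, hB, hu, rfl⟩

theorem exists_act {x : P} {v w : ι → k} (hv : v ∈ coords x) (hw : w ∈ coords x) :
    ∃ B : Matrix R R k, IsBlock ρ.lbl B ∧ IsUnit B.det ∧ w = ρ.act B v :=
  (ρ.coords_iff x v w hv).1 hw

section ring

variable {A A' : Type*} [CommRing A] [CommRing A'] [Algebra k A] [Algebra k A']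

theorem isBlock_N (J : R → C) (v : ι → A) : IsBlock ρ.lbl (ρ.N J v) := isBlock_blockOf _ _ _

theorem N_act (J : R → C) {B : Matrix R R A} (hB : IsBlock ρ.lbl B) (v : ι → A) :
    ρ.N J (ρ.act B v) = B * ρ.N J v := by
  rw [N, act, matOf_actOn, hB.blockOf_mul]; rfl

theorem N_apply (J : R → C) (v : ι → A) (i l : R) :
    ρ.N J v i l = if ρ.lbl i = ρ.lbl l then v (ρ.idx.symm (i, J l)) else 0 := rfl

theorem N_map (J : R → C) (f : A →+* A') (v : ι → A) :
    ρ.N J (fun i => f (v i)) = (ρ.N J v).map f := by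
  ext i l
  simp only [N_apply, Matrix.map_apply]
  split_ifs <;> simp

theorem act_map (f : A →+* A') (B : Matrix R R A) (v : ι → A) :
    ρ.act (B.map f) (fun i => f (v i)) = fun i => f (ρ.act B v i) := by
  funext a
  simp [act, actOn_apply]

theorem act_act (B B' : Matrix R R A) (v : ι → A) : ρ.act B (ρ.act B' v) = ρ.act (B * B') v :=
  (actOn_mul _ _ _ _).symm

theorem act_one (v : ι → A) : ρ.act 1 v = v := actOn_one _ _

theorem act_inv_act {B : Matrix R R A} (hB : IsUnit B.det) (v : ι → A) :
    ρ.act B⁻¹ (ρ.act B v) = v := by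
  rw [act_act, Matrix.nonsing_inv_mul _ hB, act_one]

theorem act_add (B : Matrix R R A) (v w : ι → A) :
    ρ.act B (v + w) = ρ.act B v + ρ.act B w := by
  funext a
  simp [act, actOn_apply, mul_add, Finset.sum_add_distrib]

theorem N_nrm {J : R → C} {v : ι → A} (h : IsUnit (ρ.N J v).det) : ρ.N J (ρ.nrm J v) = 1 := by
  rw [nrm, ρ.N_act J ((ρ.isBlock_N J v).inv h), Matrix.nonsing_inv_mul _ h]

theorem isUnit_det_inv {B : Matrix R R A} (h : IsUnit B.det) : IsUnit B⁻¹.det := by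
  exact Matrix.isUnit_nonsing_inv_det _ h

theorem nrm_act {J : R → C} {v : ι → A} {B : Matrix R R A} (hB : IsBlock ρ.lbl B)
    (hu : IsUnit B.det) : ρ.nrm J (ρ.act B v) = ρ.nrm J v := by
  rw [nrm, ρ.N_act J hB, act_act, Matrix.mul_inv_rev, Matrix.mul_assoc,
    Matrix.nonsing_inv_mul _ hu, Matrix.mul_one]
  rfl

theorem nrm_of_N_eq_one {J : R → C} {v : ι → A} (h : ρ.N J v = 1) : ρ.nrm J v = v := by
  rw [nrm, h, inv_one, act_one]

end ring

theorem nrm_mem {J : R → C} {x : P} {v : ι → k} (hv : v ∈ coords x)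
    (h : IsUnit (ρ.N J v).det) : ρ.nrm J v ∈ coords x :=
  ρ.act_mem hv ((ρ.isBlock_N J v).inv h) (isUnit_det_inv h)

theorem nrm_eq {J : R → C} {x : P} {v w : ι → k} (hv : v ∈ coords x) (hw : w ∈ coords x) :
    ρ.nrm J v = ρ.nrm J w := by
  obtain ⟨B, hB, hu, rfl⟩ := ρ.exists_act hv hw
  rw [ρ.nrm_act hB hu]

theorem isUnit_N_iff {J : R → C} {x : P} {v w : ι → k} (hv : v ∈ coords x) (hw : w ∈ coords x) :
    IsUnit (ρ.N J v).det ↔ IsUnit (ρ.N J w).det := by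
  obtain ⟨B, hB, hu, rfl⟩ := ρ.exists_act hv hw
  rw [ρ.N_act J hB, Matrix.det_mul, IsUnit.mul_iff]
  exact ⟨fun h => ⟨hu, h⟩, fun h => h.2⟩

/-! ### Closed sets defined by arbitrary polynomials -/

/-- The action of a constant matrix as a substitution. -/
def actPoly (B : Matrix R R k) (a : ι) : MvPolynomial ι k :=
  ∑ l, MvPolynomial.C (B (ρ.idx a).1 l) * X (ρ.idx.symm (l, (ρ.idx a).2))

theorem eval_actPoly (B : Matrix R R k) (v : ι → k) (q : MvPolynomial ι k) :
    eval v (bind₁ (ρ.actPoly B) q) = eval (ρ.act B v) q := by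
  have : ρ.act B v = fun a => eval v (ρ.actPoly B a) := by
    funext a; simp [act, actOn_apply, actPoly]
  rw [this]
  simp only [eval, eval₂Hom_bind₁]

/-- The points at all of whose coordinate vectors `q` vanishes form a closed set. -/
theorem isClosed_forall (ρ : Rows P R C) (q : MvPolynomial ι k) :
    IsClosed {x : P | ∀ v ∈ coords x, eval v q = 0} := by
  refine isClosed_iff.2 ⟨{r | ∃ B : Matrix R R k, IsBlock ρ.lbl B ∧ IsUnit B.det ∧
    r = bind₁ (ρ.actPoly B) q}, fun x v hv => ⟨?_, ?_⟩⟩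
  · rintro h _ ⟨B, hB, hu, rfl⟩
    rw [eval_actPoly]
    exact h _ (ρ.act_mem hv hB hu)
  · intro h w hw
    obtain ⟨B, hB, hu, rfl⟩ := ρ.exists_act hv hw
    rw [← eval_actPoly]
    exact h _ ⟨B, hB, hu, rfl⟩

theorem isOpen_exists (ρ : Rows P R C) (q : MvPolynomial ι k) :
    IsOpen {x : P | ∃ v ∈ coords x, eval v q ≠ 0} := by
  have := (ρ.isClosed_forall q).isOpen_compl
  convert! this using 1
  ext x
  simp

theorem vanishing_zclosure (ρ : Rows P R C) (Z : Set P) : vanishing (zclosure Z) = vanishing Z := by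
  refine le_antisymm (vanishing_anti subset_closure) fun p hp x hx => ?_
  have : zclosure Z ⊆ {x : P | ∀ v ∈ coords x, eval v p = 0} :=
    closure_minimal (fun y hy => hp y hy) (ρ.isClosed_forall p)
  exact this hx

theorem isPt_zclosure (ρ : Rows P R C) {Z : Set P} {A : Type*} [CommRing A] [Algebra k A]
    {v : ι → A} :
    IsPt (zclosure Z) v ↔ IsPt Z v := by
  rw [IsPt, IsPt, ρ.vanishing_zclosure]

/-! ### The action on points and tangent vectors -/

/-- The action of a variable block matrix. -/
def actVar (a : ι) : MvPolynomial ((R × R) ⊕ ι) k :=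
  ∑ l, (if ρ.lbl (ρ.idx a).1 = ρ.lbl l then X (Sum.inl ((ρ.idx a).1, l)) else 0) *
    X (Sum.inr (ρ.idx.symm (l, (ρ.idx a).2)))

/-- The determinant of the variable block matrix. -/
def detVar (ρ : Rows P R C) : MvPolynomial ((R × R) ⊕ ι) k :=
  (Matrix.of fun i l : R => (if ρ.lbl i = ρ.lbl l then X (Sum.inl (i, l)) else 0 :
    MvPolynomial ((R × R) ⊕ ι) k)).det

theorem aeval_actVar {A : Type*} [CommRing A] [Algebra k A] {B : Matrix R R A}
    (hB : IsBlock ρ.lbl B) (v : ι → A) :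
    (fun a => aeval (Sum.elim (fun il : R × R => B il.1 il.2) v) (ρ.actVar a)) = ρ.act B v := by
  funext a
  simp only [actVar, map_sum, map_mul, act, actOn_apply, aeval_X, Sum.elim_inr]
  refine Finset.sum_congr rfl fun l _ => ?_
  split_ifs with h
  · simp
  · rw [hB _ _ h]; simp

theorem aeval_detVar {A : Type*} [CommRing A] [Algebra k A] {B : Matrix R R A}
    (hB : IsBlock ρ.lbl B) (v : ι → A) :
    aeval (Sum.elim (fun il : R × R => B il.1 il.2) v) ρ.detVar = B.det := by
  rw [detVar, AlgHom.map_det]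
  congr 1
  ext i l
  simp only [AlgHom.mapMatrix_apply, Matrix.map_apply, Matrix.of_apply]
  split_ifs with h
  · simp
  · rw [hB _ _ h]; simp

theorem isPt_act [Infinite k] {Z : Set P} {A : Type*} [CommRing A] [Algebra k A]
    {B : Matrix R R A} (hB : IsBlock ρ.lbl B) (hu : IsUnit B.det) {v : ι → A} (hv : IsPt Z v) :
    IsPt Z (ρ.act B v) := by
  rw [← ρ.aeval_actVar hB]
  refine IsPt.of_param (Y := Z) ρ.actVar ρ.detVar ?_ hv _ ?_
  · intro y hy u hu s hs
    refine ⟨y, hy, ?_⟩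
    let B' : Matrix R R k := Matrix.of fun i l => if ρ.lbl i = ρ.lbl l then s (i, l) else 0
    have hB' : IsBlock ρ.lbl B' := fun i l h => by simp [B', h]
    have h1 : (fun i => eval (Sum.elim s u) (ρ.actVar i)) = ρ.act B' u := by
      funext a
      simp only [actVar, map_sum, map_mul, act, actOn_apply, eval_X, Sum.elim_inr]
      refine Finset.sum_congr rfl fun l _ => ?_
      simp only [B', Matrix.of_apply]
      split_ifs with h <;> simp
    have h2 : eval (Sum.elim s u) ρ.detVar = B'.det := by
      rw [detVar, RingHom.map_det]
      congr 1
      ext i l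
      simp only [RingHom.mapMatrix_apply, Matrix.map_apply, Matrix.of_apply, B']
      split_ifs with h <;> simp
    rw [h1]
    exact ρ.act_mem hu hB' (isUnit_iff_ne_zero.2 (h2 ▸ hs))
  · rw [ρ.aeval_detVar hB]; exact hu

theorem isUnit_det_dual {A : Type*} [CommRing A] {B : Matrix R R (DualNumber A)}
    (h : IsUnit (B.map (TrivSqZeroExt.fstHom A A A)).det) : IsUnit B.det := by
  rw [TrivSqZeroExt.isUnit_iff_isUnit_fst]
  have : (TrivSqZeroExt.fstHom A A A) B.det = (B.map (TrivSqZeroExt.fstHom A A A)).det := by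
    rw [AlgHom.map_det]; rfl
  change IsUnit ((TrivSqZeroExt.fstHom A A A) B.det)
  rwa [this]

variable [Fintype ι]

theorem act_mem_tangentAt [Infinite k] {Z : Set P} {A : Type*} [CommRing A] [Algebra k A]
    {B : Matrix R R A} (hB : IsBlock ρ.lbl B) (hu : IsUnit B.det) {v w : ι → A} (hv : IsPt Z v)
    (hw : w ∈ tangentAt Z v) : ρ.act B w ∈ tangentAt Z (ρ.act B v) := by
  have h1 := ρ.isPt_act (B := B.map (TrivSqZeroExt.inlHom A A)) (hB.map _) (by
    rw [← RingHom.mapMatrix_apply, ← RingHom.map_det]; exact hu.map _) (isPt_dual.2 ⟨hv, hw⟩)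
  have h2 : ρ.act (B.map (TrivSqZeroExt.inlHom A A)) (dual v w) = dual (ρ.act B v) (ρ.act B w) := by
    funext a
    ext
    · simp [act, actOn_apply, TrivSqZeroExt.fst_sum]
    · simp [act, actOn_apply, TrivSqZeroExt.snd_sum]
  rw [h2] at h1
  exact (isPt_dual.1 h1).2

/-- Moving the coordinate vector of a fixed point is tangent to the cone. -/
theorem act_mem_tangentAt_self [Infinite k] {Z : Set P} {A : Type*} [CommRing A] [Algebra k A]
    {B : Matrix R R A} (hB : IsBlock ρ.lbl B) {v : ι → A} (hv : IsPt Z v) :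
    ρ.act B v ∈ tangentAt Z v := by
  let β : Matrix R R (DualNumber A) := 1 + Matrix.of fun i l => TrivSqZeroExt.inr (B i l)
  have hβ : IsBlock ρ.lbl β := fun i l h => by
    have h1 : i ≠ l := fun h' => h (h' ▸ rfl)
    simp [β, h1, hB i l h]
  have h0 : β.map (TrivSqZeroExt.fstHom A A A) = 1 := by
    ext i l
    simp [β, Matrix.one_apply]
    split_ifs <;> simp
  have h1 := ρ.isPt_act hβ (isUnit_det_dual (by rw [h0]; simp))
    (isPt_dual.2 ⟨hv, Submodule.zero_mem (tangentAt Z v)⟩)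
  have h2 : ρ.act β (dual v 0) = dual v (ρ.act B v) := by
    rw [act, actOn_add]
    funext a
    rw [Pi.add_apply, actOn_one]
    ext
    · simp [actOn_apply, TrivSqZeroExt.fst_sum]
    · simp [act, actOn_apply, TrivSqZeroExt.snd_sum]
  rw [h2] at h1
  exact (isPt_dual.1 h1).2

end Rows

/-! ### Projective space, Grassmannians and products -/

/-- A matrix with independent rows has a non-vanishing maximal minor. -/
theorem exists_isUnit_det_submatrix {k R C : Type*} [Field k] [Fintype R] [DecidableEq R]
    [Finite C] {M : Matrix R C k} (hM : LinearIndependent k M.row) :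
    ∃ J : R → C, IsUnit (M.submatrix id J).det := by
  classical
  have := Fintype.ofFinite C
  obtain ⟨κ, a, -, hspan, hli⟩ := exists_linearIndependent' k M.col
  have htop : Submodule.span k (Set.range M.col) = ⊤ := by
    rw [← Matrix.range_mulVecLin]
    apply Submodule.eq_top_of_finrank_eq
    change M.rank = _
    rw [hM.rank_matrix, Module.finrank_fintype_fun_eq_card]
  rw [htop] at hspan
  have hfin : Finite κ := hli.finite
  have := Fintype.ofFinite κ
  have hcard : Fintype.card R = Fintype.card κ := by
    rw [← Module.finrank_fintype_fun_eq_card k (η := R)]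
    exact Module.finrank_eq_card_basis (Module.Basis.mk hli hspan.ge)
  let e : R ≃ κ := Fintype.equivOfCardEq hcard
  refine ⟨a ∘ e, ?_⟩
  rw [← Matrix.isUnit_iff_isUnit_det, ← Matrix.linearIndependent_cols_iff_isUnit]
  exact hli.comp e e.injective

theorem span_row_mul_le {k R R' C : Type*} [Field k] [Fintype R]
    (B : Matrix R' R k) (M : Matrix R C k) :
    Submodule.span k (Set.range (B * M).row) ≤ Submodule.span k (Set.range M.row) := by
  rw [Submodule.span_le]
  rintro _ ⟨i, rfl⟩
  have : (B * M).row i = ∑ l, B i l • M.row l := by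
    funext c; simp [Matrix.mul_apply, Matrix.row]
  rw [this]
  exact Submodule.sum_mem _ fun l _ => Submodule.smul_mem _ _ (Submodule.subset_span ⟨l, rfl⟩)

theorem exists_mul_of_span_row_le {k R R' C : Type*} [Field k] [Fintype R]
    {M : Matrix R C k} {M' : Matrix R' C k}
    (h : ∀ i, M'.row i ∈ Submodule.span k (Set.range M.row)) : ∃ B : Matrix R' R k, M' = B * M := by
  choose B hB using fun i => (Submodule.mem_span_range_iff_exists_fun k).1 (h i)
  refine ⟨Matrix.of B, ?_⟩
  ext i c
  have := congrFun (hB i) c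
  simp only [Matrix.row, Finset.sum_apply, Pi.smul_apply, smul_eq_mul] at this
  simp [Matrix.mul_apply, ← this]

/-- A matrix with a non-vanishing maximal minor has independent rows. -/
theorem linearIndependent_row_of_isUnit {k R C : Type*} [Field k] [Fintype R] [DecidableEq R]
    {M : Matrix R C k} {J : R → C} (h : IsUnit (M.submatrix id J).det) :
    LinearIndependent k M.row := by
  rw [← Matrix.isUnit_iff_isUnit_det, ← Matrix.linearIndependent_rows_iff_isUnit] at h
  exact LinearIndependent.of_comp (LinearMap.funLeft k k J) h

section PN

variable (k : Type*) [Field k] (N : ℕ)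

/-- Coordinate vectors in `ℙ^N` as matrices with one row. -/
def pnRows : Rows (PN k N) Unit (Fin (N + 1)) where
  lbl _ := 0
  idx := (Equiv.punitProd _).symm
  coords_iff := by
    rintro x v w ⟨hv, rfl⟩
    constructor
    · rintro ⟨hw, h⟩
      obtain ⟨c, rfl⟩ := (Projectivization.mk_eq_mk_iff k w v hw hv).1 h
      refine ⟨Matrix.of fun _ _ => c, fun _ _ h => (h rfl).elim, ?_, ?_⟩
      · simp
      · funext a; simp [actOn_apply, Units.smul_def]
    · rintro ⟨B, -, hu, rfl⟩
      have hc : B () () ≠ 0 := by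
        have : B.det = B () () := by simp
        rw [← this]; exact hu.ne_zero
      have : actOn (Equiv.punitProd _).symm B v = B () () • v := by
        funext a; simp [actOn_apply]
      rw [this]
      exact ⟨smul_ne_zero hc hv, (Projectivization.mk_eq_mk_iff' k _ _ _ _).2 ⟨B () (), rfl⟩⟩
  exists_chart := by
    rintro x v ⟨hv, rfl⟩
    obtain ⟨j, hj⟩ := Function.ne_iff.1 hv
    refine ⟨fun _ => j, ?_⟩
    simpa [blockOf, matOf] using hj
  exists_point := by
    intro J v h
    have hv : v ≠ 0 := by
      rintro rfl
      simp [blockOf, matOf] at h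
    exact ⟨Projectivization.mk k v hv, hv, rfl⟩

variable {k N} in
theorem mem_coords_gr {r : ℕ} {L : Gr k N r} {F : Fin r × Fin (N + 1) → k} :
    F ∈ coords L ↔
      Submodule.span k (Set.range (matOf (Equiv.refl _) F).row) = L.1 := Iff.rfl

variable {k N} in
theorem linearIndependent_of_mem_coords_gr {r : ℕ} {L : Gr k N r} {F : Fin r × Fin (N + 1) → k}
    (hF : F ∈ coords L) : LinearIndependent k (matOf (Equiv.refl _) F).row := by
  rw [linearIndependent_iff_card_eq_finrank_span, Set.finrank, mem_coords_gr.1 hF, L.2,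
    Fintype.card_fin]

theorem blockOf_const {R C : Type} {A : Type*} [CommRing A] (J : R → C) (M : Matrix R C A) :
    blockOf (fun _ => 0) J M = M.submatrix id J := by
  ext i l; simp [blockOf]

/-- The points of `𝔾(r - 1, ℙ^N)` as matrices with `r` rows. -/
def grRows (r : ℕ) : Rows (Gr k N r) (Fin r) (Fin (N + 1)) where
  lbl _ := 0
  idx := Equiv.refl _
  coords_iff := by
    intro L F F' hF
    constructor
    · intro hF'
      obtain ⟨B, hB⟩ := exists_mul_of_span_row_le (M := matOf (Equiv.refl _) F)
        (M' := matOf (Equiv.refl _) F') fun i => by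
          rw [mem_coords_gr.1 hF, ← mem_coords_gr.1 hF']; exact Submodule.subset_span ⟨i, rfl⟩
      obtain ⟨B', hB'⟩ := exists_mul_of_span_row_le (M := matOf (Equiv.refl _) F')
        (M' := matOf (Equiv.refl _) F) fun i => by
          rw [mem_coords_gr.1 hF', ← mem_coords_gr.1 hF]; exact Submodule.subset_span ⟨i, rfl⟩
      refine ⟨B, fun _ _ h => (h rfl).elim, ?_, matOf_injective (Equiv.refl _) (by simp [hB])⟩
      have hinj := Matrix.vecMul_injective_iff.2 (linearIndependent_of_mem_coords_gr hF)
      have h1 : B' * B = 1 := by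
        ext i l
        refine congrFun (@hinj ((B' * B) i) ((1 : Matrix _ _ k) i) ?_) l
        have h2 : B' * B * matOf (Equiv.refl _) F =
            (1 : Matrix (Fin r) (Fin r) k) * matOf (Equiv.refl _) F := by
          rw [Matrix.mul_assoc, ← hB, ← hB', Matrix.one_mul]
        exact congrFun h2 i
      exact Matrix.isUnit_det_of_left_inverse h1
    · rintro ⟨B, -, hu, rfl⟩
      rw [mem_coords_gr, matOf_actOn, ← mem_coords_gr.1 hF]
      apply le_antisymm (span_row_mul_le _ _)
      have : matOf (Equiv.refl _) F = B⁻¹ * (B * matOf (Equiv.refl _) F) := by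
        rw [← Matrix.mul_assoc, Matrix.nonsing_inv_mul _ hu, Matrix.one_mul]
      conv_lhs => rw [this]
      exact span_row_mul_le _ _
  exists_chart := by
    intro L F hF
    obtain ⟨J, hJ⟩ := exists_isUnit_det_submatrix (linearIndependent_of_mem_coords_gr hF)
    exact ⟨J, by rwa [blockOf_const]⟩
  exists_point := by
    intro J F h
    rw [blockOf_const] at h
    have := linearIndependent_row_of_isUnit h
    refine ⟨⟨Submodule.span k (Set.range (matOf (Equiv.refl _) F).row), ?_⟩, rfl⟩
    rw [finrank_span_eq_card this, Fintype.card_fin]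

end PN

section Prod

variable {k P Q : Type*} {ι κ : Type} [Field k] [HomogCoords k P ι] [HomogCoords k Q κ]
  {R R' C : Type} [Fintype R] [DecidableEq R] [Fintype R'] [DecidableEq R']

/-- The coordinates of a product as a matrix. -/
def prodIdx (e : ι ≃ R × C) (e' : κ ≃ R' × C) : ι ⊕ κ ≃ (R ⊕ R') × C :=
  (Equiv.sumCongr e e').trans (Equiv.sumProdDistrib R R' C).symm

theorem matOf_prodIdx {A : Type*} [CommRing A] (e : ι ≃ R × C) (e' : κ ≃ R' × C) (v : ι ⊕ κ → A) :
    matOf (prodIdx e e') v = Matrix.fromRows (matOf e (v ∘ Sum.inl)) (matOf e' (v ∘ Sum.inr)) := by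
  ext (i | i) c <;> rfl

/-- The blocks of a product: the blocks of the two factors get even and odd labels. -/
def prodLbl (l : R → ℕ) (l' : R' → ℕ) : R ⊕ R' → ℕ :=
  Sum.elim (fun i => 2 * l i) (fun i => 2 * l' i + 1)

theorem IsBlock.fromBlocks {A : Type*} [CommRing A] {l : R → ℕ} {l' : R' → ℕ}
    {B : Matrix R R A} {B' : Matrix R' R' A} (hB : IsBlock l B) (hB' : IsBlock l' B') :
    IsBlock (prodLbl l l') (Matrix.fromBlocks B 0 0 B') := by
  rintro (i | i) (j | j) h
  · exact hB i j fun h' => h (by simp [prodLbl, h'])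
  · rfl
  · rfl
  · exact hB' i j fun h' => h (by simp [prodLbl, h'])

theorem IsBlock.eq_fromBlocks {A : Type*} [CommRing A] {l : R → ℕ} {l' : R' → ℕ}
    {B : Matrix (R ⊕ R') (R ⊕ R') A} (hB : IsBlock (prodLbl l l') B) :
    IsBlock l B.toBlocks₁₁ ∧ IsBlock l' B.toBlocks₂₂ ∧
      B = Matrix.fromBlocks B.toBlocks₁₁ 0 0 B.toBlocks₂₂ := by
  refine ⟨fun i j h => hB _ _ ?_, fun i j h => hB _ _ ?_, ?_⟩
  · simpa [prodLbl] using h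
  · simpa [prodLbl] using h
  · have h1 : B.toBlocks₁₂ = 0 := by
      ext i j; exact hB _ _ (by simp only [prodLbl, Sum.elim_inl, Sum.elim_inr]; omega)
    have h2 : B.toBlocks₂₁ = 0 := by
      ext i j; exact hB _ _ (by simp only [prodLbl, Sum.elim_inl, Sum.elim_inr]; omega)
    conv_lhs => rw [← Matrix.fromBlocks_toBlocks B, h1, h2]

theorem blockOf_fromRows {A : Type*} [CommRing A] (l : R → ℕ) (l' : R' → ℕ) (J : R ⊕ R' → C)
    (M : Matrix R C A) (M' : Matrix R' C A) :
    blockOf (prodLbl l l') J (Matrix.fromRows M M') =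
      Matrix.fromBlocks (blockOf l (J ∘ Sum.inl) M) 0 0 (blockOf l' (J ∘ Sum.inr) M') := by
  ext (i | i) (j | j)
  · simp [blockOf, prodLbl]
  · have : 2 * l i ≠ 2 * l' j + 1 := by omega
    simp [blockOf, prodLbl, this]
  · have : 2 * l' i + 1 ≠ 2 * l j := by omega
    simp [blockOf, prodLbl, this]
  · simp [blockOf, prodLbl]

theorem actOn_fromBlocks {A : Type*} [CommRing A] (e : ι ≃ R × C) (e' : κ ≃ R' × C)
    (B : Matrix R R A) (B' : Matrix R' R' A) (v : ι ⊕ κ → A) :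
    actOn (prodIdx e e') (Matrix.fromBlocks B 0 0 B') v =
      Sum.elim (actOn e B (v ∘ Sum.inl)) (actOn e' B' (v ∘ Sum.inr)) := by
  refine matOf_injective (prodIdx e e') ?_
  rw [matOf_actOn, matOf_prodIdx, matOf_prodIdx, Matrix.fromBlocks_mul_fromRows]
  simp [Function.comp_def]

/-- The rows of a product are the rows of both factors. -/
def prodRows (ρ : Rows P R C) (ρ' : Rows Q R' C) : Rows (P × Q) (R ⊕ R') C where
  lbl := prodLbl ρ.lbl ρ'.lbl
  idx := prodIdx ρ.idx ρ'.idx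
  coords_iff := by
    rintro ⟨x, y⟩ v w ⟨hv, hv'⟩
    constructor
    · rintro ⟨hw, hw'⟩
      obtain ⟨B, hB, hu, h⟩ := (ρ.coords_iff _ _ _ hv).1 hw
      obtain ⟨B', hB', hu', h'⟩ := (ρ'.coords_iff _ _ _ hv').1 hw'
      refine ⟨Matrix.fromBlocks B 0 0 B', hB.fromBlocks hB', ?_, ?_⟩
      · rw [Matrix.det_fromBlocks_zero₂₁]; exact hu.mul hu'
      · rw [actOn_fromBlocks, ← h, ← h']
        exact (Sum.elim_comp_inl_inr w).symm
    · rintro ⟨B, hB, hu, rfl⟩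
      obtain ⟨h1, h2, h3⟩ := hB.eq_fromBlocks
      rw [h3, Matrix.det_fromBlocks_zero₂₁, IsUnit.mul_iff] at hu
      rw [h3, actOn_fromBlocks]
      exact ⟨(ρ.coords_iff _ _ _ hv).2 ⟨_, h1, hu.1, rfl⟩,
        (ρ'.coords_iff _ _ _ hv').2 ⟨_, h2, hu.2, rfl⟩⟩
  exists_chart := by
    rintro ⟨x, y⟩ v ⟨hv, hv'⟩
    obtain ⟨J, hJ⟩ := ρ.exists_chart x _ hv
    obtain ⟨J', hJ'⟩ := ρ'.exists_chart y _ hv'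
    refine ⟨Sum.elim J J', ?_⟩
    rw [matOf_prodIdx, blockOf_fromRows, Matrix.det_fromBlocks_zero₂₁]
    exact hJ.mul hJ'
  exists_point := by
    intro J v h
    rw [matOf_prodIdx, blockOf_fromRows, Matrix.det_fromBlocks_zero₂₁, IsUnit.mul_iff] at h
    obtain ⟨x, hx⟩ := ρ.exists_point _ _ h.1
    obtain ⟨y, hy⟩ := ρ'.exists_point _ _ h.2
    exact ⟨(x, y), hx, hy⟩

end Prod

/-! ### Function fields and generic points -/

section FunField

variable {k P : Type*} {ι : Type} [Field k] [HomogCoords k P ι]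

/-- The function field of a variety, as a field. -/
def FunField {Z : Set P} (_hZ : IsVariety Z) : Type _ := functionField Z

instance {Z : Set P} (hZ : IsVariety Z) : Field (FunField hZ) :=
  (isField_functionField hZ).toField

namespace FunField

variable {Z : Set P} (hZ : IsVariety Z)

/-- The germ of functions at the generic point which is given by an element of the function
field. -/
def toGerm : FunField hZ →+* Germ (generic Z) k where
  toFun := Subtype.val
  map_one' := rfl
  map_zero' := rfl
  map_add' _ _ := rfl
  map_mul' _ _ := rfl

theorem toGerm_injective : Function.Injective (toGerm hZ) := Subtype.val_injective

/-- The element of the function field given by a rational function. -/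
def mk (φ : P → k) (h : IsRational Z φ) : FunField hZ := ⟨(φ : Germ (generic Z) k), φ, h, rfl⟩

@[simp] theorem toGerm_mk (φ : P → k) (h : IsRational Z φ) :
    toGerm hZ (mk hZ φ h) = (φ : Germ (generic Z) k) := rfl

theorem isRational_const (c : k) : IsRational Z fun _ : P => c := ⟨C c, 1, by simp⟩

instance : Algebra k (FunField hZ) := RingHom.toAlgebra
  { toFun := fun c => mk hZ (fun _ => c) (isRational_const c)
    map_one' := rfl
    map_zero' := rfl
    map_add' := fun _ _ => rfl
    map_mul' := fun _ _ => rfl }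

theorem toGerm_algebraMap (c : k) :
    toGerm hZ (algebraMap k (FunField hZ) c) = ((fun _ : P => c : P → k) : Germ (generic Z) k) :=
      rfl

theorem exists_eq_mk (f : FunField hZ) : ∃ φ, ∃ h : IsRational Z φ, f = mk hZ φ h := by
  obtain ⟨_, φ, h, rfl⟩ := f
  exact ⟨φ, h, rfl⟩

end FunField

theorem eventually_mem (Z : Set P) : ∀ᶠ x in generic Z, x ∈ Z :=
  mem_generic.2 ⟨Set.univ, isOpen_univ, by simpa using subset_closure, fun x hx => hx.2⟩

theorem eventually_mem_of_isOpen {Z U : Set P} (hZ : IsVariety Z) (hU : IsOpen U)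
    (h : (Z ∩ U).Nonempty) : ∀ᶠ x in generic Z, x ∈ U :=
  mem_generic.2 ⟨U, hU, dense_of_irreducible hZ.2 hU (by rwa [Set.inter_comm]), fun x hx => hx.1⟩

theorem closed_of_eventually {Z W : Set P} (hW : IsClosed W) (h : ∀ᶠ x in generic Z, x ∈ W) :
    Z ⊆ W := by
  obtain ⟨U, -, hd, hs⟩ := mem_generic.1 h
  exact hd.trans (closure_minimal hs hW)

end FunField

namespace Rows

variable {k P : Type*} {ι : Type} [Field k] [HomogCoords k P ι]
  {R C : Type} [Fintype R] [DecidableEq R] (ρ : Rows P R C)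

/-- The domain of the chart `J`. -/
def dom (J : R → C) : Set P := {x | ∃ v ∈ coords x, IsUnit (ρ.N J v).det}

/-- The normalized coordinates in the chart `J`. -/
def ν (J : R → C) (x : P) : ι → k := ρ.nrm J (coords_nonempty x).some

/-- The determinant of `N` as a polynomial. -/
def detPoly (J : R → C) : MvPolynomial ι k := (ρ.N J (X : ι → MvPolynomial ι k)).det

/-- The numerators of the normalized coordinates. -/
def numPoly (J : R → C) : ι → MvPolynomial ι k :=
  ρ.act (ρ.N J (X : ι → MvPolynomial ι k)).adjugate X

variable {ρ} in
theorem mem_dom_iff {J : R → C} {x : P} {v : ι → k} (hv : v ∈ coords x) :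
    x ∈ ρ.dom J ↔ IsUnit (ρ.N J v).det :=
  ⟨fun ⟨_, hw, h⟩ => (ρ.isUnit_N_iff hw hv).1 h, fun h => ⟨v, hv, h⟩⟩

theorem ν_eq {J : R → C} {x : P} {v : ι → k} (hv : v ∈ coords x) : ρ.ν J x = ρ.nrm J v :=
  ρ.nrm_eq (coords_nonempty x).some_mem hv

variable {ρ} in
theorem ν_mem {J : R → C} {x : P} (hx : x ∈ ρ.dom J) : ρ.ν J x ∈ coords x := by
  obtain ⟨v, hv, h⟩ := hx
  rw [ρ.ν_eq hv]; exact ρ.nrm_mem hv h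

variable {ρ} in
theorem N_ν {J : R → C} {x : P} (hx : x ∈ ρ.dom J) : ρ.N J (ρ.ν J x) = 1 := by
  obtain ⟨v, hv, h⟩ := hx
  rw [ρ.ν_eq hv, ρ.N_nrm h]

theorem exists_mem_dom (ρ : Rows P R C) (x : P) : ∃ J, x ∈ ρ.dom J := by
  obtain ⟨v, hv⟩ := coords_nonempty x
  obtain ⟨J, hJ⟩ := ρ.exists_chart x v hv
  exact ⟨J, v, hv, hJ⟩

theorem exists_of_N_eq_one {J : R → C} {v : ι → k} (h : ρ.N J v = 1) :
    ∃ x ∈ ρ.dom J, v ∈ coords x ∧ ρ.ν J x = v := by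
  obtain ⟨x, hx⟩ := ρ.exists_point J v (by change IsUnit (ρ.N J v).det; rw [h]; simp)
  exact ⟨x, ⟨v, hx, by rw [h]; simp⟩, hx, by rw [ρ.ν_eq hx, ρ.nrm_of_N_eq_one h]⟩

theorem aeval_detPoly (J : R → C) {A : Type*} [CommRing A] [Algebra k A] (v : ι → A) :
    aeval v (ρ.detPoly J) = (ρ.N J v).det := by
  rw [detPoly, AlgHom.map_det]
  congr 1
  change (ρ.N J X).map (aeval v : MvPolynomial ι k →ₐ[k] A).toRingHom = _
  rw [← N_map]
  simp

theorem aeval_numPoly (J : R → C) {A : Type*} [CommRing A] [Algebra k A] (v : ι → A) (a : ι) :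
    aeval v (ρ.numPoly J a) = ρ.act (ρ.N J v).adjugate v a := by
  have h := congrFun (ρ.act_map (aeval v : MvPolynomial ι k →ₐ[k] A).toRingHom
    (ρ.N J (X : ι → MvPolynomial ι k)).adjugate X) a
  refine Eq.trans h.symm ?_
  have h2 : (ρ.N J (X : ι → MvPolynomial ι k)).adjugate.map
      (aeval v : MvPolynomial ι k →ₐ[k] A).toRingHom = (ρ.N J v).adjugate := by
    rw [← RingHom.mapMatrix_apply, RingHom.map_adjugate, RingHom.mapMatrix_apply, ← N_map]
    simp
  rw [h2]
  simp

theorem det_mul_nrm (J : R → C) {A : Type*} [CommRing A] {v : ι → A}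
    (h : IsUnit (ρ.N J v).det) (a : ι) :
    (ρ.N J v).det * ρ.nrm J v a = ρ.act (ρ.N J v).adjugate v a := by
  have : (ρ.N J v).adjugate = (ρ.N J v).det • (ρ.N J v)⁻¹ := by
    rw [Matrix.inv_def, smul_smul, Ring.mul_inverse_cancel _ h, one_smul]
  rw [this, act, actOn_smul]; rfl

theorem isOpen_dom (J : R → C) : IsOpen (ρ.dom J) := by
  convert! ρ.isOpen_exists (ρ.detPoly J) using 1
  ext x
  simp only [dom, Set.mem_ofPred_eq, ← MvPolynomial.aeval_eq_eval, aeval_detPoly,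
    isUnit_iff_ne_zero]

/-- The polynomial `p` of the normalized coordinates, multiplied by a power of the determinant so
that it becomes a polynomial in arbitrary coordinates. -/
def hat (J : R → C) (p : MvPolynomial ι k) : MvPolynomial ι k :=
  ∑ m ∈ p.support, MvPolynomial.C (p.coeff m) * ρ.detPoly J ^ (p.totalDegree - m.degree) *
    ∏ i ∈ m.support, ρ.numPoly J i ^ m i

theorem aeval_hat (J : R → C) (p : MvPolynomial ι k) {A : Type*} [CommRing A] [Algebra k A]
    {v : ι → A} (h : IsUnit (ρ.N J v).det) :
    aeval v (ρ.hat J p) = (ρ.N J v).det ^ p.totalDegree * aeval (ρ.nrm J v) p := by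
  conv_rhs => rw [aeval_def, eval₂_eq]
  rw [hat, map_sum, Finset.mul_sum]
  refine Finset.sum_congr rfl fun m hm => ?_
  have hd : m.degree ≤ p.totalDegree := le_totalDegree hm
  rw [map_mul, map_mul, map_pow, map_prod, aeval_detPoly, algHom_C]
  simp only [map_pow, aeval_numPoly, ← ρ.det_mul_nrm J h, mul_pow, Finset.prod_mul_distrib,
    Finset.prod_pow_eq_pow_sum]
  have : ∑ i ∈ m.support, m i = m.degree := rfl
  rw [this]
  calc _ = algebraMap k A (coeff m p) * ((ρ.N J v).det ^ (p.totalDegree - m.degree) *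
        (ρ.N J v).det ^ m.degree) * ∏ i ∈ m.support, ρ.nrm J v i ^ m i := by ring
    _ = _ := by rw [← pow_add, Nat.sub_add_cancel hd]; ring

theorem sum_pderiv_eq_zero_of_mem [Fintype ι] {Z : Set P} {J : R → C} {A : Type*} [CommRing A]
    [Algebra k A] {ξ w : ι → A} (hξ : IsPt Z ξ) (hξN : ρ.N J ξ = 1) (hw : w ∈ tangentAt Z ξ)
    (hN : ρ.N J w = 0) {p : MvPolynomial ι k} (hp : ρ.detPoly J * ρ.hat J p ∈ vanishing Z) :
    ∑ i, aeval ξ (pderiv i p) * w i = 0 := by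
  have h := isPt_dual.2 ⟨hξ, hw⟩ _ hp
  have h1 : ρ.N J (dual ξ w) = 1 := by
    ext i l
    · have := congrFun (congrFun (hξN) i) l
      rw [N_apply] at this ⊢
      by_cases hl : ρ.lbl i = ρ.lbl l
      · rw [if_pos hl] at this ⊢
        simp only [fst_dual, this, Matrix.one_apply]
        split_ifs <;> simp
      · rw [if_neg hl, Matrix.one_apply_ne fun h' : i = l => hl (congrArg ρ.lbl h')]
    · have := congrFun (congrFun hN i) l
      rw [N_apply] at this ⊢
      by_cases hl : ρ.lbl i = ρ.lbl l
      · rw [if_pos hl] at this ⊢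
        simp only [snd_dual, this, Matrix.one_apply]
        split_ifs <;> simp
      · rw [if_neg hl, Matrix.one_apply_ne fun h' : i = l => hl (congrArg ρ.lbl h')]
  rw [map_mul, aeval_detPoly, ρ.aeval_hat J p (by rw [h1]; simp), h1, ρ.nrm_of_N_eq_one h1,
    aeval_dual] at h
  simpa using congrArg TrivSqZeroExt.snd h

section Generic

variable {Z : Set P} (hZ : IsVariety Z) {J : R → C} (hJ : (Z ∩ ρ.dom J).Nonempty)

theorem eventually_dom (ρ : Rows P R C) {Z : Set P} (hZ : IsVariety Z) {J : R → C}
    (hJ : (Z ∩ ρ.dom J).Nonempty) : ∀ᶠ x in generic Z, x ∈ Z ∧ x ∈ ρ.dom J :=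
  (eventually_mem Z).and (eventually_mem_of_isOpen hZ (ρ.isOpen_dom J) hJ)

theorem isRational_ν (ρ : Rows P R C) {Z : Set P} (hZ : IsVariety Z) {J : R → C}
    (hJ : (Z ∩ ρ.dom J).Nonempty) (a : ι) : IsRational Z fun x => ρ.ν J x a := by
  refine ⟨ρ.numPoly J a, ρ.detPoly J, ?_⟩
  filter_upwards [ρ.eventually_dom hZ hJ] with x hx v hv
  have h := (mem_dom_iff hv).1 hx.2
  rw [← MvPolynomial.aeval_eq_eval, aeval_detPoly, aeval_numPoly, ρ.ν_eq hv, mul_comm,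
    ρ.det_mul_nrm J h]
  exact ⟨h.ne_zero, rfl⟩

/-- The generic point of `Z` in the chart `J`. -/
def gen (a : ι) : FunField hZ := FunField.mk hZ _ (ρ.isRational_ν hZ hJ a)

theorem toGerm_aeval_gen (p : MvPolynomial ι k) :
    FunField.toGerm hZ (aeval (ρ.gen hZ hJ) p) =
      ((fun x => eval (ρ.ν J x) p : P → k) : Germ (generic Z) k) := by
  induction p using MvPolynomial.induction_on with
  | C a => rw [algHom_C]; simp [FunField.toGerm_algebraMap]
  | add p q hp hq => rw [map_add, map_add, hp, hq, ← Germ.coe_add]; congr 1; funext x; simp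
  | mul_X p i hp =>
    rw [map_mul, map_mul, hp, aeval_X, gen, FunField.toGerm_mk, ← Germ.coe_mul]
    congr 1; funext x; simp

theorem aeval_gen_eq_zero {p : MvPolynomial ι k} :
    aeval (ρ.gen hZ hJ) p = 0 ↔ ∀ᶠ x in generic Z, eval (ρ.ν J x) p = 0 := by
  rw [← (FunField.toGerm_injective hZ).eq_iff, map_zero, toGerm_aeval_gen]
  exact Germ.coe_eq

theorem isPt_gen : IsPt Z (ρ.gen hZ hJ) := fun p hp => by
  rw [aeval_gen_eq_zero]
  filter_upwards [ρ.eventually_dom hZ hJ] with x hx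
  exact hp x hx.1 _ (ν_mem hx.2)

theorem N_gen : ρ.N J (ρ.gen hZ hJ) = 1 := by
  ext i l
  apply FunField.toGerm_injective hZ
  rw [N_apply, Matrix.one_apply]
  have h : ∀ x ∈ ρ.dom J, ρ.N J (ρ.ν J x) i l = (1 : Matrix R R k) i l := fun x hx => by
    rw [N_ν hx]
  split_ifs with h1 h2 h2
  · rw [map_one]
    refine Germ.coe_eq.2 ?_
    filter_upwards [ρ.eventually_dom hZ hJ] with x hx
    have := h x hx.2
    rw [N_apply, if_pos h1] at this
    rw [this, h2, Matrix.one_apply_eq]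
  · rw [map_zero]
    refine Germ.coe_eq.2 ?_
    filter_upwards [ρ.eventually_dom hZ hJ] with x hx
    have := h x hx.2
    rwa [N_apply, if_pos h1, Matrix.one_apply_ne h2] at this
  · exact absurd (congrArg ρ.lbl h2) h1
  · rfl

theorem adjoin_gen : IntermediateField.adjoin k (Set.range (ρ.gen hZ hJ)) = ⊤ := by
  refine eq_top_iff.2 fun f _ => ?_
  obtain ⟨φ, hφ, rfl⟩ := FunField.exists_eq_mk hZ f
  obtain ⟨p, q, h⟩ := id hφ
  refine (IntermediateField.mem_adjoin_range_iff k _ _).2 ⟨p, q, ?_⟩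
  have hne := generic_neBot hZ.2.1
  have hq : aeval (ρ.gen hZ hJ) q ≠ 0 := by
    rw [Ne, aeval_gen_eq_zero]
    intro h0
    obtain ⟨x, hx⟩ := (h0.and (h.and (ρ.eventually_dom hZ hJ))).exists
    exact (hx.2.1 _ (ν_mem hx.2.2.2)).1 hx.1
  rw [eq_div_iff hq]
  apply FunField.toGerm_injective hZ
  rw [map_mul, toGerm_aeval_gen, toGerm_aeval_gen, FunField.toGerm_mk, ← Germ.coe_mul]
  refine Germ.coe_eq.2 ?_
  filter_upwards [h, ρ.eventually_dom hZ hJ] with x hx hx'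
  exact (hx _ (ν_mem hx'.2)).2

/-- A polynomial relation at the generic point, made homogeneous, is an equation of `Z`. -/
theorem detPoly_mul_hat_mem {p : MvPolynomial ι k} (hp : aeval (ρ.gen hZ hJ) p = 0) :
    ρ.detPoly J * ρ.hat J p ∈ vanishing Z := by
  rw [aeval_gen_eq_zero] at hp
  have : Z ⊆ {x : P | ∀ v ∈ coords x, eval v (ρ.detPoly J * ρ.hat J p) = 0} := by
    refine closed_of_eventually (ρ.isClosed_forall _) ?_
    filter_upwards [hp, ρ.eventually_dom hZ hJ] with x hx hx' v hv
    have h := (mem_dom_iff hv).1 hx'.2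
    rw [map_mul, ← MvPolynomial.aeval_eq_eval, ρ.aeval_hat J p h, ← ρ.ν_eq hv,
      show aeval (ρ.ν J x) p = 0 by rw [MvPolynomial.aeval_eq_eval, hx], mul_zero, mul_zero]
  exact this

theorem eval_ν_eq_zero {p : MvPolynomial ι k} (hp : aeval (ρ.gen hZ hJ) p = 0) {x : P}
    (hx : x ∈ Z) (hx' : x ∈ ρ.dom J) : eval (ρ.ν J x) p = 0 := by
  have h := ρ.detPoly_mul_hat_mem hZ hJ hp x hx _ (ν_mem hx')
  have hN := N_ν hx'
  rw [map_mul, ← MvPolynomial.aeval_eq_eval, ρ.aeval_hat J p (by rw [hN]; simp), aeval_detPoly,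
    hN, ρ.nrm_of_N_eq_one hN] at h
  simpa [MvPolynomial.aeval_eq_eval] using h

end Generic

end Rows

/-! ### Krull dimension and transcendence degree -/

section KrullDim

open TopologicalSpace Topology

theorem isPreirreducible_of_image {D X : Type*} [TopologicalSpace D] [TopologicalSpace X]
    {f : D → X} (hf : IsInducing f) {S : Set D} (h : IsPreirreducible (f '' S)) :
    IsPreirreducible S := by
  intro u v hu hv hSu hSv
  obtain ⟨u, hu', rfl⟩ := hf.isOpen_iff.1 hu
  obtain ⟨v, hv', rfl⟩ := hf.isOpen_iff.1 hv
  obtain ⟨a, haS, hau⟩ := hSu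
  obtain ⟨b, hbS, hbv⟩ := hSv
  obtain ⟨_, ⟨c, hc, rfl⟩, h1, h2⟩ :=
    h u v hu' hv' ⟨f a, ⟨a, haS, rfl⟩, hau⟩ ⟨f b, ⟨b, hbS, rfl⟩, hbv⟩
  exact ⟨c, hc, h1, h2⟩

/-- A subspace that is dense in every closed set has the same dimension as the whole space. -/
theorem topologicalKrullDim_eq_of_isInducing {D X : Type*} [TopologicalSpace D]
    [TopologicalSpace X] {f : D → X} (hf : IsInducing f)
    (h : ∀ T : Set X, IsClosed T → T ⊆ closure (f '' (f ⁻¹' T))) :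
    topologicalKrullDim D = topologicalKrullDim X := by
  refine le_antisymm hf.topologicalKrullDim_le ?_
  have hcl : ∀ T : IrreducibleCloseds X, closure (f '' (f ⁻¹' (T : Set X))) = T := fun T =>
    (closure_minimal (Set.image_preimage_subset _ _) T.isClosed).antisymm (h T T.isClosed)
  let g : IrreducibleCloseds X → IrreducibleCloseds D := fun T =>
    ⟨f ⁻¹' T, ⟨by
        have := T.isIrreducible.nonempty
        rw [← hcl T, closure_nonempty_iff] at this
        exact this.of_image,
      isPreirreducible_of_image hf (by
        rw [← isPreirreducible_iff_closure, hcl T]; exact T.isIrreducible.2)⟩,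
      T.isClosed.preimage hf.continuous⟩
  refine Order.krullDim_le_of_strictMono g (Monotone.strictMono_of_injective ?_ ?_)
  · intro S T hST
    exact Set.preimage_mono (f := f) (s := (S : Set X)) (t := (T : Set X)) hST
  · intro S T hST
    have h1 : f ⁻¹' (S : Set X) = f ⁻¹' T :=
        congrArg (fun Q : IrreducibleCloseds D => (Q : Set D)) hST
    apply IrreducibleCloseds.ext
    rw [← hcl S, ← hcl T, h1]

/-- The dimension is at most `d` if this is so locally. -/
theorem topologicalKrullDim_le_of_open_cover {X : Type*} [TopologicalSpace X] {d : WithBot ℕ∞}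
    (h : ∀ x : X, ∃ U : Set X, IsOpen U ∧ x ∈ U ∧ topologicalKrullDim U ≤ d) :
    topologicalKrullDim X ≤ d := by
  rw [topologicalKrullDim, Order.krullDim_eq_iSup_coheight]
  refine iSup_le fun T => ?_
  obtain ⟨x, hx⟩ := T.isIrreducible.nonempty
  obtain ⟨U, hU, hxU, hd⟩ := h x
  have hf : IsOpenEmbedding ((↑) : U → X) := hU.isOpenEmbedding_subtypeVal
  let T' : IrreducibleCloseds U := ⟨Subtype.val ⁻¹' (T : Set X), ⟨⟨⟨x, hxU⟩, hx⟩,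
    T.isIrreducible.2.preimage hf⟩, T.isClosed.preimage hf.continuous⟩
  have hT : IrreducibleCloseds.map _ hf.continuous T' = T := by
    apply IrreducibleCloseds.ext
    rw [IrreducibleCloseds.coe_map]
    refine (closure_minimal (Set.image_preimage_subset _ _) T.isClosed).antisymm ?_
    refine (subset_closure_inter_of_isPreirreducible_of_isOpen T.isIrreducible.2 hU
      ⟨x, hx, hxU⟩).trans (closure_mono ?_)
    rintro y ⟨hy, hyU⟩
    exact ⟨⟨y, hyU⟩, hy, rfl⟩
  have := hf.coheight_map T'
  rw [hT] at this
  rw [this]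
  exact (Order.coheight_le_krullDim _).trans hd

theorem toNat_trdeg_eq_of_frac {k A K : Type*} [Field k] [CommRing A] [IsDomain A] [Algebra k A]
    [Field K] [Algebra k K] (f : A →ₐ[k] K) (hf : Function.Injective f)
    (hfrac : ∀ z, ∃ a b, z = f a / f b) :
    Cardinal.toNat (Algebra.trdeg k A) = Cardinal.toNat (Algebra.trdeg k K) := by
  let _ : Algebra A K := f.toRingHom.toAlgebra
  have hT : IsScalarTower k A K := .of_algebraMap_eq fun x => (f.commutes x).symm
  have hF : FaithfulSMul A K := (faithfulSMul_iff_algebraMap_injective _ _).2 hf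
  have hfr : IsFractionRing A K := IsFractionRing.of_field _ _ hfrac
  have halg : Algebra.IsAlgebraic A K := IsLocalization.isAlgebraic _ (nonZeroDivisors A)
  have h := lift_trdeg_add_eq k A K
  rw [_root_.trdeg_eq_zero (R := A)] at h
  have h2 := congrArg Cardinal.toNat h
  simpa only [Cardinal.lift_zero, add_zero, Cardinal.toNat_lift] using h2

end KrullDim

namespace Rows

variable {k P : Type*} {ι : Type} [Field k] [HomogCoords k P ι]
  {R C : Type} [Fintype R] [DecidableEq R] (ρ : Rows P R C)
  {Z : Set P} (hZ : IsVariety Z) {J : R → C} (hJ : (Z ∩ ρ.dom J).Nonempty)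

open TopologicalSpace Topology

/-- Nullstellensatz for the chart `J`: the normalized vectors that satisfy all relations between the
coordinates of the generic point are the coordinates of the points of `Z` in the chart. -/
theorem isPt_of_aeval_gen {v : ι → k}
    (h : ∀ p : MvPolynomial ι k, aeval (ρ.gen hZ hJ) p = 0 → aeval v p = 0) :
    ∃ x, x ∈ Z ∧ x ∈ ρ.dom J ∧ ρ.ν J x = v := by
  have hN : ρ.N J v = 1 := by
    ext i l
    have h1 := congrFun (congrFun (ρ.N_gen hZ hJ) i) l
    rw [N_apply] at h1 ⊢
    by_cases hl : ρ.lbl i = ρ.lbl l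
    · rw [if_pos hl] at h1 ⊢
      by_cases hil : i = l
      · have := h (X (ρ.idx.symm (i, J l)) - 1) (by
          rw [map_sub, aeval_X, map_one, h1, hil, Matrix.one_apply_eq, sub_self])
        rw [map_sub, aeval_X, map_one, sub_eq_zero] at this
        rw [this, hil, Matrix.one_apply_eq]
      · have := h (X (ρ.idx.symm (i, J l))) (by
          rw [aeval_X, h1, Matrix.one_apply_ne hil])
        rw [aeval_X] at this
        rw [this, Matrix.one_apply_ne hil]
    · rw [if_neg hl, Matrix.one_apply_ne fun h' => hl (congrArg ρ.lbl h')]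
  obtain ⟨x, hx, hv, hx'⟩ := ρ.exists_of_N_eq_one hN
  exact ⟨x, IsPt.mem hZ.1 hv fun p hp => h p (ρ.isPt_gen hZ hJ p hp), hx, hx'⟩

/-- The coordinate ring of the chart `J` of `Z`. -/
abbrev CoordRing : Type _ := MvPolynomial ι k ⧸ RingHom.ker (aeval (R := k) (ρ.gen hZ hJ))

/-- The evaluation of functions at a point of the chart. -/
def evalAt (x : P) (hx : x ∈ Z ∧ x ∈ ρ.dom J) : ρ.CoordRing hZ hJ →+* k :=
  Ideal.Quotient.lift _ (eval (ρ.ν J x)) fun _ hp => ρ.eval_ν_eq_zero hZ hJ hp hx.1 hx.2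

/-- The part of `Z` in the chart. -/
abbrev chart (ρ : Rows P R C) (Z : Set P) (J : R → C) : Set Z := {x : Z | (x : P) ∈ ρ.dom J}

/-- A point of the chart as a point of the spectrum of the coordinate ring. -/
def toSpec (x : ρ.chart Z J) : PrimeSpectrum (ρ.CoordRing hZ hJ) :=
  ⟨RingHom.ker (ρ.evalAt hZ hJ x.1.1 ⟨x.1.2, x.2⟩), RingHom.ker_isPrime _⟩

theorem mk_mem_toSpec {x : ρ.chart Z J} {p : MvPolynomial ι k} :
    Ideal.Quotient.mk _ p ∈ (ρ.toSpec hZ hJ x).asIdeal ↔ eval (ρ.ν J x.1.1) p = 0 := by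
  change ρ.evalAt hZ hJ _ _ (Ideal.Quotient.mk _ p) = 0 ↔ _
  rw [evalAt, Ideal.Quotient.lift_mk]

/-- The Zariski topology of a chart is the one of the spectrum of its coordinate ring: equations in
homogeneous coordinates are dehomogenized by normalizing, and conversely `hat` homogenizes. -/
theorem isInducing_toSpec : IsInducing (ρ.toSpec hZ hJ) := by
  refine ⟨TopologicalSpace.ext_iff_isClosed.2 fun S => ⟨fun hS => ?_, fun hS => ?_⟩⟩
  · obtain ⟨T, hT, rfl⟩ := isClosed_induced_iff.1 hS
    obtain ⟨W, hW, rfl⟩ := isClosed_induced_iff.1 hT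
    obtain ⟨E, hE⟩ := isClosed_iff.1 hW
    refine isClosed_induced_iff.2 ⟨PrimeSpectrum.zeroLocus (Ideal.Quotient.mk _ '' E),
      PrimeSpectrum.isClosed_zeroLocus _, ?_⟩
    ext x
    rw [Set.mem_preimage, PrimeSpectrum.mem_zeroLocus, Set.image_subset_iff]
    refine Iff.trans ?_ (hE x.1.1 _ (ν_mem x.2)).symm
    exact forall₂_congr fun p _ => ρ.mk_mem_toSpec hZ hJ
  · obtain ⟨T, hT, rfl⟩ := isClosed_induced_iff.1 hS
    obtain ⟨E, rfl⟩ := (PrimeSpectrum.isClosed_iff_zeroLocus _).1 hT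
    have hW : IsClosed (⋂ p : MvPolynomial ι k, ⋂ _ : Ideal.Quotient.mk _ p ∈ E,
        {x : P | ∀ v ∈ coords x, eval v (ρ.detPoly J * ρ.hat J p) = 0}) := by
      exact isClosed_iInter fun p => isClosed_iInter fun _ => ρ.isClosed_forall _
    refine isClosed_induced_iff.2 ⟨_, isClosed_induced_iff.2 ⟨_, hW, rfl⟩, ?_⟩
    ext x
    rw [Set.mem_preimage, Set.mem_preimage, Set.mem_preimage, PrimeSpectrum.mem_zeroLocus,
      Set.mem_iInter₂]
    have key : ∀ p : MvPolynomial ι k, (∀ v ∈ coords x.1.1, eval v (ρ.detPoly J * ρ.hat J p) = 0) ↔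
        eval (ρ.ν J x.1.1) p = 0 := by
      intro p
      constructor
      · intro h
        have h := h _ (ν_mem x.2)
        have hN := N_ν x.2
        rw [map_mul, ← MvPolynomial.aeval_eq_eval, ρ.aeval_hat J p (by rw [hN]; simp),
          aeval_detPoly, hN, ρ.nrm_of_N_eq_one hN] at h
        simpa [MvPolynomial.aeval_eq_eval] using h
      · intro h v hv
        have hu := (mem_dom_iff hv).1 x.2
        rw [map_mul, ← MvPolynomial.aeval_eq_eval, ρ.aeval_hat J p hu, ← ρ.ν_eq hv,
          show aeval (ρ.ν J x.1.1) p = 0 by rw [MvPolynomial.aeval_eq_eval, h], mul_zero, mul_zero]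
    constructor
    · intro h q hq
      obtain ⟨p, rfl⟩ := Ideal.Quotient.mk_surjective q
      exact (ρ.mk_mem_toSpec hZ hJ).2 ((key p).1 (h p hq))
    · intro h p hp
      exact (key p).2 ((ρ.mk_mem_toSpec hZ hJ).1 (h hp))

variable [IsAlgClosed k] [Finite ι]

theorem exists_toSpec_eq {𝔪 : PrimeSpectrum (ρ.CoordRing hZ hJ)} (h𝔪 : 𝔪.asIdeal.IsMaximal) :
    ∃ x, ρ.toSpec hZ hJ x = 𝔪 := by
  have h1 : (𝔪.asIdeal.comap (Ideal.Quotient.mk _)).IsMaximal :=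
    Ideal.comap_isMaximal_of_surjective _ Ideal.Quotient.mk_surjective
  obtain ⟨v, hv⟩ := isMaximal_iff_eq_vanishingIdeal_singleton.1 h1
  have h2 : ∀ p : MvPolynomial ι k, Ideal.Quotient.mk _ p ∈ 𝔪.asIdeal ↔ aeval v p = 0 := fun p => by
    rw [← Ideal.mem_comap, hv, mem_vanishingIdeal_singleton_iff]
  obtain ⟨x, hxZ, hx, rfl⟩ := ρ.isPt_of_aeval_gen hZ hJ (v := v) fun p hp => by
    rw [← h2, Ideal.Quotient.eq_zero_iff_mem.2 hp]
    exact 𝔪.asIdeal.zero_mem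
  refine ⟨⟨⟨x, hxZ⟩, hx⟩, ?_⟩
  ext q
  obtain ⟨p, rfl⟩ := Ideal.Quotient.mk_surjective q
  rw [mk_mem_toSpec, h2, MvPolynomial.aeval_eq_eval]

theorem topologicalKrullDim_chart :
    topologicalKrullDim (ρ.chart Z J) = ringKrullDim (ρ.CoordRing hZ hJ) := by
  rw [topologicalKrullDim_eq_of_isInducing (ρ.isInducing_toSpec hZ hJ),
    PrimeSpectrum.topologicalKrullDim_eq_ringKrullDim]
  intro T hT
  have hJac : IsJacobsonRing (ρ.CoordRing hZ hJ) := inferInstance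
  refine (subset_closure.trans_eq (JacobsonSpace.closure_inter_closedPoints_eq_closure
    hT.isLocallyClosed).symm).trans (closure_mono ?_)
  rintro 𝔪 ⟨hm, hm'⟩
  obtain ⟨x, rfl⟩ := ρ.exists_toSpec_eq hZ hJ
    ((PrimeSpectrum.isClosed_singleton_iff_isMaximal _).1 hm')
  exact ⟨x, hm, rfl⟩

theorem ringKrullDim_coordRing : ringKrullDim (ρ.CoordRing hZ hJ) =
    ((Cardinal.toNat (Algebra.trdeg k (FunField hZ)) : ℕ) : WithBot ℕ∞) := by
  have hprime : (RingHom.ker (aeval (R := k) (ρ.gen hZ hJ))).IsPrime := RingHom.ker_isPrime _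
  have hD : IsDomain (ρ.CoordRing hZ hJ) := Ideal.Quotient.isDomain _
  rw [ringKrullDim_eq_trdeg k]
  rw [toNat_trdeg_eq_of_frac (Ideal.kerLiftAlg (aeval (R := k) (ρ.gen hZ hJ)))
    (Ideal.kerLiftAlg_injective _)]
  intro z
  have hz : z ∈ IntermediateField.adjoin k (Set.range (ρ.gen hZ hJ)) := by
    rw [adjoin_gen]; trivial
  obtain ⟨p, q, rfl⟩ := (IntermediateField.mem_adjoin_range_iff k _ _).1 hz
  exact ⟨Ideal.Quotient.mk _ p, Ideal.Quotient.mk _ q, rfl⟩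

/-- The dimension of a variety is the transcendence degree of its function field. -/
theorem zdim_eq_trdeg (ρ : Rows P R C) {Z : Set P} (hZ : IsVariety Z) :
    zdim Z = ((Cardinal.toNat (Algebra.trdeg k (FunField hZ)) : ℕ) : WithBot ℕ∞) := by
  have key : ∀ x : Z, ∃ J : R → C, (x : P) ∈ ρ.dom J ∧ topologicalKrullDim (ρ.chart Z J) =
      ((Cardinal.toNat (Algebra.trdeg k (FunField hZ)) : ℕ) : WithBot ℕ∞) := fun x => by
    obtain ⟨J, hJ⟩ := ρ.exists_mem_dom (x : P)
    have hJ' : (Z ∩ ρ.dom J).Nonempty := ⟨x, x.2, hJ⟩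
    exact ⟨J, hJ, by rw [ρ.topologicalKrullDim_chart hZ hJ', ρ.ringKrullDim_coordRing hZ hJ']⟩
  refine le_antisymm (topologicalKrullDim_le_of_open_cover fun x => ?_) ?_
  · obtain ⟨J, hJ, hd⟩ := key x
    exact ⟨ρ.chart Z J, (ρ.isOpen_dom J).preimage continuous_subtype_val, hJ, hd.le⟩
  · obtain ⟨x, hx⟩ := hZ.2.1
    obtain ⟨J, hJ, hd⟩ := key ⟨x, hx⟩
    exact hd.ge.trans (topologicalKrullDim_subspace_le _ _)

end Rows

/-! ### Tangent spaces at the generic point -/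

section Deriv

variable {k K ι : Type*} [Field k] [Field K] [Algebra k K] [Fintype ι]

theorem derivation_eq_zero_of_gen {M : Type*} [AddCommGroup M] [Module K M] [Module k M]
    [IsScalarTower k K M] {ξ : ι → K} (hξ : IntermediateField.adjoin k (Set.range ξ) = ⊤)
    (D : Derivation k K M) (h : ∀ i, D (ξ i) = 0) : D = 0 := by
  ext z
  have hz : z ∈ IntermediateField.adjoin k (Set.range ξ) := by rw [hξ]; trivial
  obtain ⟨p, q, rfl⟩ := (IntermediateField.mem_adjoin_range_iff k _ _).1 hz
  have hp : ∀ p : MvPolynomial ι k, D (aeval ξ p) = 0 := fun p => by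
    rw [derivation_aeval]
    exact Finset.sum_eq_zero fun i _ => by rw [h i, smul_zero]
  rw [Derivation.zero_apply]
  by_cases hq : aeval ξ q = 0
  · rw [hq, div_zero, map_zero]
  · have h1 : D (aeval ξ p / aeval ξ q * aeval ξ q) = 0 := by rw [div_mul_cancel₀ _ hq, hp]
    rw [Derivation.leibniz, hp, smul_zero, zero_add] at h1
    exact (smul_eq_zero.1 h1).resolve_left hq

theorem essFiniteType_of_gen {ξ : ι → K} (hξ : IntermediateField.adjoin k (Set.range ξ) = ⊤) :
    Algebra.EssFiniteType k K := by
  have h1 : Algebra.EssFiniteType k (⊤ : IntermediateField k K) := by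
    rw [IntermediateField.essFiniteType_iff]
    exact ⟨(Set.finite_range ξ).toFinset, by rw [Set.Finite.coe_toFinset, hξ]⟩
  exact Algebra.EssFiniteType.of_surjective
    (IntermediateField.topEquiv (F := k) (E := K)).toAlgHom
    (IntermediateField.topEquiv (F := k) (E := K)).surjective

/-- The derivations that vanish on some of the functions `ξ`. -/
def derKill (k : Type*) {K ι : Type*} [Field k] [Field K] [Algebra k K] (ξ : ι → K) (S : Set ι) :
    Submodule K (Derivation k K K) where
  carrier := {D | ∀ a ∈ S, D (ξ a) = 0}
  zero_mem' := by simp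
  add_mem' := by
    intro D D' h h' a ha
    rw [Derivation.add_apply, h a ha, h' a ha, add_zero]
  smul_mem' := by
    intro c D h a ha
    rw [Derivation.smul_apply, h a ha, smul_zero]

end Deriv

namespace Rows

variable {k P : Type*} {ι : Type} [Field k] [HomogCoords k P ι] [Fintype ι]
  {R C : Type} [Fintype R] [DecidableEq R] (ρ : Rows P R C)

/-- The tangent vectors of the cone over `Z` whose rows in `U` vanish. -/
def tanRel (U : Set R) (Z : Set P) {A : Type*} [CommRing A] [Algebra k A] (v : ι → A) :
    Submodule A (ι → A) where
  carrier := {w | w ∈ tangentAt Z v ∧ ∀ a, (ρ.idx a).1 ∈ U → w a = 0}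
  zero_mem' := ⟨Submodule.zero_mem _, fun _ _ => rfl⟩
  add_mem' := by
    rintro w w' ⟨h1, h2⟩ ⟨h3, h4⟩
    exact ⟨Submodule.add_mem _ h1 h3, fun a ha => by rw [Pi.add_apply, h2 a ha, h4 a ha, add_zero]⟩
  smul_mem' := by
    rintro c w ⟨h1, h2⟩
    exact ⟨Submodule.smul_mem _ _ h1, fun a ha => by rw [Pi.smul_apply, h2 a ha, smul_zero]⟩

/-- The entries of block diagonal matrices in the rows outside `U`. -/
abbrev Entries (U : Set R) : Type _ := {ij : R × R // ρ.lbl ij.1 = ρ.lbl ij.2 ∧ ij.1 ∉ U}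

/-- The point `ξ` with values in the field `K` is a normalized generic point of `Z`. -/
structure IsGeneric (ρ : Rows P R C) (Z : Set P) (J : R → C) {K : Type*} [Field K] [Algebra k K]
    (ξ : ι → K) : Prop where
  isPt : IsPt Z ξ
  N_eq : ρ.N J ξ = 1
  adjoin_eq : IntermediateField.adjoin k (Set.range ξ) = ⊤
  /-- Every relation between the coordinates of `ξ`, made homogeneous, is an equation of `Z`. -/
  mem_vanishing : ∀ p : MvPolynomial ι k, aeval ξ p = 0 → ρ.detPoly J * ρ.hat J p ∈ vanishing Z

theorem isGeneric_gen (ρ : Rows P R C) {Z : Set P} (hZ : IsVariety Z) {J : R → C}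
    (hJ : (Z ∩ ρ.dom J).Nonempty) : ρ.IsGeneric Z J (ρ.gen hZ hJ) :=
  ⟨ρ.isPt_gen hZ hJ, ρ.N_gen hZ hJ, ρ.adjoin_gen hZ hJ, fun _ => ρ.detPoly_mul_hat_mem hZ hJ⟩

variable {Z : Set P} {J : R → C} {K : Type*} [Field K] [Algebra k K] {ξ : ι → K}

variable {ρ}

theorem IsGeneric.derivation_mem (hξ : ρ.IsGeneric Z J ξ) (D : Derivation k K K) :
    (fun a => D (ξ a)) ∈ tangentAt Z ξ := fun p hp => by
  have := derivation_aeval D ξ p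
  rw [hξ.isPt p hp, map_zero] at this
  exact this.symm

theorem IsGeneric.derivation_N (hξ : ρ.IsGeneric Z J ξ) (D : Derivation k K K) {i l : R}
    (h : ρ.lbl i = ρ.lbl l) : D (ξ (ρ.idx.symm (i, J l))) = 0 := by
  have h1 := congrFun (congrFun (hξ.N_eq) i) l
  rw [N_apply, if_pos h] at h1
  rw [h1, Matrix.one_apply]
  split_ifs <;> simp

/-- At the generic point, tangent vectors are derivations of the function field together with the
directions of the change of coordinate vectors. -/
theorem IsGeneric.finrank_tanRel (hξ : ρ.IsGeneric Z J ξ) [Infinite k] (U : Set R) :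
    Module.finrank K (ρ.tanRel U Z ξ) =
      Module.finrank K (derKill k ξ {a | (ρ.idx a).1 ∈ U}) +
        Nat.card (ρ.Entries U) := by
  classical
  -- `φ` measures how far a tangent vector is from respecting the normalization; changes of
  -- coordinate vectors show that it is surjective, and `ψ` identifies its kernel with derivations
  let φ : ρ.tanRel U Z ξ →ₗ[K] (ρ.Entries U → K) :=
    { toFun := fun w ij => w.1 (ρ.idx.symm (ij.1.1, J ij.1.2))
      map_add' := fun _ _ => rfl
      map_smul' := fun _ _ => rfl }
  have hφ : LinearMap.range φ = ⊤ := by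
    refine LinearMap.range_eq_top.2 fun b => ?_
    let B : Matrix R R K := Matrix.of fun i j =>
      if h : ρ.lbl i = ρ.lbl j ∧ i ∉ U then b ⟨(i, j), h⟩ else 0
    have hB : IsBlock ρ.lbl B := fun i j h => by simp [B, h]
    have hact : ρ.act B ξ ∈ ρ.tanRel U Z ξ := by
      refine ⟨ρ.act_mem_tangentAt_self hB (hξ.isPt), fun a ha => ?_⟩
      rw [act, actOn_apply]
      exact Finset.sum_eq_zero fun l _ => by simp [B, ha]
    refine ⟨⟨_, hact⟩, ?_⟩
    funext ij
    have h1 := congrFun (congrFun (ρ.N_act J hB ξ) ij.1.1) ij.1.2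
    rw [hξ.N_eq, Matrix.mul_one, N_apply, if_pos ij.2.1] at h1
    refine h1.trans ?_
    simp only [B, Matrix.of_apply]
    rw [dif_pos ij.2]
  let ψ : derKill k ξ {a | (ρ.idx a).1 ∈ U} →ₗ[K] LinearMap.ker φ :=
    { toFun := fun D => ⟨⟨fun a => D.1 (ξ a), hξ.derivation_mem D.1, fun a ha => D.2 a ha⟩,
        LinearMap.mem_ker.2 (funext fun ij => hξ.derivation_N D.1 ij.2.1)⟩
      map_add' := fun _ _ => rfl
      map_smul' := fun _ _ => rfl }
  have hψ : Function.Bijective ψ := by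
    constructor
    · rw [injective_iff_map_eq_zero]
      intro D hD
      refine Subtype.ext (derivation_eq_zero_of_gen (hξ.adjoin_eq) D.1 fun a => ?_)
      exact congrFun (congrArg (fun w => w.1.1) hD) a
    · rintro ⟨⟨w, hw, hwU⟩, hN⟩
      have hN' : ρ.N J w = 0 := by
        ext i l
        rw [N_apply, Matrix.zero_apply]
        split_ifs with h
        · by_cases hi : i ∈ U
          · exact hwU _ (by simpa using hi)
          · exact congrFun (LinearMap.mem_ker.1 hN) ⟨(i, l), h, hi⟩
        · rfl
      obtain ⟨D, hD⟩ := exists_derivation (hξ.adjoin_eq) w fun p hp =>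
        ρ.sum_pderiv_eq_zero_of_mem hξ.isPt hξ.N_eq hw hN' (hξ.mem_vanishing p hp)
      refine ⟨⟨D, fun a ha => (hD a).trans (hwU a ha)⟩, ?_⟩
      exact Subtype.ext (Subtype.ext (funext hD))
  have h1 := LinearMap.finrank_range_add_finrank_ker φ
  rw [hφ, finrank_top, Module.finrank_fintype_fun_eq_card, ← Nat.card_eq_fintype_card,
    ← (LinearEquiv.ofBijective ψ hψ).finrank_eq] at h1
  rw [← h1, add_comm]

end Rows

/-! ### From the generic point to general points -/

/-- A matrix over a field factors through its rank. -/
theorem exists_rank_factorization {K m n : Type*} [Field K] [Fintype m] [Fintype n]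
    [DecidableEq m] [DecidableEq n] (M : Matrix m n K) :
    ∃ (A : Matrix m (Fin M.rank) K) (B : Matrix (Fin M.rank) n K)
      (A' : Matrix (Fin M.rank) m K) (B' : Matrix n (Fin M.rank) K),
      M = A * B ∧ A' * A = 1 ∧ B * B' = 1 := by
  let f := M.mulVecLin
  let b : Module.Basis (Fin M.rank) K (LinearMap.range f) := Module.finBasis K _
  let i : (Fin M.rank → K) →ₗ[K] (m → K) :=
    (LinearMap.range f).subtype ∘ₗ b.equivFun.symm.toLinearMap
  let s : (n → K) →ₗ[K] (Fin M.rank → K) := b.equivFun.toLinearMap ∘ₗ f.rangeRestrict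
  obtain ⟨i', hi'⟩ := LinearMap.exists_leftInverse_of_injective i (by
    rw [LinearMap.ker_eq_bot]
    exact Subtype.val_injective.comp b.equivFun.symm.injective)
  obtain ⟨s', hs'⟩ := LinearMap.exists_rightInverse_of_surjective s (by
    rw [LinearMap.range_eq_top]
    exact b.equivFun.surjective.comp f.surjective_rangeRestrict)
  refine ⟨LinearMap.toMatrix' i, LinearMap.toMatrix' s, LinearMap.toMatrix' i',
    LinearMap.toMatrix' s', ?_, ?_, ?_⟩
  · rw [← LinearMap.toMatrix'_comp]
    have : i ∘ₗ s = f := by ext; simp [i, s]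
    rw [this]
    exact (LinearMap.toMatrix'_toLin' M).symm
  · rw [← LinearMap.toMatrix'_comp, hi', LinearMap.toMatrix'_id]
  · rw [← LinearMap.toMatrix'_comp, hs', LinearMap.toMatrix'_id]

theorem rank_eq_of_factorization {K m n : Type*} [Field K] [Fintype m] [Fintype n] {r : ℕ}
    {M : Matrix m n K} {A : Matrix m (Fin r) K} {B : Matrix (Fin r) n K}
    {A' : Matrix (Fin r) m K} {B' : Matrix n (Fin r) K} (h : M = A * B) (hA : A' * A = 1)
    (hB : B * B' = 1) : M.rank = r := by
  apply le_antisymm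
  · rw [h]
    exact (Matrix.rank_mul_le_left _ _).trans ((Matrix.rank_le_card_width _).trans (by simp))
  · have h1 : A' * (M * B') = 1 := by
      rw [h, Matrix.mul_assoc A B B', hB, Matrix.mul_one, hA]
    have h2 : (1 : Matrix (Fin r) (Fin r) K).rank = r := by simp
    calc r = (A' * (M * B')).rank := by rw [h1, h2]
      _ ≤ (M * B').rank := Matrix.rank_mul_le_right _ _
      _ ≤ M.rank := Matrix.rank_mul_le_left _ _

/-! ### Tangent spaces at general points -/

namespace FunField

variable {k P : Type*} {ι : Type} [Field k] [HomogCoords k P ι] {Z : Set P} (hZ : IsVariety Z)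

theorem exists_rep (c : FunField hZ) : ∃ φ : P → k, toGerm hZ c = (φ : Germ (generic Z) k) := by
  obtain ⟨φ, hφ, rfl⟩ := exists_eq_mk hZ c
  exact ⟨φ, toGerm_mk hZ φ hφ⟩

/-- A function on `P` which represents a given rational function on `Z`. -/
def rep (c : FunField hZ) : P → k := (exists_rep hZ c).choose

theorem toGerm_rep (c : FunField hZ) : toGerm hZ c = (rep hZ c : Germ (generic Z) k) :=
  (exists_rep hZ c).choose_spec

theorem rep_eventuallyEq {c : FunField hZ} {φ : P → k}
    (h : toGerm hZ c = (φ : Germ (generic Z) k)) : ∀ᶠ x in generic Z, rep hZ c x = φ x := by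
  rw [toGerm_rep] at h
  exact Germ.coe_eq.1 h

/-- The values at `x` of a matrix of rational functions. -/
def spec {m n : Type*} (A : Matrix m n (FunField hZ)) (x : P) : Matrix m n k :=
  Matrix.of fun i j => rep hZ (A i j) x

theorem spec_mul {m n l : Type*} [Finite m] [Finite n] [Fintype l]
    (A : Matrix m l (FunField hZ)) (B : Matrix l n (FunField hZ)) :
    ∀ᶠ x in generic Z, spec hZ (A * B) x = spec hZ A x * spec hZ B x := by
  have h : ∀ i j, ∀ᶠ x in generic Z, spec hZ (A * B) x i j = (spec hZ A x * spec hZ B x) i j := by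
    intro i j
    refine rep_eventuallyEq hZ (φ := fun x => (spec hZ A x * spec hZ B x) i j) ?_
    have h2 : (fun x => (spec hZ A x * spec hZ B x) i j) =
        ∑ a, (rep hZ (A i a) * rep hZ (B a j)) := by
      funext x
      simp [Matrix.mul_apply, spec]
    rw [h2, Matrix.mul_apply, map_sum]
    simp_rw [map_mul, toGerm_rep]
    exact (map_sum (Germ.coeRingHom (generic Z)) _ _).symm
  filter_upwards [eventually_all.2 fun i => eventually_all.2 (h i)] with x hx
  ext i j
  exact hx i j

theorem spec_one {m : Type*} [Finite m] [DecidableEq m] :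
    ∀ᶠ x in generic Z, spec hZ (1 : Matrix m m (FunField hZ)) x = 1 := by
  have h : ∀ i j, ∀ᶠ x in generic Z, spec hZ (1 : Matrix m m (FunField hZ)) x i j =
      (1 : Matrix m m k) i j := by
    intro i j
    refine rep_eventuallyEq hZ (φ := fun x => (1 : Matrix m m k) i j) ?_
    rw [Matrix.one_apply, Matrix.one_apply]
    split_ifs
    · rw [map_one]; rfl
    · rw [map_zero]; rfl
  filter_upwards [eventually_all.2 fun i => eventually_all.2 (h i)] with x hx
  ext i j
  exact hx i j

end FunField

theorem mem_tangentAt_iff_of_span {k P : Type*} {ι : Type} [Field k] [HomogCoords k P ι] [Fintype ι]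
    {Z : Set P} {s : Set (MvPolynomial ι k)} (hs : Ideal.span s = vanishing Z) {A : Type*}
    [CommRing A] [Algebra k A] {v w : ι → A} (hv : IsPt Z v) :
    w ∈ tangentAt Z v ↔ ∀ p ∈ s, ∑ i, aeval v (pderiv i p) * w i = 0 := by
  refine ⟨fun h p hp => h p (hs ▸ Ideal.subset_span hp), fun h p hp => ?_⟩
  rw [← hs] at hp
  induction hp using Submodule.span_induction with
  | mem p hp => exact h p hp
  | zero => simp
  | add p q _ _ hp hq => simp [add_mul, Finset.sum_add_distrib, hp, hq]
  | smul q p hp' hp =>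
    have h0 : aeval v p = 0 := hv p (by rw [← hs]; exact hp')
    have : ∀ i, aeval v (pderiv i (q • p)) * w i = aeval v q * (aeval v (pderiv i p) * w i) := by
      intro i
      rw [smul_eq_mul, Derivation.leibniz, map_add, smul_eq_mul, smul_eq_mul, map_mul, map_mul, h0,
        zero_mul, add_zero, mul_assoc]
    rw [Finset.sum_congr rfl fun i _ => this i, ← Finset.mul_sum, hp, mul_zero]

namespace Rows

variable {k P : Type*} {ι : Type} [Field k] [HomogCoords k P ι] [Fintype ι]
  {R C : Type} [Fintype R] [DecidableEq R] (ρ : Rows P R C)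

variable {Z : Set P} (hZ : IsVariety Z) {J : R → C} (hJ : (Z ∩ ρ.dom J).Nonempty)

/-- The rank of a matrix of polynomials at a general point is the rank at the generic point. -/
theorem eventually_rank_eq {m n : Type*} [Fintype m] [Fintype n]
    (M : Matrix m n (MvPolynomial ι k)) :
    ∀ᶠ x in generic Z, (M.map (eval (ρ.ν J x))).rank =
      (M.map (aeval (R := k) (ρ.gen hZ hJ))).rank := by
  classical
  obtain ⟨A, B, A', B', h, hA, hB⟩ :=
    exists_rank_factorization (M.map (aeval (R := k) (ρ.gen hZ hJ)))
  have hM : ∀ i j, ∀ᶠ x in generic Z,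
      FunField.spec hZ (M.map (aeval (R := k) (ρ.gen hZ hJ))) x i j =
      (M.map (eval (ρ.ν J x))) i j := fun i j =>
    FunField.rep_eventuallyEq hZ (ρ.toGerm_aeval_gen hZ hJ (M i j))
  filter_upwards [eventually_all.2 fun i => eventually_all.2 (hM i), FunField.spec_mul hZ A B,
    FunField.spec_mul hZ A' A, FunField.spec_mul hZ B B',
    FunField.spec_one hZ (m := Fin (M.map (aeval (R := k) (ρ.gen hZ hJ))).rank)]
      with x h1 h2 h3 h4 h5
  rw [hA, h5] at h3
  rw [hB, h5] at h4
  rw [← h] at h2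
  refine rank_eq_of_factorization (Eq.trans ?_ h2) h3.symm h4.symm
  ext i j
  exact (h1 i j).symm

/-- The equations of the relative tangent space, with polynomial coefficients. -/
def tanMatrix (U : Set R) (s : Finset (MvPolynomial ι k)) :
    Matrix (s ⊕ ι) ι (MvPolynomial ι k) := by
  classical
  exact Matrix.fromRows (Matrix.of fun p i => pderiv i p.1)
    (Matrix.diagonal fun a => if (ρ.idx a).1 ∈ U then 1 else 0)

theorem finrank_tanRel_add_rank (U : Set R) {s : Finset (MvPolynomial ι k)}
    (hs : Ideal.span (s : Set (MvPolynomial ι k)) = vanishing Z) {K : Type*} [Field K] [Algebra k K]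
    {v : ι → K} (hv : IsPt Z v) :
    Module.finrank K (ρ.tanRel U Z v) + ((ρ.tanMatrix U s).map (aeval (R := k) v)).rank =
      Fintype.card ι := by
  classical
  have h :=
    LinearMap.finrank_range_add_finrank_ker ((ρ.tanMatrix U s).map (aeval (R := k) v)).mulVecLin
  rw [Module.finrank_fintype_fun_eq_card, add_comm] at h
  have : ρ.tanRel U Z v = LinearMap.ker ((ρ.tanMatrix U s).map (aeval (R := k) v)).mulVecLin := by
    ext w
    rw [LinearMap.mem_ker, Matrix.mulVecLin_apply]
    have h1 : w ∈ ρ.tanRel U Z v ↔ w ∈ tangentAt Z v ∧ ∀ a, (ρ.idx a).1 ∈ U → w a = 0 := Iff.rfl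
    rw [h1, mem_tangentAt_iff_of_span hs hv, funext_iff, Sum.forall]
    refine and_congr ?_ (forall_congr' fun a => ?_)
    · rw [Subtype.forall]
      rfl
    · simp only [Matrix.mulVec, dotProduct, tanMatrix, Matrix.map_apply, Matrix.fromRows_apply_inr,
        Matrix.diagonal_apply, Pi.zero_apply]
      split_ifs with ha <;> simp [ha]
  rw [this, ← h]
  rfl

theorem act_smul (ρ : Rows P R C) {A : Type*} [CommRing A] (B : Matrix R R A) (c : A) (v : ι → A) :
    ρ.act B (c • v) = c • ρ.act B v := by
  funext a
  simp [act, actOn_apply, Finset.mul_sum, mul_left_comm]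

theorem finrank_tanRel_act_le (ρ : Rows P R C) [Infinite k] {U : Set R}
    (hU : ∀ i j, ρ.lbl i = ρ.lbl j → i ∈ U → j ∈ U) {x : P} {v w : ι → k} (hx : x ∈ Z)
    (hv : v ∈ coords x) (hw : w ∈ coords x) :
    Module.finrank k (ρ.tanRel U Z v) ≤ Module.finrank k (ρ.tanRel U Z w) := by
  obtain ⟨B, hB, hu, rfl⟩ := ρ.exists_act hv hw
  let f : ρ.tanRel U Z v →ₗ[k] ρ.tanRel U Z (ρ.act B v) :=
    { toFun := fun a => ⟨ρ.act B a.1, ρ.act_mem_tangentAt hB hu (isPt_of_mem hx hv) a.2.1,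
        fun i hi => by
          rw [act, actOn_apply]
          refine Finset.sum_eq_zero fun l _ => ?_
          by_cases hl : ρ.lbl (ρ.idx i).1 = ρ.lbl l
          · rw [a.2.2 _ (by simpa using hU _ _ hl hi), mul_zero]
          · rw [hB _ _ hl, zero_mul]⟩
      map_add' := fun a b => Subtype.ext (ρ.act_add B _ _)
      map_smul' := fun c a => Subtype.ext (ρ.act_smul B c _) }
  refine LinearMap.finrank_le_finrank_of_injective (f := f) fun a b h => Subtype.ext ?_
  rw [← ρ.act_inv_act hu a.1, ← ρ.act_inv_act hu b.1]
  exact congrArg (fun a => ρ.act B⁻¹ a.1) h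

/-- The dimension of the relative tangent space at a general point is the dimension at the generic
point. -/
theorem eventually_finrank_tanRel [Infinite k] {U : Set R}
    (hU : ∀ i j, ρ.lbl i = ρ.lbl j → i ∈ U → j ∈ U) :
    ∀ᶠ x in generic Z, ∀ v ∈ coords x, Module.finrank k (ρ.tanRel U Z v) =
      Module.finrank (FunField hZ) (ρ.tanRel U Z (ρ.gen hZ hJ)) := by
  obtain ⟨s, hs⟩ := (isNoetherianRing_iff_ideal_fg (MvPolynomial ι k)).1 inferInstance (vanishing Z)
  filter_upwards [ρ.eventually_rank_eq hZ hJ (ρ.tanMatrix U s), ρ.eventually_dom hZ hJ]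
    with x hx hx' v hv
  have h1 := ρ.finrank_tanRel_add_rank U hs (isPt_of_mem hx'.1 (ν_mem hx'.2))
  have h2 := ρ.finrank_tanRel_add_rank U hs (ρ.isPt_gen hZ hJ)
  rw [← hx] at h2
  rw [le_antisymm (ρ.finrank_tanRel_act_le hU hx'.1 hv (ν_mem hx'.2))
    (ρ.finrank_tanRel_act_le hU hx'.1 (ν_mem hx'.2) hv)]
  have h3 : (ρ.tanMatrix U s).map (aeval (R := k) (ρ.ν J x)) =
      (ρ.tanMatrix U s).map (eval (ρ.ν J x)) := by
    ext i j; rw [Matrix.map_apply, Matrix.map_apply, MvPolynomial.aeval_eq_eval]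
  rw [h3] at h1
  omega

end Rows

/-! ### Separability in terms of tangent spaces -/

section Separable

variable {k K₀ K ι κ : Type*} [Field k] [Field K₀] [Field K] [Algebra k K₀] [Algebra k K]
  [Algebra K₀ K] [IsScalarTower k K₀ K] [Fintype ι] [Fintype κ]

/-- The derivations of `K` that vanish on generators of `K₀` are the derivations of `K` over
`K₀`. -/
theorem finrank_derKill {η : κ → K₀} (hη : IntermediateField.adjoin k (Set.range η) = ⊤)
    {ξ : ι → K} {c : κ → ι} (hc : ∀ a, algebraMap K₀ K (η a) = ξ (c a)) :
    Module.finrank K (derKill k ξ (Set.range c)) = Module.finrank K (Derivation K₀ K K) := by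
  let φ : Derivation K₀ K K →ₗ[K] derKill k ξ (Set.range c) :=
    { toFun := fun D => ⟨D.restrictScalars k, by
        rintro _ ⟨a, rfl⟩
        rw [← hc]
        exact D.map_algebraMap _⟩
      map_add' := fun _ _ => rfl
      map_smul' := fun _ _ => rfl }
  refine (LinearEquiv.finrank_eq (LinearEquiv.ofBijective φ ⟨fun D D' h => ?_, fun D => ?_⟩)).symm
  · ext z
    exact congrArg (fun E => E.1 z) h
  · have h0 : D.1.compAlgebraMap K₀ = 0 :=
      derivation_eq_zero_of_gen hη _ fun a => by
        have : D.1 (algebraMap K₀ K (η a)) = 0 := by rw [hc]; exact D.2 _ ⟨a, rfl⟩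
        exact this
    have h1 : ∀ z, D.1 (algebraMap K₀ K z) = 0 := fun z => congrArg (fun E => E z) h0
    refine ⟨Derivation.mk' { toFun := D.1, map_add' := map_add D.1, map_smul' := fun z w => ?_ }
      D.1.leibniz, ?_⟩
    · rw [Algebra.smul_def, Derivation.leibniz, h1, smul_zero, add_zero, algebraMap_smul]
      rfl
    · ext z
      rfl

theorem toNat_trdeg_add [Algebra.EssFiniteType k K₀] [Algebra.EssFiniteType K₀ K] :
    Cardinal.toNat (Algebra.trdeg k K₀) + Cardinal.toNat (Algebra.trdeg K₀ K) =
      Cardinal.toNat (Algebra.trdeg k K) := by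
  have h := congrArg Cardinal.toNat (lift_trdeg_add_eq k K₀ K)
  rw [Cardinal.toNat_add (Cardinal.lift_lt_aleph0.2 (trdeg_lt_aleph0 k K₀))
    (Cardinal.lift_lt_aleph0.2 (trdeg_lt_aleph0 K₀ K)), Cardinal.toNat_lift, Cardinal.toNat_lift,
    Cardinal.toNat_lift] at h
  exact h

/-- Separability of `K / K₀` in terms of derivations. -/
theorem isSeparablyGenerated_iff {η : κ → K₀}
    (hη : IntermediateField.adjoin k (Set.range η) = ⊤) {ξ : ι → K}
    (hξ : IntermediateField.adjoin k (Set.range ξ) = ⊤) {c : κ → ι}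
    (hc : ∀ a, algebraMap K₀ K (η a) = ξ (c a)) :
    IsSeparablyGenerated K₀ K ↔ Module.finrank K (derKill k ξ (Set.range c)) +
      Cardinal.toNat (Algebra.trdeg k K₀) = Cardinal.toNat (Algebra.trdeg k K) := by
  have h1 : Algebra.EssFiniteType k K₀ := essFiniteType_of_gen hη
  have h2 : Algebra.EssFiniteType k K := essFiniteType_of_gen hξ
  have h3 : Algebra.EssFiniteType K₀ K := Algebra.EssFiniteType.of_comp k K₀ K
  rw [finrank_derKill hη hc, finrank_derivation, ← toNat_trdeg_add (k := k) (K₀ := K₀) (K := K),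
    add_comm, Nat.add_left_cancel_iff]
  constructor
  · rintro ⟨s, hs, hsep⟩
    exact finrank_kaehler_of_separable hs hsep
  · exact fun h => isSeparablyGenerated_of_finrank_kaehler h.le

end Separable

namespace Rows

variable {k P Q : Type*} {ι κ : Type} [Field k] [HomogCoords k P ι] [HomogCoords k Q κ] [Fintype ι]
  [Fintype κ] {R R' C : Type} [Fintype R] [DecidableEq R] [Fintype R'] [DecidableEq R']
  (ρ : Rows P R C) (ρ' : Rows Q R' C)

/-- The dimension of a variety as a natural number. -/
def dimN {P : Type*} {ι : Type} [HomogCoords k P ι] {Z : Set P} (hZ : IsVariety Z) : ℕ :=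
  Cardinal.toNat (Algebra.trdeg k (FunField hZ))

theorem zdim_eq [IsAlgClosed k] (ρ : Rows P R C) {Z : Set P} (hZ : IsVariety Z) :
    zdim Z = (dimN hZ : WithBot ℕ∞) := ρ.zdim_eq_trdeg hZ

theorem card_entries_eq (ρ : Rows P R C) : Nat.card (ρ.Entries ∅) =
    Nat.card {ij : R × R // ρ.lbl ij.1 = ρ.lbl ij.2} :=
  Nat.card_congr (Equiv.subtypeEquivRight fun ij => by simp)

/-- At a general point, the dimension of the tangent space is the dimension of the variety and that
of the group of changes of coordinates. -/
theorem eventually_finrank_coneTangent [IsAlgClosed k] (ρ : Rows P R C) {Z : Set P}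
    (hZ : IsVariety Z) : ∀ᶠ x in generic Z, ∀ v ∈ coords x,
      Module.finrank k (coneTangent Z v) = dimN hZ + Nat.card (ρ.Entries ∅) := by
  obtain ⟨z, hz⟩ := hZ.2.1
  obtain ⟨J, hJ⟩ := ρ.exists_mem_dom z
  have hJ' : (Z ∩ ρ.dom J).Nonempty := ⟨z, hz, hJ⟩
  have hU : ∀ i j, ρ.lbl i = ρ.lbl j → i ∈ (∅ : Set R) → j ∈ (∅ : Set R) := by simp
  have hg := ρ.isGeneric_gen hZ hJ'
  have h1 := hg.finrank_tanRel ∅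
  have h2 : derKill k (ρ.gen hZ hJ') {a | (ρ.idx a).1 ∈ (∅ : Set R)} = ⊤ := by
    rw [eq_top_iff]; rintro D - a ha; exact absurd ha (Set.notMem_empty _)
  have h3 : Algebra.EssFiniteType k (FunField hZ) := essFiniteType_of_gen hg.adjoin_eq
  rw [h2, finrank_top, finrank_derivation, finrank_kaehler_of_perfect] at h1
  filter_upwards [ρ.eventually_finrank_tanRel hZ hJ' hU] with x hx v hv
  have h4 : ρ.tanRel ∅ Z v = coneTangent Z v := by
    rw [← tangentAt_eq_coneTangent]
    ext w
    exact ⟨fun h => h.1, fun h => ⟨h, fun a ha => absurd ha (Set.notMem_empty _)⟩⟩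
  rw [← h4, hx v hv, h1]
  rfl

/-- The map `f` forgets some of the blocks of rows. -/
structure RowMap (ρ : Rows P R C) (ρ' : Rows Q R' C) (f : P → Q) where
  /-- The rows that are kept. -/
  row : R' → R
  row_injective : Function.Injective row
  /-- The coordinates that are kept. -/
  coord : κ → ι
  idx_coord : ∀ a, ρ.idx (coord a) = (row (ρ'.idx a).1, (ρ'.idx a).2)
  lbl_iff : ∀ i j, ρ.lbl (row i) = ρ.lbl (row j) ↔ ρ'.lbl i = ρ'.lbl j
  block : ∀ i j, ρ.lbl i = ρ.lbl j → i ∈ Set.range row → j ∈ Set.range row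
  mem : ∀ x, ∀ v ∈ coords x, v ∘ coord ∈ coords (f x)

namespace RowMap

variable {ρ ρ'} {f : P → Q} (F : RowMap ρ ρ' f)

theorem isPolyMap (F : RowMap ρ ρ' f) : IsPolyMap f :=
  ⟨fun a => X (F.coord a), fun x v hv => by simpa [Function.comp_def] using F.mem x v hv⟩

theorem N_comp (J : R → C) {A : Type*} [CommRing A] [Algebra k A] {v : ι → A} (h : ρ.N J v = 1) :
    ρ'.N (J ∘ F.row) (v ∘ F.coord) = 1 := by
  ext i l
  have h1 := congrFun (congrFun h (F.row i)) (F.row l)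
  rw [N_apply] at h1 ⊢
  simp only [F.lbl_iff] at h1
  have h2 : F.coord (ρ'.idx.symm (i, J (F.row l))) = ρ.idx.symm (F.row i, J (F.row l)) := by
    rw [Equiv.eq_symm_apply, F.idx_coord]; simp
  simp only [Function.comp_apply, h2, h1, Matrix.one_apply, F.row_injective.eq_iff]

theorem mem_dom {J : R → C} {x : P} (hx : x ∈ ρ.dom J) :
    f x ∈ ρ'.dom (J ∘ F.row) ∧ ρ'.ν (J ∘ F.row) (f x) = ρ.ν J x ∘ F.coord := by
  have h1 := F.N_comp J (N_ν hx)
  have h2 := F.mem x _ (ν_mem hx)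
  exact ⟨⟨_, h2, by rw [h1]; simp⟩, by rw [ρ'.ν_eq h2, ρ'.nrm_of_N_eq_one h1]⟩

theorem range_coord : {a | (ρ.idx a).1 ∈ Set.range F.row} = Set.range F.coord := by
  ext a
  constructor
  · rintro ⟨i, hi⟩
    refine ⟨ρ'.idx.symm (i, (ρ.idx a).2), ρ.idx.injective ?_⟩
    rw [F.idx_coord]
    simp [hi]
  · rintro ⟨b, rfl⟩
    exact ⟨_, by rw [F.idx_coord]⟩

variable [IsAlgClosed k] {Z : Set P} (hZ : IsVariety Z) (hf : IsPolyMap f)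

/-- Separability in terms of the dimension of the tangent spaces of the fibres, which is that of the
relative derivations of the function fields. -/
theorem isSeparableMorphism_iff_finrank (F : RowMap ρ ρ' f) (hZ : IsVariety Z) (hf : IsPolyMap f) :
    IsSeparableMorphism f Z ↔ ∀ᶠ z in generic Z, ∀ v ∈ coords z,
      Module.finrank k (ρ.tanRel (Set.range F.row) Z v) + dimN (hf.isVariety hZ) =
        dimN hZ + Nat.card (ρ.Entries (Set.range F.row)) := by
  obtain ⟨z, hz⟩ := hZ.2.1
  obtain ⟨J, hJ⟩ := ρ.exists_mem_dom z
  have hJ' : (Z ∩ ρ.dom J).Nonempty := ⟨z, hz, hJ⟩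
  have hW := hf.isVariety hZ
  have hJW : (imageVariety f Z ∩ ρ'.dom (J ∘ F.row)).Nonempty :=
    ⟨f z, subset_closure ⟨z, hz, rfl⟩, (F.mem_dom hJ).1⟩
  have hg := ρ.isGeneric_gen hZ hJ'
  let pb : FunField hW →+* FunField hZ := pullback hf hZ
  let _ : Algebra (FunField hW) (FunField hZ) := pb.toAlgebra
  have hT : IsScalarTower k (FunField hW) (FunField hZ) := .of_algebraMap_eq fun c => rfl
  have hgen : ∀ a, algebraMap (FunField hW) (FunField hZ) (ρ'.gen hW hJW a) =
      ρ.gen hZ hJ' (F.coord a) := by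
    intro a
    apply FunField.toGerm_injective hZ
    refine Germ.coe_eq.2 ?_
    filter_upwards [ρ.eventually_dom hZ hJ'] with x hx
    exact congrFun (F.mem_dom hx.2).2 a
  have hsep : IsSeparableMorphism f Z ↔ IsSeparablyGenerated (FunField hW) (FunField hZ) :=
    ⟨fun ⟨_, _, h⟩ => h, fun h => ⟨hf, hZ, h⟩⟩
  have h1 := hg.finrank_tanRel (Set.range F.row)
  rw [hsep, isSeparablyGenerated_iff (k := k) (ρ'.adjoin_gen hW hJW) (ρ.adjoin_gen hZ hJ') hgen,
    ← F.range_coord]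
  have h2 := ρ.eventually_finrank_tanRel hZ hJ' F.block
  have hne := generic_neBot hZ.2.1
  constructor
  · intro h
    filter_upwards [h2] with x hx v hv
    rw [hx v hv, h1, add_right_comm]
    exact congrArg (· + _) h
  · intro h
    obtain ⟨x, hx, hx2⟩ := (h.and h2).exists
    obtain ⟨v, hv⟩ := coords_nonempty x
    have h3 := hx v hv
    rw [hx2 v hv, h1, add_right_comm] at h3
    exact Nat.add_right_cancel h3

/-- The restriction of coordinate vectors. -/
def restr (F : RowMap ρ ρ' f) (k : Type*) [Field k] : (ι → k) →ₗ[k] (κ → k) :=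
  LinearMap.funLeft k k F.coord

theorem isPt_comp (F : RowMap ρ ρ' f) {A : Type*} [CommRing A] [Algebra k A] {v : ι → A}
    (hv : IsPt Z v) : IsPt (imageVariety f Z) (v ∘ F.coord) := fun p hp => by
  have h1 : rename F.coord p ∈ vanishing Z := fun x hx u hu => by
    rw [eval_rename]
    exact hp _ (subset_closure ⟨x, hx, rfl⟩) _ (F.mem x u hu)
  rw [← aeval_rename]
  exact hv _ h1

theorem comp_mem_coneTangent (F : RowMap ρ ρ' f) {v w : ι → k} (hv : IsPt Z v)
    (hw : w ∈ coneTangent Z v) : w ∘ F.coord ∈ coneTangent (imageVariety f Z) (v ∘ F.coord) := by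
  rw [← tangentAt_eq_coneTangent] at hw ⊢
  have h1 : IsPt Z (dual v w) := isPt_dual.2 ⟨hv, hw⟩
  have h2 : dual v w ∘ F.coord = dual (v ∘ F.coord) (w ∘ F.coord) := rfl
  have h3 := F.isPt_comp h1
  rw [h2] at h3
  exact (isPt_dual.1 h3).2

theorem map_restr_le (F : RowMap ρ ρ' f) {v : ι → k} (hv : IsPt Z v) :
    (coneTangent Z v).map (F.restr k) ≤ coneTangent (imageVariety f Z) (v ∘ F.coord) := by
  rintro _ ⟨w, hw, rfl⟩
  exact F.comp_mem_coneTangent hv hw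

/-- The differential of a projection has as its kernel the tangent space of the fibre. -/
theorem finrank_map_restr_add (F : RowMap ρ ρ' f) (Z : Set P) (v : ι → k) :
    Module.finrank k ((coneTangent Z v).map (F.restr k)) +
      Module.finrank k (ρ.tanRel (Set.range F.row) Z v) = Module.finrank k (coneTangent Z v) := by
  have h := LinearMap.finrank_range_add_finrank_ker ((F.restr k).domRestrict (coneTangent Z v))
  rw [LinearMap.range_domRestrict] at h
  rw [← h, Nat.add_left_cancel_iff]
  let g : LinearMap.ker ((F.restr k).domRestrict (coneTangent Z v)) →ₗ[k] (ι → k) :=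
    (coneTangent Z v).subtype ∘ₗ Submodule.subtype _
  have hg : LinearMap.range g = ρ.tanRel (Set.range F.row) Z v := by
    ext w
    have h1 : w ∈ ρ.tanRel (Set.range F.row) Z v ↔
      w ∈ tangentAt Z v ∧ ∀ a, (ρ.idx a).1 ∈ Set.range F.row → w a = 0 := Iff.rfl
    rw [h1, tangentAt_eq_coneTangent]
    constructor
    · rintro ⟨⟨⟨w, hw⟩, hw0⟩, rfl⟩
      refine ⟨hw, fun a ha => ?_⟩
      obtain ⟨b, rfl⟩ : a ∈ Set.range F.coord := by rw [← F.range_coord]; exact ha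
      exact congrFun (LinearMap.mem_ker.1 hw0) b
    · rintro ⟨hw, hw0⟩
      refine ⟨⟨⟨w, hw⟩, LinearMap.mem_ker.2 (funext fun b => hw0 _ ?_)⟩, rfl⟩
      change F.coord b ∈ {a | (ρ.idx a).1 ∈ Set.range F.row}
      rw [F.range_coord]
      exact ⟨b, rfl⟩
  rw [← hg]
  refine LinearMap.finrank_range_of_inj ?_
  exact Subtype.val_injective.comp Subtype.val_injective

theorem card_entries (F : RowMap ρ ρ' f) : Nat.card (ρ.Entries ∅) =
    Nat.card (ρ'.Entries ∅) + Nat.card (ρ.Entries (Set.range F.row)) := by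
  rw [← Nat.card_sum]
  symm
  refine Nat.card_eq_of_bijective (Sum.elim
    (fun ij => ⟨(F.row ij.1.1, F.row ij.1.2), (F.lbl_iff _ _).2 ij.2.1, Set.notMem_empty _⟩)
    (fun ij => ⟨ij.1, ij.2.1, Set.notMem_empty _⟩)) ⟨?_, ?_⟩
  · rintro (⟨⟨i, j⟩, h⟩ | ⟨⟨i, j⟩, h⟩) (⟨⟨i', j'⟩, h'⟩ | ⟨⟨i', j'⟩, h'⟩) heq
    · simp only [Sum.elim_inl, Subtype.mk.injEq, Prod.mk.injEq, F.row_injective.eq_iff] at heq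
      simp [heq]
    · simp only [Sum.elim_inl, Sum.elim_inr, Subtype.mk.injEq, Prod.mk.injEq] at heq
      exact absurd ⟨i, heq.1⟩ h'.2
    · simp only [Sum.elim_inl, Sum.elim_inr, Subtype.mk.injEq, Prod.mk.injEq] at heq
      exact absurd ⟨i', heq.1.symm⟩ h.2
    · simp only [Sum.elim_inr, Subtype.mk.injEq, Prod.mk.injEq] at heq
      simp [heq]
  · rintro ⟨⟨i, j⟩, h, -⟩
    by_cases hi : i ∈ Set.range F.row
    · obtain ⟨j, rfl⟩ := F.block i j h hi
      obtain ⟨i, rfl⟩ := hi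
      exact ⟨Sum.inl ⟨(i, j), (F.lbl_iff _ _).1 h, Set.notMem_empty _⟩, rfl⟩
    · exact ⟨Sum.inr ⟨(i, j), h, hi⟩, rfl⟩

/-- A morphism that forgets blocks of rows is separable if and only if its differential is
surjective at general points. -/
theorem isSeparableMorphism_iff (F : RowMap ρ ρ' f) (hZ : IsVariety Z) :
    IsSeparableMorphism f Z ↔ ∀ᶠ z in generic Z, ∀ v ∈ coords z,
      (coneTangent Z v).map (F.restr k) = coneTangent (imageVariety f Z) (v ∘ F.coord) := by
  have hf := F.isPolyMap
  rw [F.isSeparableMorphism_iff_finrank hZ hf]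
  refine eventually_congr ?_
  filter_upwards [ρ.eventually_finrank_coneTangent hZ, eventually_mem Z,
    (hf.tendsto hZ).eventually (ρ'.eventually_finrank_coneTangent (hf.isVariety hZ))]
    with z h1 hz h2
  refine forall₂_congr fun v hv => ?_
  have h3 := F.finrank_map_restr_add Z v
  have h4 := h2 _ (F.mem z v hv)
  have h5 := F.card_entries
  rw [h1 v hv] at h3
  constructor
  · intro h
    refine Submodule.eq_of_le_of_finrank_eq (F.map_restr_le (isPt_of_mem hz hv)) ?_
    omega
  · intro h
    rw [h] at h3
    omega

/-- The dimension of the tangent spaces of the fibres is at least the difference of the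
dimensions. -/
theorem eventually_dimN_le (F : RowMap ρ ρ' f) (hZ : IsVariety Z)
    (hW : IsVariety (imageVariety f Z)) :
    ∀ᶠ z in generic Z, ∀ v ∈ coords z, dimN hZ + Nat.card (ρ.Entries (Set.range F.row)) ≤
      Module.finrank k (ρ.tanRel (Set.range F.row) Z v) + dimN hW := by
  have hf := F.isPolyMap
  filter_upwards [ρ.eventually_finrank_coneTangent hZ, eventually_mem Z,
    (hf.tendsto hZ).eventually (ρ'.eventually_finrank_coneTangent hW)] with z h1 hz h2 v hv
  have h3 := F.finrank_map_restr_add Z v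
  have h4 := h2 _ (F.mem z v hv)
  have h5 := F.card_entries
  have h6 := Submodule.finrank_mono (F.map_restr_le (isPt_of_mem hz hv))
  rw [h1 v hv] at h3
  omega

end RowMap

/-- The projection to the first factor of a product. -/
def fstMap {P Q : Type*} {ι κ : Type} [HomogCoords k P ι] [HomogCoords k Q κ] {R R' C : Type}
    [Fintype R] [DecidableEq R] [Fintype R'] [DecidableEq R'] (ρ : Rows P R C) (ρ' : Rows Q R' C) :
    RowMap (prodRows ρ ρ') ρ Prod.fst where
  row := Sum.inl
  row_injective := Sum.inl_injective
  coord := Sum.inl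
  idx_coord _ := rfl
  lbl_iff i j := by simp [prodRows, prodLbl]
  block := by
    rintro _ (j | j) h ⟨i, rfl⟩
    · exact ⟨j, rfl⟩
    · simp only [prodRows, prodLbl, Sum.elim_inl, Sum.elim_inr] at h
      omega
  mem _ _ hv := hv.1

/-- The projection to the second factor of a product. -/
def sndMap {P Q : Type*} {ι κ : Type} [HomogCoords k P ι] [HomogCoords k Q κ] {R R' C : Type}
    [Fintype R] [DecidableEq R] [Fintype R'] [DecidableEq R'] (ρ : Rows P R C) (ρ' : Rows Q R' C) :
    RowMap (prodRows ρ ρ') ρ' Prod.snd where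
  row := Sum.inr
  row_injective := Sum.inr_injective
  coord := Sum.inr
  idx_coord _ := rfl
  lbl_iff i j := by simp [prodRows, prodLbl]
  block := by
    rintro _ (j | j) h ⟨i, rfl⟩
    · simp only [prodRows, prodLbl, Sum.elim_inl, Sum.elim_inr] at h
      omega
    · exact ⟨j, rfl⟩
  mem _ _ hv := hv.2

end Rows

/-! ### Images of closed sets under the projections -/

theorem IsPt.of_injective {k P : Type*} {ι : Type} [Field k] [HomogCoords k P ι] {Z : Set P}
    {A B : Type*} [CommRing A] [Algebra k A] [CommRing B] [Algebra k B] {v : ι → A} (f : A →ₐ[k] B)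
    (hf : Function.Injective f) (h : IsPt Z fun i => f (v i)) : IsPt Z v := fun p hp => by
  apply hf
  have := h p hp
  rwa [← MvPolynomial.comp_aeval_apply, ← map_zero f] at this

theorem IsVariety.image_of_inverse {k P Q : Type*} {ι κ : Type} [Field k] [HomogCoords k P ι]
    [HomogCoords k Q κ] {f : P → Q} {g : Q → P} {Z : Set P} (hZ : IsVariety Z) (hf : IsPolyMap f)
    (hg : IsPolyMap g) (hgf : ∀ x, g (f x) = x) (hfg : ∀ y, f (g y) = y) : IsVariety (f '' Z) := by
  refine ⟨?_, hZ.2.image _ hf.continuous.continuousOn⟩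
  rw [Set.image_eq_preimage_of_inverse hgf hfg]
  exact hZ.1.preimage hg.continuous

/-- If every relation between the `η a` holds for the `y a`, then `η` specializes to `y` along a
valuation ring. -/
theorem exists_valuationSubring {k K α : Type*} [Field k] [Field K] [Algebra k K] {η : α → K}
    {y : α → k} (h : ∀ p : MvPolynomial α k, aeval η p = 0 → eval y p = 0) :
    ∃ O : ValuationSubring K, (∀ p : MvPolynomial α k, aeval η p ∈ O) ∧
      ∀ p : MvPolynomial α k, eval y p = 0 → aeval η p ∈ O.nonunits := by
  let A : Subring K := (aeval (R := k) η).range.toSubring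
  let I : Ideal A :=
    { carrier := {a | ∃ p : MvPolynomial α k, aeval η p = a.1 ∧ eval y p = 0}
      zero_mem' := ⟨0, by simp, by simp⟩
      add_mem' := by
        rintro a b ⟨p, hp, hp0⟩ ⟨q, hq, hq0⟩
        exact ⟨p + q, by simp [hp, hq], by simp [hp0, hq0]⟩
      smul_mem' := by
        rintro ⟨_, q, rfl⟩ b ⟨p, hp, hp0⟩
        refine ⟨q * p, ?_, by simp [hp0]⟩
        rw [map_mul, hp]
        rfl }
  have hI : I ≠ ⊤ := by
    rw [Ne, Ideal.eq_top_iff_one]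
    rintro ⟨p, hp, hp0⟩
    have h1 : eval y (p - 1) = 0 := h _ (by rw [map_sub, hp, map_one]; exact sub_self _)
    rw [map_sub, hp0, map_one, zero_sub, neg_eq_zero] at h1
    exact one_ne_zero h1
  obtain ⟨O, hO, hO'⟩ := Ideal.image_subset_nonunits_valuationSubring I hI
  exact ⟨O, fun p => hO ⟨p, rfl⟩, fun p hp => hO' ⟨⟨aeval η p, p, rfl⟩, ⟨p, rfl, hp⟩, rfl⟩⟩

/-- A system of polynomial equations over an algebraically closed field which has a solution in an
extension field has a solution. -/
theorem exists_specialization {k K α : Type*} [Field k] [IsAlgClosed k] [Field K] [Algebra k K]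
    [Finite α] (η : α → K) :
    ∃ y : α → k, ∀ p : MvPolynomial α k, aeval η p = 0 → eval y p = 0 := by
  let I : Ideal (MvPolynomial α k) := RingHom.ker (aeval (R := k) η)
  have hI : I.IsPrime := RingHom.ker_isPrime _
  have h1 : vanishingIdeal k (zeroLocus k I) = I := IsPrime.vanishingIdeal_zeroLocus I
  obtain ⟨y, hy⟩ : (zeroLocus k I).Nonempty := by
    rw [Set.nonempty_iff_ne_empty]
    intro h0
    rw [h0, vanishingIdeal_empty] at h1
    exact hI.ne_top h1.symm
  exact ⟨y, fun p hp => by rw [← MvPolynomial.aeval_eq_eval]; exact hy p hp⟩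

namespace Rows

section Valuation

variable {k Q : Type*} {κ : Type} [Field k] [HomogCoords k Q κ] [Fintype κ] {R C : Type}
  [Fintype R] [DecidableEq R] [Finite C] (ρ : Rows Q R C)

/-- A point of a Grassmannian with values in the fraction field of a valuation ring has coordinates
in the valuation ring: normalize a minor of smallest valuation. -/
theorem exists_nrm_mem (ρ : Rows Q R C) (hone : ∀ i j, ρ.lbl i = ρ.lbl j) {K : Type*} [Field K]
    [Algebra k K] (O : ValuationSubring K) {ζ : κ → K} {J₀ : R → C}
    (h : IsUnit (ρ.N J₀ ζ).det) :
    ∃ J, IsUnit (ρ.N J ζ).det ∧ ∀ a, ρ.nrm J ζ a ∈ O := by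
  have : Nonempty (R → C) := ⟨J₀⟩
  obtain ⟨J, hJ⟩ := Finite.exists_max fun J : R → C => O.valuation (ρ.N J ζ).det
  have h0 : O.valuation (ρ.N J ζ).det ≠ 0 := by
    have := (O.valuation.pos_iff.2 h.ne_zero).trans_le (hJ J₀)
    exact this.ne'
  have hu : IsUnit (ρ.N J ζ).det := isUnit_iff_ne_zero.2 (O.valuation.ne_zero_iff.1 h0)
  refine ⟨J, hu, fun a => ?_⟩
  have h1 : ρ.act (ρ.N J ζ).adjugate ζ a =
      (ρ.N (Function.update J (ρ.idx a).1 (ρ.idx a).2) ζ).det := by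
    have h2 : ρ.act (ρ.N J ζ).adjugate ζ a =
        ((ρ.N J ζ).adjugate.mulVec fun l => ζ (ρ.idx.symm (l, (ρ.idx a).2))) (ρ.idx a).1 := by
      rw [act, actOn_apply]; rfl
    rw [h2, ← Matrix.cramer_eq_adjugate_mulVec, Matrix.cramer_apply]
    congr 1
    ext i l
    rw [Matrix.updateCol_apply, N_apply, N_apply, if_pos (hone _ _), if_pos (hone _ _),
      Function.update_apply]
    split_ifs <;> rfl
  have h2 := ρ.det_mul_nrm J hu a
  rw [h1] at h2
  have h3 := congrArg O.valuation h2
  rw [map_mul] at h3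
  rw [← O.valuation_le_one_iff]
  have h4 := hJ (Function.update J (ρ.idx a).1 (ρ.idx a).2)
  rw [← h3] at h4
  by_contra hlt
  rw [not_le] at hlt
  exact absurd h4 (not_le.2 ((lt_mul_iff_one_lt_right (zero_lt_iff.2 h0)).2 hlt))

end Valuation

variable {k P Q : Type*} {ι κ : Type} [Field k] [IsAlgClosed k] [HomogCoords k P ι]
  [HomogCoords k Q κ] [Fintype ι] [Fintype κ] {R R' C : Type} [Fintype R] [DecidableEq R]
  [Fintype R'] [DecidableEq R'] [Finite C]

theorem prodRows_act (ρ : Rows P R C) (ρ' : Rows Q R' C) {A : Type*} [CommRing A]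
    (B : Matrix R' R' A) (u : ι → A) (v : κ → A) :
    (prodRows ρ ρ').act (Matrix.fromBlocks 1 0 0 B) (Sum.elim u v) = Sum.elim u (ρ'.act B v) := by
  refine (actOn_fromBlocks _ _ _ _ _).trans ?_
  rw [Sum.elim_comp_inl, Sum.elim_comp_inr, actOn_one]
  rfl

theorem prodRows_N (ρ : Rows P R C) (ρ' : Rows Q R' C) (J : R → C) (J' : R' → C) {A : Type*}
    [CommRing A] (v : ι ⊕ κ → A) :
    (prodRows ρ ρ').N (Sum.elim J J') v =
      Matrix.fromBlocks (ρ.N J (v ∘ Sum.inl)) 0 0 (ρ'.N J' (v ∘ Sum.inr)) := by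
  refine Eq.trans ?_ (blockOf_fromRows ρ.lbl ρ'.lbl (Sum.elim J J') _ _)
  rw [← matOf_prodIdx]
  rfl

/-- A relation between the coordinates that are kept holds on the closure of the image. -/
theorem RowMap.eval_ν_eq_zero {ρ : Rows P R C} {ρ' : Rows Q R' C} {f : P → Q} (F : RowMap ρ ρ' f)
    {Z : Set P} (hZ : IsVariety Z) {J : R → C} (hJ : (Z ∩ ρ.dom J).Nonempty) {p : MvPolynomial κ k}
    (hp : aeval (ρ.gen hZ hJ ∘ F.coord) p = 0) {y : Q} (hy : y ∈ imageVariety f Z)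
    (hy' : y ∈ ρ'.dom (J ∘ F.row)) : eval (ρ'.ν (J ∘ F.row) y) p = 0 := by
  let T : Set Q := {y | ∀ v ∈ coords y, eval v (ρ'.detPoly (J ∘ F.row) * ρ'.hat (J ∘ F.row) p) = 0}
  have key : ∀ y ∈ ρ'.dom (J ∘ F.row), y ∈ T ↔ eval (ρ'.ν (J ∘ F.row) y) p = 0 := by
    intro y hy
    constructor
    · intro h
      have h := h _ (ν_mem hy)
      have hN := N_ν hy
      rw [map_mul, ← MvPolynomial.aeval_eq_eval, ρ'.aeval_hat _ p (by rw [hN]; simp),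
        aeval_detPoly, hN, ρ'.nrm_of_N_eq_one hN] at h
      simpa [MvPolynomial.aeval_eq_eval] using h
    · intro h v hv
      have hu := (mem_dom_iff hv).1 hy
      rw [map_mul, ← MvPolynomial.aeval_eq_eval, ρ'.aeval_hat _ p hu, ← ρ'.ν_eq hv,
        show aeval (ρ'.ν (J ∘ F.row) y) p = 0 by rw [MvPolynomial.aeval_eq_eval, h], mul_zero,
        mul_zero]
  have hT : IsClosed T := ρ'.isClosed_forall _
  rw [← aeval_rename, aeval_gen_eq_zero] at hp
  have h1 : Z ⊆ f ⁻¹' T := by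
    refine closed_of_eventually (hT.preimage F.isPolyMap.continuous) ?_
    filter_upwards [hp, ρ.eventually_dom hZ hJ] with x hx hx'
    obtain ⟨h2, h3⟩ := F.mem_dom hx'.2
    refine (key _ h2).2 ?_
    rwa [h3, ← eval_rename]
  exact (key y hy').1 (closure_minimal (Set.image_subset_iff.2 h1) hT hy)

/-- A point of the closure of the image is the image of a point with values in a valuation ring,
which can be specialized since the second factor is proper. -/
theorem exists_mem_of_gen (ρ : Rows P R C) (ρ' : Rows Q R' C) (hone : ∀ i j, ρ'.lbl i = ρ'.lbl j)
    {Z : Set (P × Q)} (hZ : @IsClosed (P × Q) (zariski (P × Q)) Z) {K : Type*} [Field K]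
      [Algebra k K] {η : ι → K} {ζ : κ → K}
    (hpt : IsPt Z (Sum.elim η ζ)) {J : R' → C} (hJ : IsUnit (ρ'.N J ζ).det) {x : P} {y : ι → k}
    (hy : y ∈ coords x) (h : ∀ p : MvPolynomial ι k, aeval η p = 0 → eval y p = 0) :
    x ∈ Prod.fst '' Z := by
  classical
  -- a valuation ring that dominates the local ring of `y`; the point `ζ` of the second factor
  -- extends to it after renormalization
  obtain ⟨O, hO, hO'⟩ := exists_valuationSubring h
  obtain ⟨J, hJ, hmem⟩ := ρ'.exists_nrm_mem hone O hJ
  let _ : Algebra k O := ((algebraMap k K).codRestrict O.toSubring fun c => by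
    have := hO (MvPolynomial.C c)
    rwa [algHom_C] at this).toAlgebra
  let i : O →ₐ[k] K := { O.subtype with commutes' := fun c => rfl }
  let res : O →ₐ[k] IsLocalRing.ResidueField O :=
    { IsLocalRing.residue O with commutes' := fun c => rfl }
  have hηO : ∀ a, η a ∈ O := fun a => by simpa using hO (X a)
  have h1 : IsPt Z (Sum.elim η (ρ'.nrm J ζ)) := by
    rw [nrm, ← ρ.prodRows_act ρ']
    refine isPt_act _ ((IsBlock.one _).fromBlocks ((ρ'.isBlock_N J ζ).inv hJ)) ?_ hpt
    rw [Matrix.det_fromBlocks_zero₂₁, Matrix.det_one, one_mul]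
    exact isUnit_det_inv hJ
  let v : ι ⊕ κ → O := Sum.elim (fun a => ⟨η a, hηO a⟩) (fun a => ⟨_, hmem a⟩)
  have h2 : IsPt Z v := by
    refine IsPt.of_injective i Subtype.val_injective ?_
    convert! h1 using 1
    funext a
    rcases a with a | a <;> rfl
  have h3 := h2.map res
  have h4 : ∀ a, res (v (Sum.inl a)) = algebraMap k _ (y a) := fun a => by
    rw [← res.commutes, ← sub_eq_zero, ← map_sub]
    refine (IsLocalRing.residue_eq_zero_iff _).2 ?_
    have h5 := hO' (X a - MvPolynomial.C (y a)) (by simp)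
    rw [map_sub, aeval_X, algHom_C] at h5
    obtain ⟨z, hz, hz'⟩ :
        ∃ z ∈ IsLocalRing.maximalIdeal O, (z : K) = η a - algebraMap k K (y a) := by
      rw [← SetLike.mem_coe, ← O.image_maximalIdeal] at h5
      exact h5
    convert! hz using 1
    exact Subtype.ext hz'.symm
  have hN : ρ'.N J (fun a => res (v (Sum.inr a))) = 1 := by
    have h6 : ρ'.N J (fun a => v (Sum.inr a)) = 1 := by
      have h7 := ρ'.N_map J i.toRingHom (fun a => v (Sum.inr a))
      have h8 : ρ'.N J (fun a => i.toRingHom (v (Sum.inr a))) = 1 := ρ'.N_nrm hJ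
      rw [h8] at h7
      ext a b
      have := congrFun (congrFun h7 a) b
      rw [Matrix.map_apply] at this
      refine this.symm.trans ?_
      rw [Matrix.one_apply, Matrix.one_apply]
      split_ifs <;> rfl
    have h7 := ρ'.N_map J res.toRingHom (fun a => v (Sum.inr a))
    rw [h6, Matrix.map_one _ (map_zero _) (map_one _)] at h7
    exact h7
  -- the residue field may be larger than `k`; specialize once more
  obtain ⟨u, hu⟩ := exists_specialization (k := k) fun a => res (v (Sum.inr a))
  have hNu : ρ'.N J u = 1 := by
    ext a b
    have h6 := congrFun (congrFun hN a) b
    rw [N_apply, if_pos (hone _ _)] at h6 ⊢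
    have h7 := hu (X (ρ'.idx.symm (a, J b)) - MvPolynomial.C ((1 : Matrix R' R' k) a b)) (by
      rw [map_sub, aeval_X, h6, algHom_C, Matrix.one_apply, Matrix.one_apply]
      split_ifs <;> simp)
    simpa [sub_eq_zero] using h7
  obtain ⟨q, -, hq, -⟩ := ρ'.exists_of_N_eq_one hNu
  refine ⟨(x, q), IsPt.mem (P := P × Q) hZ (x := (x, q)) (v := Sum.elim y u)
    ⟨by simpa using hy, by simpa using hq⟩ ?_, rfl⟩
  intro p hp
  have h6 := h3 p hp
  have h7 := hu (bind₁ (Sum.elim (fun a => MvPolynomial.C (y a)) X) p) (by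
    rw [aeval_bind₁, ← h6]
    congr 2
    funext a
    rcases a with a | a
    · simp [h4]
    · simp)
  rw [← MvPolynomial.aeval_eq_eval, aeval_bind₁] at h7
  rw [← h7]
  congr 2
  funext a
  rcases a with a | a <;> simp

/-- The first projection is closed if the coordinates of the second factor form a single block, as
those of a Grassmannian do: Grassmannians are complete. -/
theorem isClosed_fst_image (ρ : Rows P R C) (ρ' : Rows Q R' C) (hone : ∀ i j, ρ'.lbl i = ρ'.lbl j)
    {Z : Set (P × Q)} (hZ : IsVariety Z) : IsClosed (Prod.fst '' Z) := by
  rw [← closure_subset_iff_isClosed]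
  intro x hx
  have hf : IsPolyMap (Prod.fst : P × Q → P) := isPolyMap_fst
  have hW := hf.isVariety hZ
  obtain ⟨J, hJ⟩ := ρ.exists_mem_dom x
  have hJW : (imageVariety Prod.fst Z ∩ ρ.dom J).Nonempty := ⟨x, hx, hJ⟩
  obtain ⟨_, hzJ, ⟨z, hz, rfl⟩⟩ := mem_closure_iff.1 hx _ (ρ.isOpen_dom J) hJ
  obtain ⟨J', hJ'⟩ := ρ'.exists_mem_dom z.2
  have hdom : (Z ∩ (prodRows ρ ρ').dom (Sum.elim J J')).Nonempty := by
    obtain ⟨u, hu, hu'⟩ := hzJ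
    obtain ⟨v, hv, hv'⟩ := hJ'
    refine ⟨z, hz, Sum.elim u v, ⟨by simpa using hu, by simpa using hv⟩, ?_⟩
    rw [prodRows_N, Matrix.det_fromBlocks_zero₂₁, Sum.elim_comp_inl, Sum.elim_comp_inr]
    exact hu'.mul hv'
  have hN := (prodRows ρ ρ').N_gen hZ hdom
  rw [prodRows_N] at hN
  refine ρ.exists_mem_of_gen ρ' hone hZ.1
    (η := (prodRows ρ ρ').gen hZ hdom ∘ Sum.inl) (ζ := (prodRows ρ ρ').gen hZ hdom ∘ Sum.inr)
    (by rw [Sum.elim_comp_inl_inr]; exact (prodRows ρ ρ').isPt_gen hZ hdom) (J := J') ?_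
    (ν_mem hJ) fun p hp => ?_
  · have h1 := congrArg Matrix.toBlocks₂₂ hN
    rw [Matrix.toBlocks_fromBlocks₂₂, ← Matrix.fromBlocks_one, Matrix.toBlocks_fromBlocks₂₂] at h1
    rw [h1]; simp
  · exact (ρ.fstMap ρ').eval_ν_eq_zero hZ hdom hp hx hJ

theorem isClosed_snd_image (ρ : Rows P R C) (ρ' : Rows Q R' C) (hone : ∀ i j, ρ.lbl i = ρ.lbl j)
    {Z : Set (P × Q)} (hZ : IsVariety Z) : IsClosed (Prod.snd '' Z) := by
  have hswap : IsPolyMap (Prod.swap : Q × P → P × Q) :=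
    ⟨Sum.elim (fun a => X (Sum.inr a)) (fun a => X (Sum.inl a)), fun x v hv =>
      ⟨by simpa [Function.comp_def] using hv.2, by simpa [Function.comp_def] using hv.1⟩⟩
  have hswap' : IsPolyMap (Prod.swap : P × Q → Q × P) :=
    ⟨Sum.elim (fun a => X (Sum.inr a)) (fun a => X (Sum.inl a)), fun x v hv =>
      ⟨by simpa [Function.comp_def] using hv.2, by simpa [Function.comp_def] using hv.1⟩⟩
  have hZ' : IsVariety (Prod.swap '' Z : Set (Q × P)) :=
    hZ.image_of_inverse hswap' hswap Prod.swap_swap Prod.swap_swap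
  have h2 := ρ'.isClosed_fst_image ρ hone hZ'
  rw [Set.image_image] at h2
  exact h2

end Rows

/-! ### Linear algebra with polynomial entries -/

/-- The kernel of a matrix of polynomials is, where the rank does not jump, the image of a matrix
of polynomials. -/
theorem exists_frame {k σ m n : Type*} [Field k] [Fintype m] [Fintype n] [DecidableEq n]
    (M : Matrix m n (MvPolynomial σ k)) (y₀ : σ → k) :
    ∃ (h : MvPolynomial σ k) (Φ : Matrix n n (MvPolynomial σ k)), eval y₀ h ≠ 0 ∧
      (∀ (y : σ → k) (w : n → k), (M.map (eval y)).mulVec w = 0 →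
        (Φ.map (eval y)).mulVec w = eval y h • w) ∧
      ∀ y : σ → k, eval y h ≠ 0 → (M.map (eval y)).rank = (M.map (eval y₀)).rank →
        M.map (eval y) * Φ.map (eval y) = 0 := by
  classical
  obtain ⟨A, B, A', B', hM, hA, hB⟩ := exists_rank_factorization (M.map (eval y₀))
  let a' : Matrix _ m (MvPolynomial σ k) := A'.map C
  let b' : Matrix n _ (MvPolynomial σ k) := B'.map C
  let D := a' * M * b'
  have hD : ∀ y : σ → k, D.map (eval y) = A' * M.map (eval y) * B' := fun y => by
    have h1 : a'.map (eval y) = A' := by ext; simp [a']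
    have h2 : b'.map (eval y) = B' := by ext; simp [b']
    simp only [D, Matrix.map_mul, h1, h2]
  have hdet : ∀ y : σ → k, eval y D.det = (A' * M.map (eval y) * B').det := fun y => by
    rw [RingHom.map_det, RingHom.mapMatrix_apply, hD]
  -- the square matrix `D = A' M B'` is invertible at `y₀`, and its size is the rank of `M` there;
  -- `Φ` is its determinant times the projection to the kernel of `A' M` along the image of `B'`
  let Φ : Matrix n n (MvPolynomial σ k) := D.det • (1 : Matrix n n _) - b' * D.adjugate * a' * M
  have hΦ : ∀ y : σ → k, Φ.map (eval y) = eval y D.det • (1 : Matrix n n k) -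
      B' * (A' * M.map (eval y) * B').adjugate * A' * M.map (eval y) := fun y => by
    have h1 : a'.map (eval y) = A' := by ext; simp [a']
    have h2 : b'.map (eval y) = B' := by ext; simp [b']
    have h3 : D.adjugate.map (eval y) = (A' * M.map (eval y) * B').adjugate := by
      rw [← hD, ← RingHom.mapMatrix_apply, RingHom.map_adjugate, RingHom.mapMatrix_apply]
    rw [Matrix.map_sub _ (map_sub _), Matrix.map_mul, Matrix.map_mul, Matrix.map_mul, h1, h2, h3]
    congr 1
    ext i j
    simp [Matrix.one_apply, apply_ite (eval y)]
  refine ⟨D.det, Φ, ?_, fun y w hw => ?_, fun y hy hr => ?_⟩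
  · have h1 : A' * M.map (eval y₀) * B' = 1 :=
      (congrArg (fun Z => A' * Z * B') hM).trans
        (by rw [← Matrix.mul_assoc, hA, Matrix.one_mul, hB])
    rw [hdet, h1, Matrix.det_one]
    exact one_ne_zero
  · rw [hΦ, Matrix.sub_mulVec, ← Matrix.mulVec_mulVec, hw, Matrix.mulVec_zero, sub_zero,
      Matrix.smul_mulVec, Matrix.one_mulVec]
  · have hu : IsUnit (A' * M.map (eval y) * B').det := by
      rw [← hdet]; exact isUnit_iff_ne_zero.2 hy
    have h1 : (A' * M.map (eval y)) * Φ.map (eval y) = 0 := by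
      rw [hΦ, Matrix.mul_sub, hdet, Matrix.mul_smul, Matrix.mul_one]
      rw [show A' * M.map (eval y) *
            (B' * (A' * M.map (eval y) * B').adjugate * A' * M.map (eval y)) =
        ((A' * M.map (eval y) * B') * (A' * M.map (eval y) * B').adjugate) *
          (A' * M.map (eval y)) by
          simp only [Matrix.mul_assoc]]
      rw [Matrix.mul_adjugate, Matrix.smul_mul, Matrix.one_mul, sub_self]
    have h2 : (M.map (eval y)).rank ≤ (A' * M.map (eval y)).rank := by
      rw [hr]
      have h3 := Matrix.rank_mul_le_left (A' * M.map (eval y)) B'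
      rw [Matrix.rank_of_isUnit _ ((Matrix.isUnit_iff_isUnit_det _).2 hu), Fintype.card_fin] at h3
      exact h3
    have hker : LinearMap.ker (M.map (eval y)).mulVecLin =
        LinearMap.ker (A' * M.map (eval y)).mulVecLin := by
      refine Submodule.eq_of_le_of_finrank_le (fun w hw => ?_) ?_
      · rw [LinearMap.mem_ker, Matrix.mulVecLin_apply] at hw ⊢
        rw [← Matrix.mulVec_mulVec, hw, Matrix.mulVec_zero]
      · have h3 := LinearMap.finrank_range_add_finrank_ker (M.map (eval y)).mulVecLin
        have h4 := LinearMap.finrank_range_add_finrank_ker (A' * M.map (eval y)).mulVecLin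
        change (M.map (eval y)).rank + _ = _ at h3
        change (A' * M.map (eval y)).rank + _ = _ at h4
        omega
    ext i j
    have h3 : (fun l => Φ.map (eval y) l j) ∈ LinearMap.ker (A' * M.map (eval y)).mulVecLin := by
      rw [LinearMap.mem_ker, Matrix.mulVecLin_apply]
      funext l
      exact congrFun (congrFun h1 l) j
    rw [← hker, LinearMap.mem_ker, Matrix.mulVecLin_apply] at h3
    exact congrFun h3 i

section RowComb

variable {A A' : Type*} [CommRing A] [CommRing A'] {r N : ℕ}

/-- The linear combination of the rows of `F` with coefficients `c`. -/
def rowComb (c : Fin r → A) (F : Fin r × Fin N → A) : Fin N → A := fun j => ∑ i, c i * F (i, j)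

/-- The square matrix of the columns in `J`. -/
def cols (J : Fin r → Fin N) (F : Fin r × Fin N → A) : Matrix (Fin r) (Fin r) A :=
  Matrix.of fun i l => F (i, J l)

/-- The coefficients of `t` with respect to the rows of `F`, computed from the entries in the
columns `J`, times the determinant. -/
def coeffs (J : Fin r → Fin N) (F : Fin r × Fin N → A) (t : Fin N → A) : Fin r → A :=
  fun i => ∑ l, t (J l) * (cols J F).adjugate l i

/-- The vector which vanishes if and only if `t` is a linear combination of the rows of `F`. -/
def defect (J : Fin r → Fin N) (F : Fin r × Fin N → A) (t : Fin N → A) : Fin N → A :=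
  fun j => (cols J F).det * t j - rowComb (coeffs J F t) F j

theorem rowComb_map (f : A →+* A') (c : Fin r → A) (F : Fin r × Fin N → A) (j : Fin N) :
    rowComb (fun i => f (c i)) (fun a => f (F a)) j = f (rowComb c F j) := by
  simp [rowComb]

theorem cols_map (f : A →+* A') (J : Fin r → Fin N) (F : Fin r × Fin N → A) :
    cols J (fun a => f (F a)) = (cols J F).map f := rfl

theorem det_cols_map (f : A →+* A') (J : Fin r → Fin N) (F : Fin r × Fin N → A) :
    (cols J (fun a => f (F a))).det = f (cols J F).det := by
  rw [cols_map, ← RingHom.mapMatrix_apply, ← RingHom.map_det]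

theorem coeffs_map (f : A →+* A') (J : Fin r → Fin N) (F : Fin r × Fin N → A) (t : Fin N → A)
    (i : Fin r) : coeffs J (fun a => f (F a)) (fun j => f (t j)) i = f (coeffs J F t i) := by
  have : (cols J (fun a => f (F a))).adjugate = (cols J F).adjugate.map f := by
    rw [cols_map, ← RingHom.mapMatrix_apply, ← RingHom.map_adjugate, RingHom.mapMatrix_apply]
  simp [coeffs, this]

theorem defect_map (f : A →+* A') (J : Fin r → Fin N) (F : Fin r × Fin N → A) (t : Fin N → A)
    (j : Fin N) : defect J (fun a => f (F a)) (fun j => f (t j)) j = f (defect J F t j) := by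
  rw [defect, defect, det_cols_map, map_sub, map_mul, ← rowComb_map]
  congr 2
  funext i
  exact coeffs_map f J F t i

theorem rowComb_add (c c' : Fin r → A) (F : Fin r × Fin N → A) :
    rowComb (c + c') F = rowComb c F + rowComb c' F := by
  funext j; simp [rowComb, add_mul, Finset.sum_add_distrib]

theorem rowComb_smul (a : A) (c : Fin r → A) (F : Fin r × Fin N → A) :
    rowComb (a • c) F = a • rowComb c F := by
  funext j; simp [rowComb, Finset.mul_sum, mul_assoc]

theorem rowComb_add_right (c : Fin r → A) (F F' : Fin r × Fin N → A) :
    rowComb c (F + F') = rowComb c F + rowComb c F' := by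
  funext j; simp [rowComb, mul_add, Finset.sum_add_distrib]

theorem rowComb_smul_right (a : A) (c : Fin r → A) (F : Fin r × Fin N → A) :
    rowComb c (a • F) = a • rowComb c F := by
  funext j; simp [rowComb, Finset.mul_sum, mul_left_comm]

theorem coeffs_add (J : Fin r → Fin N) (F : Fin r × Fin N → A) (t t' : Fin N → A) :
    coeffs J F (t + t') = coeffs J F t + coeffs J F t' := by
  funext i; simp [coeffs, add_mul, Finset.sum_add_distrib]

theorem coeffs_smul (J : Fin r → Fin N) (F : Fin r × Fin N → A) (a : A) (t : Fin N → A) :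
    coeffs J F (a • t) = a • coeffs J F t := by
  funext i; simp [coeffs, Finset.mul_sum, mul_assoc]

theorem defect_add (J : Fin r → Fin N) (F : Fin r × Fin N → A) (t t' : Fin N → A) :
    defect J F (t + t') = defect J F t + defect J F t' := by
  funext j; simp only [defect, coeffs_add, rowComb_add, Pi.add_apply]; ring

theorem defect_smul (J : Fin r → Fin N) (F : Fin r × Fin N → A) (a : A) (t : Fin N → A) :
    defect J F (a • t) = a • defect J F t := by
  funext j; simp only [defect, coeffs_smul, rowComb_smul, Pi.smul_apply, smul_eq_mul]; ring

theorem coeffs_rowComb (J : Fin r → Fin N) (F : Fin r × Fin N → A) (c : Fin r → A) :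
    coeffs J F (rowComb c F) = (cols J F).det • c := by
  have h1 : (fun l => rowComb c F (J l)) = Matrix.vecMul c (cols J F) := by
    funext l; simp [rowComb, Matrix.vecMul, dotProduct, cols]
  have h2 : coeffs J F (rowComb c F) =
      Matrix.vecMul (Matrix.vecMul c (cols J F)) (cols J F).adjugate := by
    rw [← h1]; funext i; simp [coeffs, Matrix.vecMul, dotProduct]
  rw [h2, Matrix.vecMul_vecMul, Matrix.mul_adjugate, Matrix.vecMul_smul, Matrix.vecMul_one]

theorem defect_rowComb (J : Fin r → Fin N) (F : Fin r × Fin N → A) (c : Fin r → A) :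
    defect J F (rowComb c F) = 0 := by
  funext j
  simp [defect, coeffs_rowComb, rowComb_smul]

theorem exists_rowComb_of_defect_eq_zero {J : Fin r → Fin N} {F : Fin r × Fin N → A}
    (hu : IsUnit (cols J F).det) {t : Fin N → A} (h : defect J F t = 0) :
    ∃ c, t = rowComb c F := by
  obtain ⟨u, hu⟩ := hu
  refine ⟨(↑u⁻¹ : A) • coeffs J F t, ?_⟩
  rw [rowComb_smul]
  funext j
  have h1 := congrFun h j
  rw [defect, Pi.zero_apply, sub_eq_zero, ← hu] at h1
  rw [Pi.smul_apply, smul_eq_mul, ← h1, Units.inv_mul_cancel_left]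

/-- If a family of vectors stays in a family of subspaces, the derivative of the vector is known
modulo the subspace. -/
theorem exists_of_defect_dual {J : Fin r → Fin N} {F F' : Fin r × Fin N → A}
    (hu : IsUnit (cols J F).det) {t t' : Fin N → A} (h : defect J (dual F F') (dual t t') = 0) :
    ∃ b b', t = rowComb b F ∧ t' = rowComb b F' + rowComb b' F := by
  have hu' : IsUnit (cols J (dual F F')).det := by
    refine Rows.isUnit_det_dual ?_
    convert! hu using 2
    ext i l
    simp [cols]
  obtain ⟨c, hc⟩ := exists_rowComb_of_defect_eq_zero hu' h
  refine ⟨fun i => (c i).fst, fun i => (c i).snd, ?_, ?_⟩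
  · funext j
    have := congrArg TrivSqZeroExt.fst (congrFun hc j)
    simpa [rowComb, TrivSqZeroExt.fst_sum] using this
  · funext j
    have := congrArg TrivSqZeroExt.snd (congrFun hc j)
    simpa [rowComb, TrivSqZeroExt.snd_sum, Finset.sum_add_distrib] using this

end RowComb

section Gr

variable {k : Type*} [Field k] {N r : ℕ} {L : Gr k N r} {F : Fin r × Fin (N + 1) → k}

theorem mem_iff_rowComb (hF : F ∈ coords L) {t : V k N} : t ∈ L.1 ↔ ∃ c, t = rowComb c F := by
  have h : Submodule.span k (Set.range fun i : Fin r => fun j => F (i, j)) = L.1 := hF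
  rw [← h, Submodule.mem_span_range_iff_exists_fun]
  refine exists_congr fun c => ?_
  rw [eq_comm, funext_iff, funext_iff]
  exact forall_congr' fun j => by simp [rowComb]

theorem rowComb_mem (hF : F ∈ coords L) (c : Fin r → k) : rowComb c F ∈ L.1 :=
  (mem_iff_rowComb hF).2 ⟨c, rfl⟩

theorem rowComb_injective (hF : F ∈ coords L) :
    Function.Injective fun c : Fin r → k => rowComb c F := by
  have h := linearIndependent_of_mem_coords_gr hF
  intro c c' hc
  have h2 := Fintype.linearIndependent_iff.1 h (c - c') (by
    funext j
    have h3 := congrFun hc j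
    simp only [rowComb] at h3
    simp [sub_mul, Finset.sum_sub_distrib, h3, Matrix.row, matOf])
  funext i
  exact sub_eq_zero.1 (h2 i)

theorem exists_cols (hF : F ∈ coords L) : ∃ J, IsUnit (cols J F).det := by
  obtain ⟨J, hJ⟩ := (grRows k N r).exists_chart L F hF
  refine ⟨J, ?_⟩
  rwa [show (grRows k N r).lbl = fun _ => 0 from rfl, blockOf_const] at hJ

theorem mem_iff_defect (hF : F ∈ coords L) {J : Fin r → Fin (N + 1)} (hJ : IsUnit (cols J F).det)
    {t : V k N} : t ∈ L.1 ↔ defect J F t = 0 := by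
  rw [mem_iff_rowComb hF]
  refine ⟨?_, exists_rowComb_of_defect_eq_zero hJ⟩
  rintro ⟨c, rfl⟩
  exact defect_rowComb _ _ _

theorem defect_eq_zero (hF : F ∈ coords L) (J : Fin r → Fin (N + 1)) {t : V k N} (ht : t ∈ L.1) :
    defect J F t = 0 := by
  obtain ⟨c, rfl⟩ := (mem_iff_rowComb hF).1 ht
  exact defect_rowComb _ _ _

end Gr

/-! ### Frames of tangent spaces -/

/-- A non-vanishing condition at one point holds at a general point. -/
theorem Rows.eventually_eval_ν_ne_zero {k P : Type*} {ι : Type} [Field k] [HomogCoords k P ι]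
    {R C : Type} [Fintype R] [DecidableEq R] (ρ : Rows P R C) {Z : Set P} (hZ : IsVariety Z)
    {J : R → C} {x₀ : P} (hx₀ : x₀ ∈ Z) (hJ : x₀ ∈ ρ.dom J) {p : MvPolynomial ι k}
    (hp : eval (ρ.ν J x₀) p ≠ 0) : ∀ᶠ x in generic Z, eval (ρ.ν J x) p ≠ 0 := by
  have key : ∀ x ∈ ρ.dom J, ∀ v ∈ coords x,
      eval v (ρ.hat J p) = eval v (ρ.detPoly J) ^ p.totalDegree * eval (ρ.ν J x) p := by
    intro x hx v hv
    have h := (mem_dom_iff hv).1 hx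
    have := ρ.aeval_hat J p h
    rw [← ρ.ν_eq hv] at this
    simpa [MvPolynomial.aeval_eq_eval, ← aeval_detPoly] using this
  have hd : ∀ x ∈ ρ.dom J, ∀ v ∈ coords x, eval v (ρ.detPoly J) ≠ 0 := by
    intro x hx v hv
    have h := (mem_dom_iff hv).1 hx
    rw [← MvPolynomial.aeval_eq_eval, aeval_detPoly]
    exact h.ne_zero
  filter_upwards [ρ.eventually_dom hZ ⟨x₀, hx₀, hJ⟩, eventually_mem_of_isOpen hZ
    (ρ.isOpen_exists (ρ.hat J p)) ⟨x₀, hx₀, _, ν_mem hJ, by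
      rw [key _ hJ _ (ν_mem hJ)]
      exact mul_ne_zero (pow_ne_zero _ (hd _ hJ _ (ν_mem hJ))) hp⟩] with x hx hx'
  obtain ⟨v, hv, hne⟩ := hx'
  rw [key _ hx.2 _ hv] at hne
  exact right_ne_zero_of_mul hne

section Generic

variable {k P : Type*} {ι : Type} [Field k] [HomogCoords k P ι] {Z Z' : Set P}

theorem zclosure_eq_of_eventually (hZ : IsVariety Z) (hsub : Z' ⊆ Z)
    (h : ∀ᶠ x in generic Z, x ∈ Z') : zclosure Z' = Z :=
  (closure_minimal hsub hZ.1).antisymm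
    (closed_of_eventually isClosed_closure (h.mono fun _ hx => subset_closure hx))

theorem isIrreducible_of_eventually (hZ : IsVariety Z) (hsub : Z' ⊆ Z)
    (h : ∀ᶠ x in generic Z, x ∈ Z') : IsIrreducible Z' := by
  have := zclosure_eq_of_eventually hZ hsub h
  rw [← isIrreducible_iff_closure]
  rw [zclosure] at this
  rw [this]; exact hZ.2

theorem vanishing_eq_of_eventually {R C : Type} [Fintype R] [DecidableEq R] (ρ : Rows P R C)
    (hZ : IsVariety Z) (hsub : Z' ⊆ Z)
    (h : ∀ᶠ x in generic Z, x ∈ Z') : vanishing Z' = vanishing Z := by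
  rw [← ρ.vanishing_zclosure, zclosure_eq_of_eventually hZ hsub h]

end Generic

/-- A matrix of polynomials has, near a point where its rank does not jump, a basis of the kernel
with polynomial entries. -/
theorem exists_kernelBasis {k σ m n : Type*} [Field k] [Fintype m] [Fintype n]
    (M : Matrix m n (MvPolynomial σ k)) (y₀ : σ → k) {d : ℕ}
    (hd : Module.finrank k (LinearMap.ker (M.map (eval y₀)).mulVecLin) = d) :
    ∃ (h : MvPolynomial σ k) (φ : Fin d → n → MvPolynomial σ k), eval y₀ h ≠ 0 ∧
      ∀ y : σ → k, eval y h ≠ 0 →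
        Module.finrank k (LinearMap.ker (M.map (eval y)).mulVecLin) = d →
        LinearIndependent k (fun i a => eval y (φ i a)) ∧
        Submodule.span k (Set.range fun i a => eval y (φ i a)) =
          LinearMap.ker (M.map (eval y)).mulVecLin := by
  classical
  obtain ⟨h, Φ, h0, h1, h2⟩ := exists_frame M y₀
  let b := (Module.finBasisOfFinrankEq k _ hd)
  let u : Fin d → n → k := fun i => (b i : n → k)
  have hu : LinearIndependent k u :=
    b.linearIndependent.map' (Submodule.subtype _) (Submodule.ker_subtype _)
  obtain ⟨J, hJ⟩ := exists_isUnit_det_submatrix (M := Matrix.of u) hu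
  -- apply the projection of `exists_frame` to a basis of the kernel at `y₀`
  let φ : Fin d → n → MvPolynomial σ k := fun i => Φ.mulVec fun a => C (u i a)
  have hφ : ∀ y i, (fun a => eval y (φ i a)) = (Φ.map (eval y)).mulVec (u i) := fun y i => by
    funext a
    simp [φ, Matrix.mulVec, dotProduct]
  -- the minor that witnesses the independence at `y₀` defines the neighbourhood
  let D : Matrix (Fin d) (Fin d) (MvPolynomial σ k) := Matrix.of fun i l => φ i (J l)
  have hD : ∀ y, eval y D.det = (Matrix.of fun i l => eval y (φ i (J l))).det := fun y => by
    rw [RingHom.map_det]; rfl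
  refine ⟨h * D.det, φ, ?_, fun y hy hr => ?_⟩
  · rw [map_mul]
    refine mul_ne_zero h0 ?_
    have : (Matrix.of fun i l => eval y₀ (φ i (J l))) =
        eval y₀ h • (Matrix.of u).submatrix id J := by
      ext i l
      have h3 := congrFun (h1 y₀ (u i) (LinearMap.mem_ker.1 (b i).2)) (J l)
      rw [← hφ] at h3
      simpa using h3
    rw [hD, this, Matrix.det_smul]
    exact mul_ne_zero (pow_ne_zero _ h0) hJ.ne_zero
  · rw [map_mul] at hy
    have hli : LinearIndependent k (fun i a => eval y (φ i a)) := by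
      have h3 : IsUnit (Matrix.of fun i l => eval y (φ i (J l))).det := by
        rw [← hD]; exact isUnit_iff_ne_zero.2 (right_ne_zero_of_mul hy)
      have h4 := Matrix.linearIndependent_rows_iff_isUnit.2
        ((Matrix.isUnit_iff_isUnit_det _).2 h3)
      exact LinearIndependent.of_comp (LinearMap.funLeft k k J) h4
    refine ⟨hli, Submodule.eq_of_le_of_finrank_eq ?_ ?_⟩
    · rw [Submodule.span_le]
      rintro _ ⟨i, rfl⟩
      have hrank : (M.map (eval y)).rank = (M.map (eval y₀)).rank := by
        have h3 := LinearMap.finrank_range_add_finrank_ker (M.map (eval y)).mulVecLin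
        have h4 := LinearMap.finrank_range_add_finrank_ker (M.map (eval y₀)).mulVecLin
        change (M.map (eval y)).rank + _ = _ at h3
        change (M.map (eval y₀)).rank + _ = _ at h4
        omega
      beta_reduce
      rw [SetLike.mem_coe, LinearMap.mem_ker, Matrix.mulVecLin_apply, hφ, Matrix.mulVec_mulVec,
        h2 y (left_ne_zero_of_mul hy) hrank, Matrix.zero_mulVec]
    · rw [finrank_span_eq_card hli, hr, Fintype.card_fin]

/-- Near a point of `Z` where the dimension of the tangent space does not jump, the tangent spaces
have a basis that depends polynomially on the point. -/
theorem exists_tangentFrame {k P : Type*} {ι : Type} [Field k] [HomogCoords k P ι] [Fintype ι]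
    (Z : Set P) (v₀ : ι → k) (hv₀ : IsPt Z v₀) {d : ℕ}
    (hd : Module.finrank k (coneTangent Z v₀) = d) :
    ∃ (h : MvPolynomial ι k) (φ : Fin d → ι → MvPolynomial ι k), eval v₀ h ≠ 0 ∧
      ∀ v, IsPt Z v → eval v h ≠ 0 → Module.finrank k (coneTangent Z v) = d →
        LinearIndependent k (fun i a => eval v (φ i a)) ∧
        Submodule.span k (Set.range fun i a => eval v (φ i a)) = coneTangent Z v := by
  classical
  obtain ⟨s, hs⟩ := (isNoetherianRing_iff_ideal_fg (MvPolynomial ι k)).1 inferInstance (vanishing Z)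
  let M : Matrix s ι (MvPolynomial ι k) := Matrix.of fun p i => pderiv i p.1
  have hM : ∀ v : ι → k, IsPt Z v → LinearMap.ker (M.map (eval v)).mulVecLin = coneTangent Z v := by
    intro v hv
    ext w
    rw [LinearMap.mem_ker, Matrix.mulVecLin_apply, ← tangentAt_eq_coneTangent,
      mem_tangentAt_iff_of_span hs hv, funext_iff, Subtype.forall]
    refine forall₂_congr fun p hp => ?_
    simp [M, Matrix.mulVec, dotProduct, MvPolynomial.aeval_eq_eval]
  obtain ⟨h, φ, h0, h1⟩ := exists_kernelBasis M v₀ (d := d) (by rw [hM _ hv₀, hd])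
  refine ⟨h, φ, h0, fun v hv hh hr => ?_⟩
  have := h1 v hh (by rw [hM _ hv, hr])
  rwa [hM _ hv] at this

/-! ### Polynomial families -/

/-- A polynomial family of points of `B` over an open subset of `Y`, in free parameters `s`. The
coordinates `coord` of the members of the family are the coordinates of the point of `Y`. A member
of the family is only required to be in `B` if it consists of coordinates of a point. -/
structure LocalFamily {k P Q : Type*} {ι κ : Type} [Field k] [HomogCoords k P ι]
    [HomogCoords k Q κ] (B : Set P) (Y : Set Q) (coord : κ → ι) where
  /-- The free parameters. -/
  τ : Type
  /-- The members of the family. -/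
  Θ : ι → MvPolynomial (τ ⊕ κ) k
  /-- The family lives over the points where `h` does not vanish. -/
  h : MvPolynomial κ k
  Θ_coord : ∀ a, Θ (coord a) = X (Sum.inr a)
  mem : ∀ y ∈ Y, ∀ u ∈ coords y, eval u h ≠ 0 → ∀ s b,
    (fun i => eval (Sum.elim s u) (Θ i)) ∈ coords b → b ∈ B

namespace LocalFamily

variable {k P Q : Type*} {ι κ : Type} [Field k] [HomogCoords k P ι] [HomogCoords k Q κ]
  {B : Set P} {Y : Set Q} {coord : κ → ι}

/-- The member of the family with parameters `s` over the point `u`. -/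
def pt (T : LocalFamily B Y coord) {A : Type*} [CommRing A] [Algebra k A] (s : T.τ → A)
    (u : κ → A) : ι → A := fun i => aeval (Sum.elim s u) (T.Θ i)

/-- The family contains all points of `B` over the open set where `h` does not vanish. -/
def Covers (T : LocalFamily B Y coord) : Prop :=
  ∀ b ∈ B, ∀ v ∈ coords b, eval (v ∘ coord) T.h ≠ 0 → ∃ s, T.pt s (v ∘ coord) = v

theorem pt_comp (T : LocalFamily B Y coord) {A : Type*} [CommRing A] [Algebra k A] (s : T.τ → A)
    (u : κ → A) : T.pt s u ∘ coord = u := by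
  funext a
  simp [pt, T.Θ_coord]

theorem pt_eq (T : LocalFamily B Y coord) (s : T.τ → k) (u : κ → k) :
    T.pt s u = fun i => eval (Sum.elim s u) (T.Θ i) := by
  funext i; rw [pt, MvPolynomial.aeval_eq_eval]

theorem dual_sumElim {τ κ A : Type*} [CommRing A] (s s' : τ → A) (u w : κ → A) :
    Sum.elim (dual s s') (dual u w) = dual (Sum.elim s u) (Sum.elim s' w) := by
  funext i
  rcases i with i | i <;> rfl

theorem fst_aeval_dual {σ A : Type*} [CommRing A] [Algebra k A] (v w : σ → A)
    (p : MvPolynomial σ k) : (aeval (dual v w) p).fst = aeval v p := by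
  change TrivSqZeroExt.fstHom k A A _ = _
  rw [MvPolynomial.comp_aeval_apply]
  exact congrArg (fun u => aeval u p) (_root_.funext fun i => by simp [dual])

theorem fst_pt_dual (T : LocalFamily B Y coord) (s s' : T.τ → k) (u w : κ → k) (i : ι) :
    (T.pt (dual s s') (dual u w) i).fst = T.pt s u i := by
  rw [pt, dual_sumElim, fst_aeval_dual, pt]

section Product

variable {R C : Type} [Fintype R] [DecidableEq R] (ρ : Rows P R C)

/-- Infinitesimal members of the family, i.e. members with values in the dual numbers, are points of
`B` with values in the dual numbers. -/
theorem isPt_pt_dual [Fintype κ] [Infinite k] (T : LocalFamily B Y coord) (ρ : Rows P R C)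
    {b : P} {s s' : T.τ → k}
    {u w : κ → k} (hb : T.pt s u ∈ coords b) (hu : eval u T.h ≠ 0) (hw : IsPt Y (dual u w)) :
    IsPt B (T.pt (dual s s') (dual u w)) := by
  obtain ⟨J, hJ⟩ := ρ.exists_chart b _ hb
  refine IsPt.of_param (Y := Y) T.Θ (rename Sum.inr T.h * bind₁ T.Θ (ρ.detPoly J)) ?_ hw _ ?_
  · intro y hy u hu s hs
    rw [map_mul, eval_rename, Sum.elim_comp_inr] at hs
    have h1 := right_ne_zero_of_mul hs
    simp only [eval, eval₂Hom_bind₁] at h1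
    change aeval (fun i => eval (Sum.elim s u) (T.Θ i)) (ρ.detPoly J) ≠ 0 at h1
    rw [Rows.aeval_detPoly] at h1
    obtain ⟨x, hx⟩ := ρ.exists_point J _ (isUnit_iff_ne_zero.2 h1)
    exact ⟨x, T.mem y hy u hu (left_ne_zero_of_mul hs) s x hx, hx⟩
  · rw [TrivSqZeroExt.isUnit_iff_isUnit_fst, dual_sumElim, fst_aeval_dual, map_mul,
      aeval_rename, Sum.elim_comp_inr, aeval_bind₁]
    refine IsUnit.mul (isUnit_iff_ne_zero.2 (by rwa [MvPolynomial.aeval_eq_eval])) ?_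
    change IsUnit (aeval (T.pt s u) (ρ.detPoly J))
    rw [Rows.aeval_detPoly]
    exact hJ

/-- Tangent vectors of `Y` lift to tangent vectors of `B`. -/
theorem exists_mem_coneTangent [Fintype ι] [Fintype κ] [Infinite k] (T : LocalFamily B Y coord)
    (ρ : Rows P R C) {b : P} {s : T.τ → k} {u w : κ → k} (hb : T.pt s u ∈ coords b)
    (hu : eval u T.h ≠ 0) (hu' : IsPt Y u) (hw : w ∈ coneTangent Y u) :
    ∃ w' ∈ coneTangent B (T.pt s u), w' ∘ coord = w := by
  have h1 := T.isPt_pt_dual ρ hb hu (isPt_dual.2 ⟨hu', by rwa [tangentAt_eq_coneTangent]⟩) (s' := 0)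
  rw [← dual_fst_snd (T.pt (dual s 0) (dual u w)), isPt_dual] at h1
  have h2 := h1.2
  simp only [fst_pt_dual] at h2
  change _ ∈ tangentAt B (T.pt s u) at h2
  rw [tangentAt_eq_coneTangent] at h2
  refine ⟨_, h2, ?_⟩
  funext a
  have := congrFun (T.pt_comp (dual s 0) (dual u w)) a
  simp only [Function.comp_apply] at this ⊢
  rw [this, snd_dual]

theorem eval_pt {T : LocalFamily B Y coord} (p : MvPolynomial ι k) (s : T.τ → k)
    (u : κ → k) : eval (T.pt s u) p = eval (Sum.elim s u) (bind₁ T.Θ p) := by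
  rw [pt_eq]
  simp only [eval, eval₂Hom_bind₁]

end Product

/-- If the points of `B` over open subsets of the irreducible set `Y` form polynomial families,
then `B` is irreducible. -/
theorem isPreirreducible {R D R' D' : Type} [Fintype R] [DecidableEq R] [Fintype R']
    [DecidableEq R'] [Infinite k] (ρ : Rows P R D) (ρ' : Rows Q R' D') (hY : IsIrreducible Y)
    (f : P → Q) (hf : ∀ b ∈ B, f b ∈ Y) (hc : ∀ b, ∀ v ∈ coords b, v ∘ coord ∈ coords (f b))
    (hlift : ∀ b, ∀ u ∈ coords (f b), ∃ v ∈ coords b, v ∘ coord = u)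
    (H : ∀ b ∈ B, ∀ v ∈ coords b, ∃ T : LocalFamily B Y coord,
      eval (v ∘ coord) T.h ≠ 0 ∧ T.Covers) : IsPreirreducible B := by
  rintro U₁ U₂ hU₁ hU₂ ⟨b₁, hb₁, hb₁'⟩ ⟨b₂, hb₂, hb₂'⟩
  -- an open set that meets `B` contains a member of `B` over a general point of `Y`
  have key : ∀ U : Set P, IsOpen U → ∀ b ∈ B, b ∈ U → ∃ (T : LocalFamily B Y coord)
      (q : MvPolynomial κ k), T.Covers ∧ (∃ u ∈ coords (f b), eval u q ≠ 0) ∧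
        ∀ y ∈ Y, ∀ u ∈ coords y, eval u q ≠ 0 → eval u T.h ≠ 0 ∧
          ∃ s, ∃ c ∈ B, c ∈ U ∧ T.pt s u ∈ coords c := by
    intro U hU b hb hbU
    obtain ⟨v, hv⟩ := coords_nonempty b
    obtain ⟨T, hT, hcov⟩ := H b hb v hv
    obtain ⟨s, hs⟩ := hcov b hb v hv hT
    obtain ⟨S, hS⟩ := isClosed_iff.1 hU.isClosed_compl
    have h1 : ∃ p ∈ S, eval v p ≠ 0 := by
      by_contra! hcon
      exact (hS b v hv).2 hcon hbU
    obtain ⟨p, hp, hp0⟩ := h1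
    obtain ⟨J, hJ⟩ := ρ.exists_chart b v hv
    let e : MvPolynomial (T.τ ⊕ κ) k →ₐ[k] MvPolynomial κ k :=
      aeval (Sum.elim (fun i => C (s i)) X)
    have he : ∀ u (p : MvPolynomial ι k), eval u (e (bind₁ T.Θ p)) = eval (T.pt s u) p := by
      intro u p
      rw [eval_pt, ← MvPolynomial.aeval_eq_eval, ← MvPolynomial.aeval_eq_eval,
        MvPolynomial.comp_aeval_apply]
      congr 2
      funext i
      rcases i with i | i <;> simp
    refine ⟨T, T.h * e (bind₁ T.Θ (p * ρ.detPoly J)), hcov, ⟨_, hc b v hv, ?_⟩, ?_⟩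
    · rw [map_mul, he, hs, map_mul, ← MvPolynomial.aeval_eq_eval (f := v), Rows.aeval_detPoly]
      rw [MvPolynomial.aeval_eq_eval]
      exact mul_ne_zero hT (mul_ne_zero hp0 hJ.ne_zero)
    · intro y hy u hu hq
      rw [map_mul, he, map_mul, ← MvPolynomial.aeval_eq_eval (f := T.pt s u),
        Rows.aeval_detPoly] at hq
      have h2 := right_ne_zero_of_mul hq
      obtain ⟨c, hc⟩ := ρ.exists_point J _ (isUnit_iff_ne_zero.2 (right_ne_zero_of_mul h2))
      refine ⟨left_ne_zero_of_mul hq, s, c, ?_, ?_, hc⟩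
      · exact T.mem y hy u hu (left_ne_zero_of_mul hq) s c (by rw [← pt_eq]; exact hc)
      · by_contra hcU
        have h3 := (hS c _ hc).1 hcU p hp
        rw [MvPolynomial.aeval_eq_eval] at h2
        exact left_ne_zero_of_mul h2 h3
  -- by irreducibility of `Y`, both open sets contain members of `B` over the same `y`; the first
  -- family contains both members, since it covers `B` over `y`
  obtain ⟨T₁, q₁, hcov₁, ⟨u₁, hu₁, hq₁⟩, H₁⟩ := key U₁ hU₁ b₁ hb₁ hb₁'
  obtain ⟨T₂, q₂, -, ⟨u₂, hu₂, hq₂⟩, H₂⟩ := key U₂ hU₂ b₂ hb₂ hb₂'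
  obtain ⟨y, hy, ⟨u, hu, hqu⟩, ⟨u', hu', hqu'⟩⟩ := hY.2 _ _ (ρ'.isOpen_exists q₁)
    (ρ'.isOpen_exists q₂) ⟨_, hf b₁ hb₁, u₁, hu₁, hq₁⟩ ⟨_, hf b₂ hb₂, u₂, hu₂, hq₂⟩
  obtain ⟨hT, s₁, c₁, hc₁, hc₁U, hs₁⟩ := H₁ y hy u hu hqu
  obtain ⟨-, s₂, c₂, hc₂, hc₂U, hs₂⟩ := H₂ y hy u' hu' hqu'
  have hfc : ∀ y' : Q, u' ∈ coords y' → coords y' = coords y := by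
    intro y' hy'
    ext w
    rw [ρ'.coords_iff y' u' w hy', ρ'.coords_iff y u' w hu']
  have h3 : u ∈ coords (f c₂) := by
    have := hc c₂ _ hs₂
    rw [pt_comp] at this
    rw [hfc _ this]
    exact hu
  obtain ⟨v, hv, hvu⟩ := hlift c₂ u h3
  obtain ⟨s, hs⟩ := hcov₁ c₂ hc₂ v hv (by rwa [hvu])
  rw [hvu] at hs
  -- the points of `B` over `y` form an open subset of an affine space
  have key2 : ∀ U : Set P, IsOpen U → ∀ c ∈ U, ∀ s, T₁.pt s u ∈ coords c →
      ∃ p : MvPolynomial ι k, eval (T₁.pt s u) p ≠ 0 ∧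
        ∀ s' c', T₁.pt s' u ∈ coords c' → eval (T₁.pt s' u) p ≠ 0 → c' ∈ U := by
    intro U hU c hcU s hs
    obtain ⟨S, hS⟩ := isClosed_iff.1 hU.isClosed_compl
    have h1 : ∃ p ∈ S, eval (T₁.pt s u) p ≠ 0 := by
      by_contra! hcon
      exact (hS c _ hs).2 hcon hcU
    obtain ⟨p, hp, hp0⟩ := h1
    refine ⟨p, hp0, fun s' c' hc' hne => ?_⟩
    by_contra hcU
    exact hne ((hS c' _ hc').1 hcU p hp)
  obtain ⟨p₁, hp₁, H₁⟩ := key2 U₁ hU₁ c₁ hc₁U s₁ hs₁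
  obtain ⟨p₂, hp₂, H₂⟩ := key2 U₂ hU₂ c₂ hc₂U s (by rw [hs]; exact hv)
  obtain ⟨J, hJ⟩ := ρ.exists_chart c₁ _ hs₁
  let e : MvPolynomial (T₁.τ ⊕ κ) k →ₐ[k] MvPolynomial T₁.τ k :=
    aeval (Sum.elim X (fun i => C (u i)))
  have he : ∀ s (p : MvPolynomial ι k), eval s (e (bind₁ T₁.Θ p)) = eval (T₁.pt s u) p := by
    intro s p
    rw [eval_pt, ← MvPolynomial.aeval_eq_eval, ← MvPolynomial.aeval_eq_eval,
      MvPolynomial.comp_aeval_apply]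
    congr 2
    funext i
    rcases i with i | i <;> simp
  have hdet : ∀ s, eval (T₁.pt s u) (ρ.detPoly J) = (ρ.N J (T₁.pt s u)).det := fun s => by
    rw [← MvPolynomial.aeval_eq_eval, Rows.aeval_detPoly]
  -- the parameters of the members in `U₁` and `U₂` are non-empty open subsets of an affine space
  -- over the infinite field `k`
  have hne : e (bind₁ T₁.Θ p₁) * e (bind₁ T₁.Θ p₂) * e (bind₁ T₁.Θ (ρ.detPoly J)) ≠ 0 := by
    refine mul_ne_zero (mul_ne_zero ?_ ?_) ?_ <;> intro h0
    · exact hp₁ (by rw [← he, h0, map_zero])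
    · exact hp₂ (by rw [← he, h0, map_zero])
    · exact hJ.ne_zero (by rw [← Rows.N, ← hdet, ← he, h0, map_zero])
  obtain ⟨s', hs'⟩ : ∃ s', eval s'
      (e (bind₁ T₁.Θ p₁) * e (bind₁ T₁.Θ p₂) * e (bind₁ T₁.Θ (ρ.detPoly J))) ≠ 0 := by
    by_contra! hcon
    exact hne (MvPolynomial.funext fun s => by rw [hcon, map_zero])
  rw [map_mul, map_mul, he, he, he, hdet] at hs'
  obtain ⟨c, hc'⟩ := ρ.exists_point J _ (isUnit_iff_ne_zero.2 (right_ne_zero_of_mul hs'))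
  have h4 := left_ne_zero_of_mul hs'
  exact ⟨c, T₁.mem y hy u hu hT s' c (by rw [← pt_eq]; exact hc'),
    H₁ s' c hc' (left_ne_zero_of_mul h4), H₂ s' c hc' (right_ne_zero_of_mul h4)⟩

end LocalFamily

/-! ### Tangent spaces of subvarieties of Grassmannians -/

section GrTangent

variable {k : Type*} [Field k] {N r : ℕ} {L : Gr k N r} {F : Fin r × Fin (N + 1) → k}

/-- The basis of `L` given by a coordinate vector. -/
def basisOf (hF : F ∈ coords L) : Module.Basis (Fin r) k L.1 :=
  (Module.Basis.span (linearIndependent_of_mem_coords_gr hF)).map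
    (LinearEquiv.ofEq _ _ (mem_coords_gr.1 hF))

theorem basisOf_apply (hF : F ∈ coords L) (i : Fin r) (j : Fin (N + 1)) :
    (basisOf hF i : V k N) j = F (i, j) := by
  rw [basisOf, Module.Basis.map_apply, LinearEquiv.coe_ofEq_apply, Module.Basis.span_apply]
  rfl

theorem mem_coords_of_basis (b : Module.Basis (Fin r) k L.1) :
    (fun ij : Fin r × Fin (N + 1) => (b ij.1 : V k N) ij.2) ∈ coords L := by
  have h : Submodule.map L.1.subtype (Submodule.span k (Set.range b)) =
      Submodule.map L.1.subtype ⊤ := congrArg _ b.span_eq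
  rw [Submodule.map_span, Submodule.map_top, Submodule.range_subtype, ← Set.range_comp] at h
  exact h

theorem rowComb_eq_sum (c : Fin r → k) (F : Fin r × Fin (N + 1) → k) :
    rowComb c F = ∑ i, c i • fun j => F (i, j) := by
  funext j; simp [rowComb]

theorem sum_basisOf (hF : F ∈ coords L) (c : Fin r → k) :
    ((∑ i, c i • basisOf hF i : L.1) : V k N) = rowComb c F := by
  rw [rowComb_eq_sum, Submodule.coe_sum]
  refine Finset.sum_congr rfl fun i _ => ?_
  funext j
  simp [basisOf_apply]

theorem actOn_grRows {B : Matrix (Fin r) (Fin r) k} (i : Fin r) (j : Fin (N + 1)) :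
    (grRows k N r).act B F (i, j) = rowComb (B i) F j := by
  simp [Rows.act, actOn_apply, grRows, rowComb]

/-- The linear map `L → V / L` defined by moving the rows of the coordinate vector `F` with
velocity `F'`. -/
def velocity (hF : F ∈ coords L) :
    (Fin r × Fin (N + 1) → k) →ₗ[k] L.1 →ₗ[k] V k N ⧸ L.1 where
  toFun F' := L.1.mkQ ∘ₗ (basisOf hF).constr k fun i j => F' (i, j)
  map_add' F' F'' := by
    refine (basisOf hF).ext fun i => ?_
    simp only [LinearMap.comp_apply, LinearMap.add_apply, Module.Basis.constr_basis, ← map_add]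
    rfl
  map_smul' c F' := by
    refine (basisOf hF).ext fun i => ?_
    simp only [LinearMap.comp_apply, LinearMap.smul_apply, Module.Basis.constr_basis,
      RingHom.id_apply, ← map_smul]
    rfl

theorem velocity_apply (hF : F ∈ coords L) (F' : Fin r × Fin (N + 1) → k) (c : Fin r → k) :
    velocity hF F' (∑ i, c i • basisOf hF i) = L.1.mkQ (rowComb c F') := by
  simp only [velocity, LinearMap.coe_mk, AddHom.coe_mk, LinearMap.comp_apply, map_sum, map_smul,
    Module.Basis.constr_basis, rowComb_eq_sum]

/-- The tangent space of `Y` in `Hom(L, V / L)` is the image of the tangent space of the cone of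
coordinate matrices. -/
theorem grTangent_eq_map [Infinite k] {Y : Set (Gr k N r)} (hL : L ∈ Y) (hF : F ∈ coords L) :
    grTangent Y L = (coneTangent Y F).map (velocity hF) := by
  have hb : (fun ij : Fin r × Fin (N + 1) => (basisOf hF ij.1 : V k N) ij.2) = F := by
    funext ij; exact basisOf_apply hF _ _
  ext t
  constructor
  · rintro ⟨A, rfl, hA⟩
    refine ⟨fun ij => A (basisOf hF ij.1) ij.2, ?_, ?_⟩
    · have := hA (basisOf hF)
      rwa [hb] at this
    · refine (basisOf hF).ext fun i => ?_
      simp only [velocity, LinearMap.coe_mk, AddHom.coe_mk, LinearMap.comp_apply,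
        Module.Basis.constr_basis]
  · rintro ⟨F', hF', rfl⟩
    refine ⟨(basisOf hF).constr k fun i j => F' (i, j), rfl, fun b => ?_⟩
    obtain ⟨B, hB, hu, hBF⟩ := (grRows k N r).exists_act hF (mem_coords_of_basis b)
    have h1 := (grRows k N r).act_mem_tangentAt hB hu (isPt_of_mem hL hF)
      (by rw [tangentAt_eq_coneTangent]; exact hF')
    rw [tangentAt_eq_coneTangent, ← hBF] at h1
    convert! h1 using 1
    funext ⟨i, j⟩
    rw [actOn_grRows]
    have h2 : b i = ∑ l, B i l • basisOf hF l := by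
      apply Subtype.ext
      rw [sum_basisOf]
      funext j
      rw [← actOn_grRows, ← hBF]
    simp only [h2, map_sum, map_smul, Module.Basis.constr_basis]
    simp [rowComb]

theorem velocity_eq_zero_iff (hF : F ∈ coords L) {F' : Fin r × Fin (N + 1) → k} :
    velocity hF F' = 0 ↔ ∃ B, F' = (grRows k N r).act B F := by
  have h1 : velocity hF F' = 0 ↔ ∀ i, (fun j => F' (i, j)) ∈ L.1 := by
    have h0 : velocity hF F' = 0 ↔ ∀ i, velocity hF F' (basisOf hF i) = 0 :=
      ⟨fun h i => by rw [h]; rfl, fun h => (basisOf hF).ext h⟩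
    rw [h0]
    refine forall_congr' fun i => ?_
    simp only [velocity, LinearMap.coe_mk, AddHom.coe_mk, LinearMap.comp_apply,
      Module.Basis.constr_basis, Submodule.mkQ_apply, Submodule.Quotient.mk_eq_zero]
  rw [h1]
  constructor
  · intro h
    choose B hB using fun i => (mem_iff_rowComb hF).1 (h i)
    refine ⟨Matrix.of B, ?_⟩
    funext ⟨i, j⟩
    rw [actOn_grRows]
    exact congrFun (hB i) j
  · rintro ⟨B, rfl⟩ i
    have : (fun j => (grRows k N r).act B F (i, j)) = rowComb (B i) F := by
      funext j; rw [actOn_grRows]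
    rw [this]
    exact rowComb_mem hF _

/-- The tangent space of the cone has `r * r` dimensions more than that of `Y`, which come from the
choice of the basis of `L`. -/
theorem finrank_coneTangent_eq [Infinite k] {Y : Set (Gr k N r)} (hL : L ∈ Y) (hF : F ∈ coords L) :
    Module.finrank k (coneTangent Y F) = Module.finrank k (grTangent Y L) + r * r := by
  have h := LinearMap.finrank_range_add_finrank_ker ((velocity hF).domRestrict (coneTangent Y F))
  rw [LinearMap.range_domRestrict, ← grTangent_eq_map hL hF] at h
  rw [← h, Nat.add_left_cancel_iff]
  let ρ := grRows k N r
  let g : Matrix (Fin r) (Fin r) k →ₗ[k] (Fin r × Fin (N + 1) → k) :=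
    { toFun := fun B => ρ.act B F
      map_add' := fun B B' => actOn_add _ _ _ _
      map_smul' := fun c B => actOn_smul _ _ _ _ }
  have hg : Function.Injective g := by
    intro B B' hBB
    funext i
    refine rowComb_injective hF ?_
    funext j
    simp only [← actOn_grRows]
    exact congrFun hBB (i, j)
  have h2 : (LinearMap.ker ((velocity hF).domRestrict (coneTangent Y F))).map
      (coneTangent Y F).subtype = LinearMap.range g := by
    ext F'
    constructor
    · rintro ⟨⟨F', hF'⟩, h0, rfl⟩
      obtain ⟨B, hB⟩ := (velocity_eq_zero_iff hF).1 (LinearMap.mem_ker.1 h0)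
      exact ⟨B, hB.symm⟩
    · rintro ⟨B, rfl⟩
      have h3 := ρ.act_mem_tangentAt_self (B := B) (fun _ _ h => (h rfl).elim) (isPt_of_mem hL hF)
      rw [tangentAt_eq_coneTangent] at h3
      exact ⟨⟨_, h3⟩, LinearMap.mem_ker.2 ((velocity_eq_zero_iff hF).2 ⟨B, rfl⟩), rfl⟩
  rw [← Submodule.finrank_map_subtype_eq, h2, LinearMap.finrank_range_of_inj hg,
    Module.finrank_matrix]
  simp

/-- In coordinates, the kernel of `Φ` consists of the combinations of the rows of `F` which stay in
`L` to first order when `F` moves in `Y`. -/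
theorem mem_kerPhi_iff [Infinite k] {Y : Set (Gr k N r)} (hL : L ∈ Y) (hF : F ∈ coords L)
    (c : Fin r → k) :
    rowComb c F ∈ kerPhi Y L ↔ ∀ F' ∈ coneTangent Y F, rowComb c F' ∈ L.1 := by
  have h1 : rowComb c F ∈ kerPhi Y L ↔ ∀ t ∈ grTangent Y L, t (∑ i, c i • basisOf hF i) = 0 := by
    constructor
    · rintro ⟨w, hw, hwc⟩ t ht
      have h2 : w = ∑ i, c i • basisOf hF i := by
        apply Subtype.ext
        rw [sum_basisOf]; exact hwc
      rw [← h2]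
      exact LinearMap.congr_fun (LinearMap.mem_ker.1 hw) ⟨t, ht⟩
    · intro h
      refine ⟨∑ i, c i • basisOf hF i, LinearMap.mem_ker.2 (LinearMap.ext fun t => h t.1 t.2), ?_⟩
      exact sum_basisOf hF c
  rw [h1, grTangent_eq_map hL hF]
  constructor
  · intro h F' hF'
    have := h _ ⟨F', hF', rfl⟩
    rw [velocity_apply] at this
    simpa using this
  · rintro h _ ⟨F', hF', rfl⟩
    rw [velocity_apply]
    simpa using h F' hF'

theorem kerPhi_le (Y : Set (Gr k N r)) (L : Gr k N r) : kerPhi Y L ≤ L.1 := by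
  rintro _ ⟨w, -, rfl⟩
  exact w.2

theorem card_entries_gr : Nat.card ((grRows k N r).Entries ∅) = r * r := by
  have h : ∀ ij : Fin r × Fin r, (grRows k N r).lbl ij.1 =
    (grRows k N r).lbl ij.2 := fun _ => rfl
  rw [Rows.card_entries_eq, Nat.card_congr (Equiv.subtypeUnivEquiv h)]
  simp

theorem card_entries_pn : Nat.card ((pnRows k N).Entries ∅) = 1 := by
  have h : ∀ ij : Unit × Unit, (pnRows k N).lbl ij.1 = (pnRows k N).lbl ij.2 := fun _ => rfl
  rw [Rows.card_entries_eq, Nat.card_congr (Equiv.subtypeUnivEquiv h)]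
  simp

variable [IsAlgClosed k] {Y : Set (Gr k N r)}

theorem mem_grSmoothLocus_iff (hY : IsVariety Y) {L : Gr k N r} {F} (hF : F ∈ coords L) :
    L ∈ grSmoothLocus Y ↔ L ∈ Y ∧ Module.finrank k (coneTangent Y F) = Rows.dimN hY + r * r := by
  have := IsAlgClosed.instInfinite (K := k)
  refine and_congr_right fun hL => ?_
  rw [(grRows k N r).zdim_eq hY, finrank_coneTangent_eq hL hF]
  rw [Nat.add_right_cancel_iff]
  exact_mod_cast Iff.rfl

theorem eventually_mem_grSmoothLocus (hY : IsVariety Y) :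
    ∀ᶠ L in generic Y, L ∈ grSmoothLocus Y := by
  filter_upwards [(grRows k N r).eventually_finrank_coneTangent hY,
    eventually_mem Y] with L hL hLY
  obtain ⟨F, hF⟩ := coords_nonempty L
  rw [mem_grSmoothLocus_iff hY hF]
  refine ⟨hLY, ?_⟩
  rw [hL F hF, card_entries_gr]

end GrTangent

/-! ### The pull-back along the shrinking map -/

section Coords

variable {k : Type*} [Field k] {N r : ℕ}

theorem submodule_le_iff {x : PN k N} {v : V k N} (hv : v ∈ coords x) (K : Submodule k (V k N)) :
    x.submodule ≤ K ↔ v ∈ K := by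
  obtain ⟨h0, rfl⟩ := hv
  rw [Projectivization.submodule_mk, Submodule.span_singleton_le_iff_mem]

theorem gr_eq_of_mem_coords {L L' : Gr k N r} {F : Fin r × Fin (N + 1) → k} (hF : F ∈ coords L)
    (hF' : F ∈ coords L') : L = L' := Subtype.ext (hF.symm.trans hF')

theorem pn_eq_of_mem_coords {x y : PN k N} {v : V k N} (hx : v ∈ coords x)
    (hy : v ∈ coords y) : x = y := by
  obtain ⟨_, rfl⟩ := hx
  obtain ⟨_, rfl⟩ := hy
  rfl

theorem coneTangent_congr {P : Type*} {ι : Type} [HomogCoords k P ι] [Fintype ι] {Z Z' : Set P}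
    (h : vanishing Z = vanishing Z') (v : ι → k) : coneTangent Z v = coneTangent Z' v := by
  ext w
  simp only [coneTangent, h]

/-- The rows of `F` as a linear map. -/
def rowCombL (F : Fin r × Fin (N + 1) → k) : (Fin r → k) →ₗ[k] V k N where
  toFun c := rowComb c F
  map_add' _ _ := rowComb_add _ _ _
  map_smul' _ _ := rowComb_smul _ _ _

end Coords

section Shrink

variable {k : Type*} [Field k] [IsAlgClosed k] {N r : ℕ} {Y : Set (Gr k N r)}

/-- Near a smooth point of `Y`, the kernel of `Φ` is the kernel of a matrix of polynomials. -/
theorem exists_kerMatrix (hY : IsVariety Y) {L₀ : Gr k N r} (hL₀ : L₀ ∈ grSmoothLocus Y)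
    {F₀ : Fin r × Fin (N + 1) → k} (hF₀ : F₀ ∈ coords L₀) :
    ∃ (h : MvPolynomial (Fin r × Fin (N + 1)) k) (J : Fin r → Fin (N + 1)) (d : ℕ)
      (M : Matrix (Fin d × Fin (N + 1)) (Fin r) (MvPolynomial (Fin r × Fin (N + 1)) k)),
      eval F₀ h ≠ 0 ∧ (∀ F, eval F h ≠ 0 → IsUnit (cols J F).det) ∧
      ∀ L ∈ grSmoothLocus Y, ∀ F ∈ coords L, eval F h ≠ 0 → ∀ c,
        (M.map (eval F)).mulVec c = 0 ↔ rowComb c F ∈ kerPhi Y L := by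
  have := IsAlgClosed.instInfinite (K := k)
  obtain ⟨J, hJ⟩ := exists_cols hF₀
  have hd := ((mem_grSmoothLocus_iff hY hF₀).1 hL₀).2
  obtain ⟨h, φ, h0, hφ⟩ := exists_tangentFrame Y F₀ (isPt_of_mem hL₀.1 hF₀) hd
  have hdet : ∀ F : Fin r × Fin (N + 1) → k,
      eval F (cols J (X : Fin r × Fin (N + 1) → MvPolynomial _ k)).det = (cols J F).det := by
    intro F
    rw [← det_cols_map]
    simp
  -- the entry of `M` for a tangent vector `φ e` of the frame and a row `i` of `F` is the class
  -- modulo `L` of the velocity of the row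
  refine ⟨h * (cols J X).det, J, _, Matrix.of fun ej i => defect J X (fun j => φ ej.1 (i, j)) ej.2,
    ?_, fun F hF => ?_, fun L hL F hF hne c => ?_⟩
  · rw [map_mul, hdet]
    exact mul_ne_zero h0 hJ.ne_zero
  · rw [map_mul, hdet] at hF
    exact isUnit_iff_ne_zero.2 (right_ne_zero_of_mul hF)
  · rw [map_mul, hdet] at hne
    have hJF : IsUnit (cols J F).det := isUnit_iff_ne_zero.2 (right_ne_zero_of_mul hne)
    obtain ⟨-, hspan⟩ := hφ F (isPt_of_mem hL.1 hF) (left_ne_zero_of_mul hne)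
      ((mem_grSmoothLocus_iff hY hF).1 hL).2
    have h1 : ∀ e j, ((Matrix.of fun (ej : _ × Fin (N + 1)) (i : Fin r) =>
        defect J X (fun j => φ ej.1 (i, j)) ej.2).map (eval F)).mulVec c (e, j) =
        defect J F (rowComb c fun a => eval F (φ e a)) j := by
      intro e j
      have h2 : ∀ i, eval F (defect J X (fun j => φ e (i, j)) j) =
          defect J F (fun j => eval F (φ e (i, j))) j := by
        intro i
        rw [← defect_map (eval F) J]
        simp
      have h3 : rowComb c (fun a => eval F (φ e a)) = ∑ i, c i • fun j => eval F (φ e (i, j)) :=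
        rowComb_eq_sum _ _
      let D : (Fin (N + 1) → k) →ₗ[k] (Fin (N + 1) → k) :=
        { toFun := defect J F, map_add' := defect_add J F, map_smul' := defect_smul J F }
      have h4 : defect J F (rowComb c fun a => eval F (φ e a)) =
          ∑ i, c i • defect J F fun j => eval F (φ e (i, j)) := by
        rw [h3]
        exact (map_sum D _ _).trans (Finset.sum_congr rfl fun i _ => map_smul D _ _)
      rw [h4]
      simp only [Matrix.mulVec, dotProduct, Matrix.map_apply, Matrix.of_apply, h2,
        Finset.sum_apply, Pi.smul_apply, smul_eq_mul]
      exact Finset.sum_congr rfl fun i _ => mul_comm _ _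
    rw [mem_kerPhi_iff hL.1 hF]
    have h5 : (∀ F' ∈ coneTangent Y F, rowComb c F' ∈ L.1) ↔
        ∀ e, rowComb c (fun a => eval F (φ e a)) ∈ L.1 := by
      rw [← hspan]
      constructor
      · intro h e
        exact h _ (Submodule.subset_span ⟨e, rfl⟩)
      · intro h F' hF'
        induction hF' using Submodule.span_induction with
        | mem F' hF' => obtain ⟨e, rfl⟩ := hF'; exact h e
        | zero =>
          have : rowComb c (0 : Fin r × Fin (N + 1) → k) = 0 := by funext j; simp [rowComb]
          rw [this]; exact Submodule.zero_mem _
        | add F' F'' _ _ h1 h2 => rw [rowComb_add_right]; exact Submodule.add_mem _ h1 h2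
        | smul a F' _ h1 => rw [rowComb_smul_right]; exact Submodule.smul_mem _ _ h1
    rw [h5, funext_iff, Prod.forall]
    refine forall_congr' fun e => ?_
    rw [mem_iff_defect hF hJF, funext_iff]
    refine forall_congr' fun j => ?_
    rw [h1]; rfl

theorem finrank_ker_eq {m : Type*} [Fintype m] {L : Gr k N r} {F : Fin r × Fin (N + 1) → k}
    (hF : F ∈ coords L) (M : Matrix m (Fin r) k)
    (h : ∀ c, M.mulVec c = 0 ↔ rowComb c F ∈ kerPhi Y L) :
    Module.finrank k (LinearMap.ker M.mulVecLin) = Module.finrank k (kerPhi Y L) := by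
  have h1 : (LinearMap.ker M.mulVecLin).map (rowCombL F) = kerPhi Y L := by
    ext w
    constructor
    · rintro ⟨c, hc, rfl⟩
      exact (h c).1 hc
    · intro hw
      obtain ⟨c, rfl⟩ := (mem_iff_rowComb hF).1 (kerPhi_le _ _ hw)
      exact ⟨c, (h c).2 hw, rfl⟩
  rw [← h1]
  exact LinearEquiv.finrank_eq (Submodule.equivMapOfInjective _ (rowComb_injective hF) _)

/-- The dimension of the kernel of `Φ` is constant on a dense open subset of `Y`. -/
theorem exists_eventually_finrank_kerPhi (hY : IsVariety Y) :
    ∃ d, ∀ᶠ L in generic Y, Module.finrank k (kerPhi Y L) = d := by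
  let ρ := grRows k N r
  have hne := generic_neBot hY.2.1
  obtain ⟨L₀, hL₀⟩ := (eventually_mem_grSmoothLocus hY).exists
  obtain ⟨I, hI⟩ := ρ.exists_mem_dom L₀
  obtain ⟨h, J, d, M, h0, hJ, hM⟩ := exists_kerMatrix hY hL₀ (Rows.ν_mem hI)
  have hI' : (Y ∩ ρ.dom I).Nonempty := ⟨L₀, hL₀.1, hI⟩
  refine ⟨r - (M.map (aeval (R := k) (ρ.gen hY hI'))).rank, ?_⟩
  filter_upwards [eventually_mem_grSmoothLocus hY, ρ.eventually_eval_ν_ne_zero hY hL₀.1 hI h0,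
    ρ.eventually_rank_eq hY hI' M, ρ.eventually_dom hY hI'] with L hL hne hrank hdom
  have h1 := finrank_ker_eq (Rows.ν_mem hdom.2) (M.map (eval (ρ.ν I L)))
    (hM L hL _ (Rows.ν_mem hdom.2) hne)
  have h2 := LinearMap.finrank_range_add_finrank_ker (M.map (eval (ρ.ν I L))).mulVecLin
  change (M.map (eval (ρ.ν I L))).rank + _ = _ at h2
  rw [h1, hrank, Module.finrank_fintype_fun_eq_card, Fintype.card_fin] at h2
  omega

theorem eventually_mem_shrinkDomain (hY : IsVariety Y) :
    ∀ᶠ L in generic Y, L ∈ shrinkDomain Y := by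
  have h : ∀ᶠ L in generic Y, Module.finrank k (kerPhi Y L) = shrinkRank Y :=
    Nat.sInf_mem (s := {d | ∀ᶠ L in generic Y, Module.finrank k (kerPhi Y L) = d})
      (exists_eventually_finrank_kerPhi hY)
  filter_upwards [h, eventually_mem_grSmoothLocus hY] with L h1 h2
  exact ⟨h2, h1⟩

theorem shrinkDomain_subset : shrinkDomain Y ⊆ Y := fun _ h => h.1.1

/-- The pull-back of the universal family to the domain of the shrinking map. -/
def shrinkFamily (Y : Set (Gr k N r)) : Set (Gr k N r × PN k N) :=
  {z | z.1 ∈ shrinkDomain Y ∧ z.2.submodule ≤ kerPhi Y z.1}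

theorem shrinkPullback_eq : shrinkPullback Y = zclosure (shrinkFamily Y) := by
  rw [shrinkPullback]
  congr 1
  ext z
  exact ⟨fun ⟨h, h'⟩ => ⟨h, h'⟩, fun ⟨h, h'⟩ => ⟨h, h'⟩⟩

/-- Near a point of the domain of the shrinking map, the pull-back of the universal family is
parametrized by a basis of the kernel of `Φ` with polynomial entries. -/
theorem exists_localFamily_shrinkFamily (hY : IsVariety Y) {L₀ : Gr k N r}
    (hL₀ : L₀ ∈ shrinkDomain Y) {F₀ : Fin r × Fin (N + 1) → k} (hF₀ : F₀ ∈ coords L₀) :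
    ∃ T : LocalFamily (shrinkFamily Y) (shrinkDomain Y) Sum.inl, eval F₀ T.h ≠ 0 ∧ T.Covers := by
  obtain ⟨h, J, d, M, h0, hJ, hM⟩ := exists_kerMatrix hY hL₀.1 hF₀
  have hker : ∀ L ∈ shrinkDomain Y, ∀ F ∈ coords L, eval F h ≠ 0 →
      Module.finrank k (LinearMap.ker (M.map (eval F)).mulVecLin) = shrinkRank Y :=
    fun L hL F hF hne => (finrank_ker_eq hF _ (hM L hL.1 F hF hne)).trans hL.2
  obtain ⟨h', ψ, h0', hψ⟩ := exists_kernelBasis M F₀ (hker L₀ hL₀ F₀ hF₀ h0)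
  -- the coordinates `F` of `L`, and the combination, with free coefficients, of the basis of the
  -- kernel
  let Θ : (Fin r × Fin (N + 1)) ⊕ Fin (N + 1) →
      MvPolynomial (Fin (shrinkRank Y) ⊕ (Fin r × Fin (N + 1))) k :=
    Sum.elim (fun a => X (Sum.inr a))
      (fun j => ∑ l, X (Sum.inl l) * rename Sum.inr (rowComb (ψ l) X j))
  have hΘ : ∀ (s : Fin (shrinkRank Y) → k) (F : Fin r × Fin (N + 1) → k),
      (fun i => eval (Sum.elim s F) (Θ i)) =
        Sum.elim F (rowComb (∑ l, s l • fun i => eval F (ψ l i)) F) := by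
    intro s F
    have h1 : ∀ l j, eval F (rowComb (ψ l) X j) = rowComb (fun i => eval F (ψ l i)) F j := by
      intro l j
      rw [← rowComb_map]
      simp
    have h2 : rowComb (∑ l, s l • fun i => eval F (ψ l i)) F =
        ∑ l, s l • rowComb (fun i => eval F (ψ l i)) F := by
      exact (map_sum (rowCombL F) _ _).trans
        (Finset.sum_congr rfl fun l _ => map_smul (rowCombL F) _ _)
    funext i
    rcases i with i | j
    · simp [Θ]
    · simp only [Θ, Sum.elim_inr, map_sum, map_mul, eval_X, Sum.elim_inl, eval_rename,
        Sum.elim_comp_inr, h1, h2, Finset.sum_apply, Pi.smul_apply, smul_eq_mul]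
  refine ⟨⟨Fin (shrinkRank Y), Θ, h * h', fun a => rfl, ?_⟩, ?_, ?_⟩
  · intro L hL F hF hne s b hb
    rw [map_mul] at hne
    rw [hΘ] at hb
    have hbL : b.1 = L := gr_eq_of_mem_coords hb.1 hF
    refine ⟨hbL ▸ hL, ?_⟩
    have hb2 : rowComb (∑ l, s l • fun i => eval F (ψ l i)) F ∈ coords b.2 := hb.2
    rw [submodule_le_iff hb2, hbL, ← hM L hL.1 F hF (left_ne_zero_of_mul hne)]
    have h3 := (hψ F (right_ne_zero_of_mul hne) (hker L hL F hF (left_ne_zero_of_mul hne))).2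
    have h4 : (∑ l, s l • fun i => eval F (ψ l i)) ∈
        LinearMap.ker (M.map (eval F)).mulVecLin := by
      rw [← h3]
      exact Submodule.sum_mem _ fun l _ => Submodule.smul_mem _ _ (Submodule.subset_span ⟨l, rfl⟩)
    exact h4
  · rw [map_mul]
    exact mul_ne_zero h0 h0'
  · intro b hb v hv hne
    change eval (v ∘ Sum.inl) (h * h') ≠ 0 at hne
    rw [map_mul] at hne
    have h3 := (hψ _ (right_ne_zero_of_mul hne)
      (hker b.1 hb.1 _ hv.1 (left_ne_zero_of_mul hne))).2
    have h4 := (submodule_le_iff hv.2 _).1 hb.2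
    obtain ⟨c, hc⟩ := (mem_iff_rowComb hv.1).1 (kerPhi_le _ _ h4)
    rw [hc, ← hM b.1 hb.1.1 _ hv.1 (left_ne_zero_of_mul hne)] at h4
    have h5 : c ∈ LinearMap.ker (M.map (eval (v ∘ Sum.inl))).mulVecLin := h4
    rw [← h3, Submodule.mem_span_range_iff_exists_fun] at h5
    obtain ⟨s, hs⟩ := h5
    refine ⟨s, ?_⟩
    rw [LocalFamily.pt_eq]
    change (fun i => eval (Sum.elim s (v ∘ Sum.inl)) (Θ i)) = v
    rw [hΘ, hs, ← hc, Sum.elim_comp_inl_inr]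

theorem isPreirreducible_shrinkFamily (hY : IsVariety Y) :
    @IsPreirreducible _ (zariski (Gr k N r × PN k N)) (shrinkFamily Y) := by
  have := IsAlgClosed.instInfinite (K := k)
  refine LocalFamily.isPreirreducible (coord := Sum.inl)
    (prodRows (grRows k N r) (pnRows k N)) (grRows k N r)
    (isIrreducible_of_eventually hY shrinkDomain_subset (eventually_mem_shrinkDomain hY))
    Prod.fst (fun b hb => hb.1) (fun b v hv => hv.1) (fun b u hu => ?_) fun b hb v hv =>
      exists_localFamily_shrinkFamily hY hb.1 hv.1
  obtain ⟨v, hv⟩ := coords_nonempty b.2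
  exact ⟨Sum.elim u v, ⟨hu, hv⟩, rfl⟩

theorem vanishing_shrinkPullback : vanishing (shrinkPullback Y) = vanishing (shrinkFamily Y) := by
  rw [shrinkPullback_eq,
    (prodRows (grRows k N r) (pnRows k N)).vanishing_zclosure]

theorem vanishing_shrinkDomain (hY : IsVariety Y) : vanishing (shrinkDomain Y) = vanishing Y :=
  vanishing_eq_of_eventually (grRows k N r) hY shrinkDomain_subset
    (eventually_mem_shrinkDomain hY)

/-- The differential of the projection of the pull-back to `Y` is surjective. -/
theorem exists_mem_coneTangent_shrinkPullback (hY : IsVariety Y) {z : Gr k N r × PN k N}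
    (hz : z ∈ shrinkFamily Y) {v : (Fin r × Fin (N + 1)) ⊕ Fin (N + 1) → k} (hv : v ∈ coords z)
    {w : Fin r × Fin (N + 1) → k} (hw : w ∈ coneTangent Y (v ∘ Sum.inl)) :
    ∃ w' ∈ coneTangent (shrinkPullback Y) v, w' ∘ Sum.inl = w := by
  have := IsAlgClosed.instInfinite (K := k)
  obtain ⟨T, hT, hcov⟩ := exists_localFamily_shrinkFamily hY hz.1 hv.1
  obtain ⟨s, hs⟩ := hcov z hz v hv hT
  rw [coneTangent_congr vanishing_shrinkPullback]
  rw [← coneTangent_congr (vanishing_shrinkDomain hY)] at hw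
  have h1 := T.exists_mem_coneTangent (prodRows (grRows k N r) (pnRows k N))
    (by rw [hs]; exact hv) hT (isPt_of_mem hz.1 hv.1) hw
  rwa [hs] at h1

/-- The points of `shrinkPullback Y` over the domain of the shrinking map, and the tangent vectors
of the fibres. -/
theorem mem_kerPhi_of_isPt (hY : IsVariety Y) {L : Gr k N r} (hL : L ∈ shrinkDomain Y)
    {F : Fin r × Fin (N + 1) → k} (hF : F ∈ coords L) {v w : V k N}
    (h : IsPt (shrinkPullback Y) (Sum.elim (dual F 0) (dual v w))) :
    v ∈ kerPhi Y L ∧ w ∈ kerPhi Y L := by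
  obtain ⟨h₁, J, d, M, h0, hJ, hM⟩ := exists_kerMatrix hY hL.1 hF
  let XF : Fin r × Fin (N + 1) → MvPolynomial ((Fin r × Fin (N + 1)) ⊕ Fin (N + 1)) k :=
    fun a => X (Sum.inl a)
  let Xv : Fin (N + 1) → MvPolynomial ((Fin r × Fin (N + 1)) ⊕ Fin (N + 1)) k :=
    fun a => X (Sum.inr a)
  -- equations of the pull-back: `q₁` says that `v` is in `L`, and `q₂` that it is in the kernel of
  -- `Φ`
  let q₁ := fun j => defect J XF Xv j
  let q₂ := fun m => rename Sum.inl h₁ * ∑ i, rename Sum.inl (M m i) * coeffs J XF Xv i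
  have hq₁ : ∀ {A : Type _} [CommRing A] [Algebra k A] (F : Fin r × Fin (N + 1) → A)
      (v : Fin (N + 1) → A) (j), aeval (Sum.elim F v) (q₁ j) = defect J F v j := by
    intro A _ _ F v j
    have := defect_map (aeval (Sum.elim F v) : _ →ₐ[k] A).toRingHom J XF Xv j
    refine this.symm.trans ?_
    simp [XF, Xv]
  have hq₂ : ∀ {A : Type _} [CommRing A] [Algebra k A] (F : Fin r × Fin (N + 1) → A)
      (v : Fin (N + 1) → A) (m), aeval (Sum.elim F v) (q₂ m) =
        aeval F h₁ * ∑ i, aeval F (M m i) * coeffs J F v i := by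
    intro A _ _ F v m
    have h3 : ∀ i, aeval (Sum.elim F v) (coeffs J XF Xv i) = coeffs J F v i := by
      intro i
      have := coeffs_map (aeval (Sum.elim F v) : _ →ₐ[k] A).toRingHom J XF Xv i
      refine this.symm.trans ?_
      simp [XF, Xv]
    simp only [q₂, map_mul, map_sum, aeval_rename, Sum.elim_comp_inl, h3]
  have hv₁ : ∀ j, q₁ j ∈ vanishing (shrinkPullback Y) := by
    rw [vanishing_shrinkPullback]
    intro j z hz u hu
    rw [← Sum.elim_comp_inl_inr u, ← MvPolynomial.aeval_eq_eval, hq₁]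
    exact congrFun (defect_eq_zero hu.1 J
      (kerPhi_le _ _ ((submodule_le_iff hu.2 _).1 hz.2))) j
  have hv₂ : ∀ m, q₂ m ∈ vanishing (shrinkPullback Y) := by
    rw [vanishing_shrinkPullback]
    intro m z hz u hu
    rw [← Sum.elim_comp_inl_inr u, ← MvPolynomial.aeval_eq_eval, hq₂]
    by_cases hne : eval (u ∘ Sum.inl) h₁ = 0
    · rw [MvPolynomial.aeval_eq_eval, hne, zero_mul]
    have h4 := (submodule_le_iff hu.2 _).1 hz.2
    obtain ⟨c, hc⟩ := (mem_iff_rowComb hu.1).1 (kerPhi_le _ _ h4)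
    rw [hc, ← hM z.1 hz.1.1 _ hu.1 hne] at h4
    rw [hc, coeffs_rowComb]
    have h5 := congrFun h4 m
    simp only [Matrix.mulVec, dotProduct, Matrix.map_apply, Pi.zero_apply] at h5
    simp only [MvPolynomial.aeval_eq_eval, Pi.smul_apply, smul_eq_mul,
        mul_left_comm _ (cols _ _).det,
      ← Finset.mul_sum, h5, mul_zero]
  have hne : eval F h₁ ≠ 0 := h0
  have hdet := hJ F hne
  -- the equations are linear in the second factor
  let ι : k →+* DualNumber k := TrivSqZeroExt.inlHom k k
  have hF0 : dual F 0 = fun a => ι (F a) := by funext a; simp [dual, ι]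
  have hvw : dual v w = (fun j => ι (v j)) +
      (DualNumber.eps : DualNumber k) • fun j => ι (w j) := by
    funext j
    ext
    · simp [ι]
    · simp [ι]
  have hsplit : ∀ a b : k, ι a + DualNumber.eps * ι b = 0 → a = 0 ∧ b = 0 := by
    intro a b hab
    constructor
    · simpa [ι] using congrArg TrivSqZeroExt.fst hab
    · simpa [ι] using congrArg TrivSqZeroExt.snd hab
  have e₁ : ∀ j, defect J F v j = 0 ∧ defect J F w j = 0 := by
    intro j
    have := h _ (hv₁ j)
    rw [hq₁, hF0, hvw, defect_add, defect_smul, Pi.add_apply, Pi.smul_apply, defect_map,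
      defect_map, smul_eq_mul] at this
    exact hsplit _ _ this
  have hιp : ∀ p : MvPolynomial (Fin r × Fin (N + 1)) k,
      aeval (fun a => ι (F a)) p = ι (eval F p) := by
    intro p
    have : (fun a => ι (F a)) = algebraMap k (DualNumber k) ∘ F := rfl
    rw [this, MvPolynomial.aeval_algebraMap_apply, MvPolynomial.aeval_eq_eval]
    rfl
  have e₂ : ∀ m, (∑ i, eval F (M m i) * coeffs J F v i) = 0 ∧
      (∑ i, eval F (M m i) * coeffs J F w i) = 0 := by
    intro m
    have := h _ (hv₂ m)
    rw [hq₂, hF0, hvw, coeffs_add, coeffs_smul] at this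
    simp only [hιp, Pi.add_apply, Pi.smul_apply, coeffs_map, smul_eq_mul] at this
    have h6 : ι (eval F h₁ * ∑ i, eval F (M m i) * coeffs J F v i) +
        DualNumber.eps * ι (eval F h₁ * ∑ i, eval F (M m i) * coeffs J F w i) = 0 := by
      rw [← this]
      simp only [map_mul, map_sum, mul_add, Finset.sum_add_distrib, Finset.mul_sum]
      congr 1
      exact Finset.sum_congr rfl fun i _ => by ring
    have h7 := hsplit _ _ h6
    exact ⟨(mul_eq_zero.1 h7.1).resolve_left hne, (mul_eq_zero.1 h7.2).resolve_left hne⟩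
  have final : ∀ t : V k N, (∀ j, defect J F t j = 0) →
      (∀ m, (∑ i, eval F (M m i) * coeffs J F t i) = 0) → t ∈ kerPhi Y L := by
    intro t h1 h2
    obtain ⟨c, rfl⟩ := exists_rowComb_of_defect_eq_zero hdet (funext h1)
    rw [← hM L hL.1 F hF hne]
    funext m
    have h3 := h2 m
    simp only [coeffs_rowComb, Pi.smul_apply, smul_eq_mul, mul_left_comm _ (cols _ _).det,
      ← Finset.mul_sum] at h3
    exact (mul_eq_zero.1 h3).resolve_left hdet.ne_zero
  exact ⟨final v (fun j => (e₁ j).1) fun m => (e₂ m).1,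
    final w (fun j => (e₁ j).2) fun m => (e₂ m).2⟩

end Shrink

/-! ### The projection of the pull-back to the base -/

section Closure

variable {k P Q : Type*} {ι κ : Type} [Field k] [HomogCoords k P ι] [HomogCoords k Q κ]

theorem isVariety_zclosure {B : Set P} (hB : IsPreirreducible B) (hne : B.Nonempty) :
    IsVariety (zclosure B) := ⟨isClosed_closure, IsIrreducible.closure ⟨hne, hB⟩⟩

theorem imageVariety_zclosure {f : P → Q} (hf : IsPolyMap f) (B : Set P) :
    imageVariety f (zclosure B) = zclosure (f '' B) :=
  closure_image_closure hf.continuous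

theorem subset_zclosure (B : Set P) : B ⊆ zclosure B := subset_closure

theorem subset_of_eventually {Z W : Set P} (hW : IsVariety W) (h : ∀ᶠ x in generic Z, x ∈ W) :
    Z ⊆ W := closed_of_eventually hW.1 h

theorem image_eq_imageVariety {f : P → Q} {Z : Set P} (h : IsClosed (f '' Z)) :
    f '' Z = imageVariety f Z := h.closure_eq.symm

end Closure

namespace Rows

variable {k P Q : Type*} {ι κ : Type} [Field k] [HomogCoords k P ι] [HomogCoords k Q κ] [Fintype ι]
  [Fintype κ] {R R' C : Type} [Fintype R] [DecidableEq R] [Fintype R'] [DecidableEq R']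

theorem card_entries_fst (ρ : Rows P R C) (ρ' : Rows Q R' C) :
    Nat.card ((prodRows ρ ρ').Entries (Set.range (fstMap ρ ρ').row)) =
      Nat.card (ρ'.Entries ∅) := by
  symm
  refine Nat.card_eq_of_bijective (fun ij => ⟨(Sum.inr ij.1.1, Sum.inr ij.1.2),
    ((sndMap ρ ρ').lbl_iff _ _).2 ij.2.1, by rintro ⟨a, ha⟩; exact Sum.inl_ne_inr ha⟩) ⟨?_, ?_⟩
  · rintro ⟨⟨i, j⟩, h⟩ ⟨⟨i', j'⟩, h'⟩ heq
    simp only [Subtype.mk.injEq, Prod.mk.injEq, Sum.inr.injEq] at heq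
    simp [heq]
  · rintro ⟨⟨i, j⟩, h, hi⟩
    rcases i with i | i
    · exact (hi ⟨i, rfl⟩).elim
    · obtain ⟨j, rfl⟩ := (sndMap ρ ρ').block _ j h ⟨i, rfl⟩
      exact ⟨⟨(i, j), ((sndMap ρ ρ').lbl_iff _ _).1 h, Set.notMem_empty _⟩, rfl⟩

theorem mem_tanRel_fst_iff (ρ : Rows P R C) (ρ' : Rows Q R' C) {Z : Set (P × Q)} {v w : ι ⊕ κ → k} :
    w ∈ (prodRows ρ ρ').tanRel (Set.range (fstMap ρ ρ').row) Z v ↔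
      w ∈ coneTangent Z v ∧ w ∘ Sum.inl = 0 := by
  have h1 : w ∈ (prodRows ρ ρ').tanRel (Set.range (fstMap ρ ρ').row) Z v ↔
    w ∈ tangentAt Z v ∧ ∀ a, ((prodRows ρ ρ').idx a).1 ∈ Set.range (fstMap ρ ρ').row → w a = 0 :=
    Iff.rfl
  rw [h1, tangentAt_eq_coneTangent]
  refine and_congr_right fun _ => ?_
  have h2 : ∀ a, ((prodRows ρ ρ').idx a).1 ∈ Set.range (fstMap ρ ρ').row ↔
      a ∈ Set.range (Sum.inl : ι → ι ⊕ κ) := fun a => by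
    exact Set.ext_iff.1 (fstMap ρ ρ').range_coord a
  simp only [h2, Set.forall_mem_range]
  exact ⟨fun h => funext h, fun h a => congrFun h a⟩

theorem mem_tanRel_snd_iff (ρ : Rows P R C) (ρ' : Rows Q R' C) {Z : Set (P × Q)} {v w : ι ⊕ κ → k} :
    w ∈ (prodRows ρ ρ').tanRel (Set.range (sndMap ρ ρ').row) Z v ↔
      w ∈ coneTangent Z v ∧ w ∘ Sum.inr = 0 := by
  have h1 : w ∈ (prodRows ρ ρ').tanRel (Set.range (sndMap ρ ρ').row) Z v ↔
    w ∈ tangentAt Z v ∧ ∀ a, ((prodRows ρ ρ').idx a).1 ∈ Set.range (sndMap ρ ρ').row → w a = 0 :=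
    Iff.rfl
  rw [h1, tangentAt_eq_coneTangent]
  refine and_congr_right fun _ => ?_
  have h2 : ∀ a, ((prodRows ρ ρ').idx a).1 ∈ Set.range (sndMap ρ ρ').row ↔
      a ∈ Set.range (Sum.inr : κ → ι ⊕ κ) := fun a => by
    exact Set.ext_iff.1 (sndMap ρ ρ').range_coord a
  simp only [h2, Set.forall_mem_range]
  exact ⟨fun h => funext h, fun h a => congrFun h a⟩

end Rows

section ShrinkVariety

variable {k : Type*} [Field k] [IsAlgClosed k] {N r : ℕ} {Y : Set (Gr k N r)}

/-- Points of `𝔾(r - 1, ℙ^N) × ℙ^N` as matrices. -/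
abbrev incRows (k : Type*) [Field k] (N r : ℕ) :
    Rows (Gr k N r × PN k N) (Fin r ⊕ Unit) (Fin (N + 1)) :=
  prodRows (grRows k N r) (pnRows k N)

theorem card_entries_incRows : Nat.card ((incRows k N r).Entries ∅) = r * r + 1 := by
  rw [incRows, (Rows.fstMap (grRows k N r) (pnRows k N)).card_entries, Rows.card_entries_fst,
    card_entries_gr, card_entries_pn]

theorem isVariety_shrinkPullback (hY : IsVariety Y) (hne : (shrinkFamily Y).Nonempty) :
    IsVariety (shrinkPullback Y) := by
  rw [shrinkPullback_eq]
  exact isVariety_zclosure (isPreirreducible_shrinkFamily hY) hne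

theorem shrinkFamily_nonempty_of_shrinkPullback (h : (shrinkPullback Y).Nonempty) :
    (shrinkFamily Y).Nonempty := by
  rw [shrinkPullback_eq, zclosure] at h
  exact (@closure_nonempty_iff _ (zariski _) _).1 h

theorem image_fst_shrinkFamily (hne : (shrinkFamily Y).Nonempty) :
    Prod.fst '' shrinkFamily Y = shrinkDomain Y := by
  ext L
  constructor
  · rintro ⟨z, hz, rfl⟩
    exact hz.1
  · intro hL
    obtain ⟨z, hz⟩ := hne
    have h1 : kerPhi Y z.1 ≠ ⊥ := by
      intro h0
      obtain ⟨v, hv⟩ := coords_nonempty z.2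
      have h2 := (submodule_le_iff hv _).1 hz.2
      rw [h0, Submodule.mem_bot] at h2
      obtain ⟨hv0, -⟩ := hv
      exact hv0 h2
    have h2 : kerPhi Y L ≠ ⊥ := by
      intro h0
      apply h1
      have h3 : Module.finrank k (kerPhi Y L) = 0 := by rw [h0, finrank_bot]
      rw [hL.2, ← hz.1.2] at h3
      exact Submodule.finrank_eq_zero.1 h3
    obtain ⟨v, hv, hv0⟩ := Submodule.exists_mem_ne_zero_of_ne_bot h2
    exact ⟨(L, Projectivization.mk k v hv0), ⟨hL, (submodule_le_iff ⟨hv0, rfl⟩ _).2 hv⟩, rfl⟩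

theorem imageVariety_fst_shrinkPullback (hY : IsVariety Y) (hne : (shrinkFamily Y).Nonempty) :
    imageVariety Prod.fst (shrinkPullback Y) = Y := by
  rw [shrinkPullback_eq, imageVariety_zclosure isPolyMap_fst, image_fst_shrinkFamily hne]
  exact zclosure_eq_of_eventually hY shrinkDomain_subset (eventually_mem_shrinkDomain hY)

theorem mem_shrinkFamily_of_mem (hY : IsVariety Y) {z : Gr k N r × PN k N}
    (hz : z ∈ shrinkPullback Y) (hz' : z.1 ∈ shrinkDomain Y) :
    z ∈ shrinkFamily Y := by
  obtain ⟨F, hF⟩ := coords_nonempty z.1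
  obtain ⟨v, hv⟩ := coords_nonempty z.2
  refine ⟨hz', ?_⟩
  rw [submodule_le_iff hv]
  have h1 : IsPt (shrinkPullback Y) (dual (Sum.elim F v) 0) :=
    isPt_dual.2 ⟨isPt_of_mem hz ⟨hF, hv⟩, Submodule.zero_mem _⟩
  have h2 : dual (Sum.elim F v) 0 = Sum.elim (dual F 0) (dual v 0) := by
    rw [LocalFamily.dual_sumElim]
    congr 1
    funext i
    rcases i with i | i <;> rfl
  rw [h2] at h1
  exact (mem_kerPhi_of_isPt hY hz' hF h1).1

theorem eventually_mem_shrinkFamily (hY : IsVariety Y) (hS : IsVariety (shrinkPullback Y)) :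
    ∀ᶠ z in generic (shrinkPullback Y), z ∈ shrinkFamily Y := by
  have h1 := (isPolyMap_fst (P := Gr k N r) (Q := PN k N)).tendsto hS
  rw [imageVariety_fst_shrinkPullback hY
    (shrinkFamily_nonempty_of_shrinkPullback (hS.2.1))] at h1
  filter_upwards [eventually_mem (shrinkPullback Y), h1.eventually (eventually_mem_shrinkDomain hY)]
    with z hz hz'
  exact mem_shrinkFamily_of_mem hY hz hz'

/-- The pull-back is separable over `Y`, since it is a vector bundle over an open subset of `Y`, up
to scalars. -/
theorem isSeparableMorphism_fst_shrinkPullback (hY : IsVariety Y)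
    (hS : IsVariety (shrinkPullback Y)) : IsSeparableMorphism Prod.fst (shrinkPullback Y) := by
  have hW := imageVariety_fst_shrinkPullback hY (shrinkFamily_nonempty_of_shrinkPullback (hS.2.1))
  rw [(Rows.fstMap (grRows k N r) (pnRows k N)).isSeparableMorphism_iff hS]
  filter_upwards [eventually_mem_shrinkFamily hY hS, eventually_mem (shrinkPullback Y)]
    with z hz hz' v hv
  refine le_antisymm (Rows.RowMap.map_restr_le _ (isPt_of_mem hz' hv)) fun w hw => ?_
  rw [hW] at hw
  obtain ⟨w', hw', rfl⟩ := exists_mem_coneTangent_shrinkPullback hY hz hv hw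
  exact ⟨w', hw', rfl⟩

/-- The fibres of the pull-back over `Y` have at most the dimension of the projectivized kernel of
`Φ`. -/
theorem dimN_shrinkPullback_le (hY : IsVariety Y) (hS : IsVariety (shrinkPullback Y)) :
    Rows.dimN hS + 1 ≤ shrinkRank Y + Rows.dimN hY := by
  have hW := imageVariety_fst_shrinkPullback hY (shrinkFamily_nonempty_of_shrinkPullback (hS.2.1))
  have hne := generic_neBot hS.2.1
  have h1 := (Rows.fstMap (grRows k N r) (pnRows k N)).eventually_dimN_le hS
    (hW.symm ▸ hY)
  obtain ⟨z, hz, h2⟩ := ((eventually_mem_shrinkFamily hY hS).and h1).exists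
  obtain ⟨v, hv⟩ := coords_nonempty z
  have h3 := h2 v hv
  rw [Rows.card_entries_fst, card_entries_pn] at h3
  have h4 : Rows.dimN (hW.symm ▸ hY : IsVariety (imageVariety Prod.fst (shrinkPullback Y))) =
      Rows.dimN hY := by
    congr!
  rw [h4] at h3
  refine h3.trans (Nat.add_le_add_right ?_ _)
  rw [← hz.1.2]
  have h5 : ∀ w ∈ (incRows k N r).tanRel
      (Set.range (Rows.fstMap (grRows k N r) (pnRows k N)).row) (shrinkPullback Y) v,
      w ∘ Sum.inr ∈ kerPhi Y z.1 ∧ w ∘ Sum.inl = 0 := by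
    intro w hw
    rw [Rows.mem_tanRel_fst_iff, ← tangentAt_eq_coneTangent] at hw
    refine ⟨?_, hw.2⟩
    have h6 : IsPt (shrinkPullback Y) (dual v w) :=
      isPt_dual.2 ⟨isPt_of_mem (by rw [shrinkPullback_eq]; exact subset_zclosure _ hz) hv, hw.1⟩
    have h7 : dual v w = Sum.elim (dual (v ∘ Sum.inl) 0) (dual (v ∘ Sum.inr) (w ∘ Sum.inr)) := by
      rw [LocalFamily.dual_sumElim, Sum.elim_comp_inl_inr, ← hw.2, Sum.elim_comp_inl_inr]
    rw [h7] at h6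
    exact (mem_kerPhi_of_isPt hY hz.1 hv.1 h6).2
  let G := (incRows k N r).tanRel
      (Set.range (Rows.fstMap (grRows k N r) (pnRows k N)).row) (shrinkPullback Y) v
  let f : G →ₗ[k] kerPhi Y z.1 :=
    LinearMap.codRestrict _ ((LinearMap.funLeft k k Sum.inr).domRestrict G) fun w => (h5 w.1 w.2).1
  refine LinearMap.finrank_le_finrank_of_injective (f := f) fun w w' hww => ?_
  apply Subtype.ext
  rw [← Sum.elim_comp_inl_inr w.1, ← Sum.elim_comp_inl_inr w'.1, (h5 w.1 w.2).2, (h5 w'.1 w'.2).2]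
  congr 1
  exact congrArg Subtype.val hww

end ShrinkVariety

/-! ### The incidence variety -/

section Proj

variable {k : Type*} [Field k] {N : ℕ} {X : Set (PN k N)}

theorem act_pnRows (B : Matrix Unit Unit k) (v : V k N) : (pnRows k N).act B v = B () () • v := by
  funext a
  simp [Rows.act, actOn_apply, pnRows]

/-- The tangent space of the cone over `X ⊆ ℙ^N` is the same at all vectors of a line, so that it
can be computed at any of them. -/
theorem coneTangent_eq_embTangent [Infinite k] {x : PN k N} (hx : x ∈ X) {v : V k N}
    (hv : v ∈ coords x) : coneTangent X v = embTangent X x := by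
  have hle : ∀ u v : V k N, u ∈ coords x → v ∈ coords x → coneTangent X u ≤ coneTangent X v := by
    intro u v hu hv w hw
    obtain ⟨B, hB, hBu, rfl⟩ := (pnRows k N).exists_act hu hv
    have h1 := (pnRows k N).act_mem_tangentAt hB hBu (isPt_of_mem hx hu)
      (by rw [tangentAt_eq_coneTangent]; exact hw)
    rw [tangentAt_eq_coneTangent, act_pnRows B w] at h1
    have h2 : B () () ≠ 0 := by
      have : B.det = B () () := by simp
      rw [← this]; exact hBu.ne_zero
    exact (Submodule.smul_mem_iff _ h2).1 h1
  have hr : x.rep ∈ coords x := ⟨x.rep_nonzero, x.mk_rep⟩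
  exact le_antisymm (hle _ _ hv hr) (hle _ _ hr hv)

theorem self_mem_coneTangent [Infinite k] {x : PN k N} (hx : x ∈ X) {v : V k N}
    (hv : v ∈ coords x) : v ∈ coneTangent X v := by
  have h1 := (pnRows k N).act_mem_tangentAt_self (B := 1) (fun _ _ h => (h rfl).elim)
    (isPt_of_mem hx hv)
  rwa [Rows.act_one, tangentAt_eq_coneTangent] at h1

variable [IsAlgClosed k] {n : ℕ}

theorem mem_smoothLocus_iff (hd : zdim X = (n : WithBot ℕ∞)) {x : PN k N} {v : V k N}
    (hv : v ∈ coords x) :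
    x ∈ smoothLocus X ↔ x ∈ X ∧ Module.finrank k (coneTangent X v) = n + 1 := by
  have := IsAlgClosed.instInfinite (K := k)
  refine and_congr_right fun hx => ?_
  rw [coneTangent_eq_embTangent hx hv, hd]
  exact_mod_cast Iff.rfl

theorem smoothLocus_subset : smoothLocus X ⊆ X := fun _ h => h.1

theorem eventually_mem_smoothLocus (hX : IsVariety X) :
    ∀ᶠ x in generic X, x ∈ smoothLocus X := by
  filter_upwards [(pnRows k N).eventually_finrank_coneTangent hX, eventually_mem X] with x h1 hx
  obtain ⟨v, hv⟩ := coords_nonempty x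
  rw [mem_smoothLocus_iff ((pnRows k N).zdim_eq hX) hv, h1 v hv, card_entries_pn]
  exact ⟨hx, rfl⟩

theorem vanishing_smoothLocus (hX : IsVariety X) : vanishing (smoothLocus X) = vanishing X :=
  vanishing_eq_of_eventually (pnRows k N) hX smoothLocus_subset (eventually_mem_smoothLocus hX)

end Proj

section Incidence

variable {k : Type*} [Field k] {N r : ℕ}

/-- The pairs `(L, x)` with `x` a smooth point of `X` and `L` containing the tangent space. -/
def incFamily (X : Set (PN k N)) (r : ℕ) : Set (Gr k N r × PN k N) :=
  {z | z.2 ∈ smoothLocus X ∧ embTangent X z.2 ≤ z.1.1}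

theorem incidence_eq (X : Set (PN k N)) (m : ℕ) :
    incidence X m = zclosure (incFamily X (m + 1)) := rfl

/-- The matrix whose first rows are `t` and whose other rows are those of `f`. -/
def extendRows {A : Type*} {d : ℕ} (t : Fin d → Fin (N + 1) → A) (f : Fin r × Fin (N + 1) → A) :
    Fin r × Fin (N + 1) → A :=
  fun ij => if h : (ij.1 : ℕ) < d then t ⟨ij.1, h⟩ ij.2 else f ij

theorem extendRows_of_lt {A : Type*} {d : ℕ} {t : Fin d → Fin (N + 1) → A}
    {f : Fin r × Fin (N + 1) → A} {i : Fin r} (hi : (i : ℕ) < d) (j : Fin (N + 1)) :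
    extendRows t f (i, j) = t ⟨i, hi⟩ j := dif_pos hi

theorem extendRows_of_not_lt {A : Type*} {d : ℕ} {t : Fin d → Fin (N + 1) → A}
    {f : Fin r × Fin (N + 1) → A} {i : Fin r} (hi : ¬ (i : ℕ) < d) (j : Fin (N + 1)) :
    extendRows t f (i, j) = f (i, j) := dif_neg hi

/-- Basis extension: independent vectors `t` of `L` are the first rows of a coordinate matrix of
`L`. -/
theorem exists_extendRows_mem_coords {L : Gr k N r} {d : ℕ} (hdr : d ≤ r)
    {t : Fin d → Fin (N + 1) → k} (ht : LinearIndependent k t)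
    (htL : Submodule.span k (Set.range t) ≤ L.1) : ∃ f, extendRows t f ∈ coords L := by
  obtain ⟨C, hC⟩ := Submodule.exists_isCompl (Submodule.span k (Set.range t))
  have hsup : Submodule.span k (Set.range t) ⊔ (C ⊓ L.1) = L.1 := by
    rw [← sup_inf_assoc_of_le C htL, hC.sup_eq_top, top_inf_eq]
  have hinf : Submodule.span k (Set.range t) ⊓ (C ⊓ L.1) = ⊥ := by
    rw [← inf_assoc, hC.inf_eq_bot, bot_inf_eq]
  have hfin := Submodule.finrank_sup_add_finrank_inf_eq (Submodule.span k (Set.range t)) (C ⊓ L.1)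
  rw [hsup, hinf, finrank_bot, finrank_span_eq_card ht, Fintype.card_fin, L.2] at hfin
  have hC' : Module.finrank k (C ⊓ L.1 : Submodule k (V k N)) = r - d :=
    Nat.eq_sub_of_add_eq ((add_comm _ _).trans hfin.symm)
  let b := Module.finBasisOfFinrankEq k _ hC'
  refine ⟨fun ij => if h : (ij.1 : ℕ) < d then 0 else
    (b ⟨ij.1 - d, by have := ij.1.2; omega⟩ : V k N) ij.2, ?_⟩
  change Submodule.span k (Set.range _) = L.1
  have hrow1 : ∀ (i : Fin r) (h : (i : ℕ) < d),
      (fun j => extendRows t (fun ij : Fin r × Fin (N + 1) =>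
      if h : (ij.1 : ℕ) < d then 0
      else (b ⟨ij.1 - d, by have := ij.1.2; omega⟩ : V k N) ij.2) (i, j)) =
      t ⟨i, h⟩ := by
    intro i h
    funext j
    simp [extendRows, h]
  have hrow2 : ∀ (i : Fin r) (h : ¬ (i : ℕ) < d),
      (fun j => extendRows t (fun ij : Fin r × Fin (N + 1) =>
      if h : (ij.1 : ℕ) < d then 0
      else (b ⟨ij.1 - d, by have := ij.1.2; omega⟩ : V k N) ij.2) (i, j)) =
      (b ⟨i - d, by have := i.2; omega⟩ : V k N) := by
    intro i h
    funext j
    simp [extendRows, h]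
  apply le_antisymm
  · rw [Submodule.span_le]
    rintro _ ⟨i, rfl⟩
    by_cases h : (i : ℕ) < d
    · beta_reduce
      rw [hrow1 i h]
      exact htL (Submodule.subset_span ⟨_, rfl⟩)
    · beta_reduce
      rw [hrow2 i h]
      exact (b ⟨i - d, by have := i.2; omega⟩).2.2
  · refine hsup.ge.trans (sup_le ?_ ?_)
    · rw [Submodule.span_le]
      rintro _ ⟨i, rfl⟩
      have h := hrow1 ⟨i, by have := i.2; omega⟩ i.2
      refine Submodule.subset_span ⟨⟨i, by have := i.2; omega⟩, h⟩
    · intro w hw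
      have h1 := b.sum_repr ⟨w, hw⟩
      have h2 := congrArg Subtype.val h1
      rw [Submodule.coe_sum] at h2
      change _ = w at h2
      rw [← h2]
      refine Submodule.sum_mem _ fun i _ => Submodule.smul_mem _ _ ?_
      have h3 : ¬ ((⟨i + d, by have := i.2; omega⟩ : Fin r) : ℕ) < d := by simp
      have h := hrow2 ⟨i + d, by have := i.2; omega⟩ h3
      refine Submodule.subset_span ⟨⟨i + d, by have := i.2; omega⟩, ?_⟩
      refine h.trans ?_
      congr 2
      ext
      simp

theorem mem_of_act_extendRows_mem_coords {L : Gr k N r} {d : ℕ} (hdr : d ≤ r)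
    {t : Fin d → Fin (N + 1) → k} {f : Fin r × Fin (N + 1) → k} {G : Matrix (Fin r) (Fin r) k}
    (h : (grRows k N r).act G (extendRows t f) ∈ coords L) (i : Fin d) : t i ∈ L.1 := by
  have h1 : Submodule.span k (Set.range fun i : Fin r => fun j =>
      (grRows k N r).act G (extendRows t f) (i, j)) = L.1 := h
  have h2 : L.1 = Submodule.span k (Set.range fun i : Fin r => fun j => extendRows t f (i, j)) := by
    refine Submodule.eq_of_le_of_finrank_le ?_ ?_
    · rw [← h1, Submodule.span_le]
      rintro _ ⟨l, rfl⟩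
      have : (fun j => (grRows k N r).act G (extendRows t f) (l, j)) =
          ∑ i, G l i • fun j => extendRows t f (i, j) := by
        rw [← rowComb_eq_sum]
        funext j
        exact actOn_grRows l j
      beta_reduce
      rw [this]
      exact Submodule.sum_mem _ fun i _ => Submodule.smul_mem _ _ (Submodule.subset_span ⟨i, rfl⟩)
    · rw [L.2]
      exact (finrank_range_le_card _).trans (by simp)
  rw [h2]
  refine Submodule.subset_span ⟨⟨i, by have := i.2; omega⟩, ?_⟩
  funext j
  simp [extendRows]

variable [IsAlgClosed k] {X : Set (PN k N)} {n : ℕ}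

theorem exists_smoothFrame (hd : zdim X = (n : WithBot ℕ∞)) {x₀ : PN k N}
    (hx₀ : x₀ ∈ smoothLocus X) {u₀ : V k N} (hu₀ : u₀ ∈ coords x₀) :
    ∃ (h : MvPolynomial (Fin (N + 1)) k)
      (φ : Fin (n + 1) → Fin (N + 1) → MvPolynomial (Fin (N + 1)) k), eval u₀ h ≠ 0 ∧
      ∀ x ∈ smoothLocus X, ∀ u ∈ coords x, eval u h ≠ 0 →
        LinearIndependent k (fun i a => eval u (φ i a)) ∧
        Submodule.span k (Set.range fun i a => eval u (φ i a)) = coneTangent X u := by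
  have h1 := (mem_smoothLocus_iff hd hu₀).1 hx₀
  obtain ⟨h, φ, h0, hφ⟩ := exists_tangentFrame X u₀ (isPt_of_mem h1.1 hu₀) h1.2
  exact ⟨h, φ, h0, fun x hx u hu hne =>
    hφ u (isPt_of_mem hx.1 hu) hne ((mem_smoothLocus_iff hd hu).1 hx).2⟩

/-- Near a smooth point of `X`, the linear spaces which contain the tangent space are spanned by a
basis of the tangent space with polynomial entries and by arbitrary further vectors. The family
also contains all infinitesimal motions of `L` that keep the tangent space in `L` to first order. -/
theorem exists_localFamily_incFamily (hnr : n + 1 ≤ r) (hd : zdim X = (n : WithBot ℕ∞))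
    {x₀ : PN k N} (hx₀ : x₀ ∈ smoothLocus X) {u₀ : V k N} (hu₀ : u₀ ∈ coords x₀) :
    ∃ T : LocalFamily (incFamily X r) (smoothLocus X) Sum.inr, eval u₀ T.h ≠ 0 ∧ T.Covers ∧
      ∀ b ∈ incFamily X r, ∀ v ∈ coords b, eval (v ∘ Sum.inr) T.h ≠ 0 →
        ∀ F' : Fin r × Fin (N + 1) → k,
          (∀ a, rowComb a (v ∘ Sum.inl) ∈ embTangent X b.2 → rowComb a F' ∈ b.1.1) →
          ∃ s s', T.pt s (v ∘ Sum.inr) = v ∧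
            T.pt (dual s s') (dual (v ∘ Sum.inr) 0) = dual v (Sum.elim F' 0) := by
  have := IsAlgClosed.instInfinite (K := k)
  obtain ⟨h, φ, h0, hφ⟩ := exists_smoothFrame hd hx₀ hu₀
  -- the rows of `L` are `G E`, where the square matrix `G` is free, the first rows of `E` are the
  -- frame of the tangent space, and the other rows of `E` are free
  let Θ : (Fin r × Fin (N + 1)) ⊕ Fin (N + 1) →
      MvPolynomial (((Fin r × Fin r) ⊕ (Fin r × Fin (N + 1))) ⊕ Fin (N + 1)) k :=
    Sum.elim (fun ij => ∑ l, MvPolynomial.X (Sum.inl (Sum.inl (ij.1, l))) *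
      extendRows (fun i a => rename Sum.inr (φ i a))
        (fun lj => MvPolynomial.X (Sum.inl (Sum.inr lj))) (l, ij.2))
      (fun j => MvPolynomial.X (Sum.inr j))
  have hΘ : ∀ {A : Type _} [CommRing A] [Algebra k A] (g : Fin r × Fin r → A)
      (f : Fin r × Fin (N + 1) → A) (u : Fin (N + 1) → A),
      (fun i => aeval (Sum.elim (Sum.elim g f) u) (Θ i)) =
        Sum.elim (fun ij => ∑ l, g (ij.1, l) *
          extendRows (fun i a => aeval u (φ i a)) f (l, ij.2)) u := by
    intro A _ _ g f u
    funext i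
    rcases i with i | j
    · simp only [Θ, Sum.elim_inl, map_sum, map_mul, aeval_X]
      refine Finset.sum_congr rfl fun l _ => ?_
      congr 1
      simp only [extendRows]
      split_ifs
      · rw [aeval_rename, Sum.elim_comp_inr]
      · simp
    · simp [Θ]
  have hΘk : ∀ (g : Fin r × Fin r → k) (f : Fin r × Fin (N + 1) → k) (u : Fin (N + 1) → k),
      (fun i => eval (Sum.elim (Sum.elim g f) u) (Θ i)) =
        Sum.elim ((grRows k N r).act (Matrix.of fun i l => g (i, l))
          (extendRows (fun i a => eval u (φ i a)) f)) u := by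
    intro g f u
    have h1 := hΘ g f u
    simp only [MvPolynomial.aeval_eq_eval] at h1
    rw [h1]
    congr 1
  -- a member of the family through a given point
  have hcov : ∀ b ∈ incFamily X r, ∀ v ∈ coords b, eval (v ∘ Sum.inr) h ≠ 0 →
      ∃ (G : Matrix (Fin r) (Fin r) k) (f : Fin r × Fin (N + 1) → k), IsUnit G.det ∧
        extendRows (fun i a => eval (v ∘ Sum.inr) (φ i a)) f ∈ coords b.1 ∧
        v ∘ Sum.inl = (grRows k N r).act G
          (extendRows (fun i a => eval (v ∘ Sum.inr) (φ i a)) f) := by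
    intro b hb v hv hne
    obtain ⟨hli, hspan⟩ := hφ b.2 hb.1 _ hv.2 hne
    obtain ⟨f, hf⟩ := exists_extendRows_mem_coords (L := b.1) hnr hli
      (by rw [hspan, coneTangent_eq_embTangent hb.1.1 hv.2]; exact hb.2)
    obtain ⟨G, -, hG, hGF⟩ := (grRows k N r).exists_act hf hv.1
    exact ⟨G, f, hG, hf, hGF⟩
  refine ⟨⟨(Fin r × Fin r) ⊕ (Fin r × Fin (N + 1)), Θ, h, fun a => rfl, ?_⟩, h0, ?_, ?_⟩
  · intro x hx u hu hne s b hb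
    rw [← Sum.elim_comp_inl_inr s, hΘk] at hb
    have hbx : b.2 = x := pn_eq_of_mem_coords hb.2 hu
    refine ⟨hbx ▸ hx, ?_⟩
    rw [hbx, ← coneTangent_eq_embTangent hx.1 hu, ← (hφ x hx u hu hne).2, Submodule.span_le]
    rintro _ ⟨i, rfl⟩
    exact mem_of_act_extendRows_mem_coords hnr hb.1 i
  · intro b hb v hv hne
    obtain ⟨G, f, -, -, hG⟩ := hcov b hb v hv hne
    refine ⟨Sum.elim (fun il => G il.1 il.2) f, ?_⟩
    rw [LocalFamily.pt_eq]
    change (fun i => eval _ (Θ i)) = v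
    rw [hΘk]
    change Sum.elim ((grRows k N r).act G _) _ = v
    rw [← hG, Sum.elim_comp_inl_inr]
  · intro b hb v hv hne F' hF'
    obtain ⟨G, f, hGu, hE, hG⟩ := hcov b hb v hv hne
    obtain ⟨hli, hspan⟩ := hφ b.2 hb.1 _ hv.2 hne
    set E := extendRows (fun i a => eval (v ∘ Sum.inr) (φ i a)) f with hEdef
    have hEF : E = (grRows k N r).act G⁻¹ (v ∘ Sum.inl) := by
      rw [hG, Rows.act_inv_act _ hGu]
    -- a motion `F'` that keeps the tangent space in `L` moves the first rows of `E = G⁻¹ F` inside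
    -- `L`; this part of the motion is a motion of `G`, the rest is a motion of the other rows of
    -- `E`
    have hrow : ∀ (i : Fin r) (hi : (i : ℕ) < n + 1), rowComb (G⁻¹ i) F' ∈ b.1.1 := by
      intro i hi
      apply hF'
      have h1 : rowComb (G⁻¹ i) (v ∘ Sum.inl) = fun a => eval (v ∘ Sum.inr) (φ ⟨i, hi⟩ a) := by
        funext j
        rw [← actOn_grRows, ← hEF, hEdef, extendRows_of_lt hi]
      rw [h1, ← coneTangent_eq_embTangent hb.1.1 hv.2, ← hspan]
      exact Submodule.subset_span ⟨_, rfl⟩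
    have hK : ∀ i : Fin r, ∃ κ : Fin r → k, ((i : ℕ) < n + 1 → rowComb (G⁻¹ i) F' = rowComb κ E) ∧
        (¬ (i : ℕ) < n + 1 → κ = 0) := by
      intro i
      by_cases hi : (i : ℕ) < n + 1
      · obtain ⟨κ, hκ⟩ := (mem_iff_rowComb hE).1 (hrow i hi)
        exact ⟨κ, fun _ => hκ, fun h => (h hi).elim⟩
      · exact ⟨0, fun h => (hi h).elim, fun _ => rfl⟩
    choose K hK1 hK2 using hK
    let f' : Fin r × Fin (N + 1) → k := fun ij =>
      if (ij.1 : ℕ) < n + 1 then 0 else rowComb (G⁻¹ ij.1) F' ij.2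
    have hsum : (grRows k N r).act G⁻¹ F' = (grRows k N r).act (Matrix.of K) E + f' := by
      funext ⟨i, j⟩
      rw [Pi.add_apply, actOn_grRows, actOn_grRows]
      by_cases hi : (i : ℕ) < n + 1
      · rw [hK1 i hi, show f' (i, j) = 0 from if_pos hi, add_zero]
        rfl
      · have : rowComb (Matrix.of K i) E j = 0 := by
          rw [show Matrix.of K i = 0 from hK2 i hi]; simp [rowComb]
        rw [this, show f' (i, j) = rowComb (G⁻¹ i) F' j from if_neg hi, zero_add]
    have hF'' : F' = (grRows k N r).act (G * Matrix.of K) E + (grRows k N r).act G f' := by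
      rw [← Rows.act_act, ← Rows.act_add, ← hsum, Rows.act_act, Matrix.mul_nonsing_inv _ hGu,
        Rows.act_one]
    refine ⟨Sum.elim (fun il => G il.1 il.2) f, Sum.elim (fun il => (G * Matrix.of K) il.1 il.2) f',
      ?_, ?_⟩
    · rw [LocalFamily.pt_eq]
      change (fun i => eval _ (Θ i)) = v
      rw [hΘk]
      change Sum.elim ((grRows k N r).act G _) _ = v
      rw [← hEdef, ← hG, Sum.elim_comp_inl_inr]
    · rw [← LocalFamily.dual_sumElim]
      change (fun i => aeval _ (Θ i)) = _
      rw [hΘ]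
      have hEd : extendRows (fun i a => aeval (dual (v ∘ Sum.inr) 0) (φ i a)) (dual f f') =
          dual E f' := by
        funext ⟨i, j⟩
        by_cases hi : (i : ℕ) < n + 1
        · rw [extendRows_of_lt hi]
          ext
          · rw [LocalFamily.fst_aeval_dual, fst_dual, hEdef, extendRows_of_lt hi,
              MvPolynomial.aeval_eq_eval]
          · rw [aeval_dual, snd_dual, show f' (i, j) = 0 from if_pos hi]
            simp
        · rw [extendRows_of_not_lt hi]
          simp only [dual]
          rw [hEdef, extendRows_of_not_lt hi]
      rw [hEd]
      funext i
      rcases i with ⟨i, j⟩ | j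
      · have e1 : v (Sum.inl (i, j)) = ∑ l, G i l * E (l, j) := by
          have := congrFun hG (i, j)
          rw [actOn_grRows] at this
          exact this
        have e2 : F' (i, j) = ∑ l, (G * Matrix.of K) i l * E (l, j) + ∑ l, G i l * f' (l, j) := by
          have := congrFun hF'' (i, j)
          rw [Pi.add_apply, actOn_grRows, actOn_grRows] at this
          exact this
        ext
        · simp [dual, TrivSqZeroExt.fst_sum, e1]
        · simp [dual, TrivSqZeroExt.snd_sum, e2, Finset.sum_add_distrib, add_comm, mul_comm]
      · rfl

end Incidence

/-! ### Tangent vectors of the incidence variety -/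

section IncidenceTangent

variable {k : Type*} [Field k] [IsAlgClosed k] {N r n : ℕ} {X : Set (PN k N)}

theorem isPreirreducible_incFamily (hnr : n + 1 ≤ r) (hX : IsVariety X)
    (hd : zdim X = (n : WithBot ℕ∞)) :
    @IsPreirreducible _ (zariski (Gr k N r × PN k N)) (incFamily X r) := by
  have := IsAlgClosed.instInfinite (K := k)
  refine LocalFamily.isPreirreducible (coord := Sum.inr) (incRows k N r) (pnRows k N)
    (isIrreducible_of_eventually hX smoothLocus_subset (eventually_mem_smoothLocus hX))
    Prod.snd (fun b hb => hb.1) (fun b v hv => hv.2) (fun b u hu => ?_) fun b hb v hv => ?_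
  · obtain ⟨v, hv⟩ := coords_nonempty b.1
    exact ⟨Sum.elim v u, ⟨hv, hu⟩, rfl⟩
  · obtain ⟨T, hT, hcov, -⟩ := exists_localFamily_incFamily (r := r) hnr hd hb.1 hv.2
    exact ⟨T, hT, hcov⟩

theorem image_snd_incFamily (hnr : n + 1 ≤ r) (hrN : r ≤ N + 1) (hd : zdim X = (n : WithBot ℕ∞)) :
    Prod.snd '' incFamily X r = smoothLocus X := by
  have := IsAlgClosed.instInfinite (K := k)
  ext x
  constructor
  · rintro ⟨z, hz, rfl⟩
    exact hz.1
  · intro hx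
    obtain ⟨v, hv⟩ := coords_nonempty x
    have h1 := (mem_smoothLocus_iff hd hv).1 hx
    rw [coneTangent_eq_embTangent h1.1 hv] at h1
    obtain ⟨C, hC⟩ := Submodule.exists_isCompl (embTangent X x)
    have h2 := Submodule.finrank_add_eq_of_isCompl hC
    rw [h1.2, Module.finrank_fintype_fun_eq_card, Fintype.card_fin] at h2
    obtain ⟨f, hf⟩ := exists_linearIndependent_of_le_finrank (R := k) (M := C) (n := r - (n + 1))
      (by omega)
    let D : Submodule k (V k N) := (Submodule.span k (Set.range f)).map C.subtype
    have hDC : D ≤ C := Submodule.map_subtype_le _ _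
    have hD : Module.finrank k D = r - (n + 1) := by
      rw [Submodule.finrank_map_subtype_eq, finrank_span_eq_card hf, Fintype.card_fin]
    have hinf : embTangent X x ⊓ D = ⊥ :=
      eq_bot_iff.2 ((inf_le_inf_left _ hDC).trans hC.inf_eq_bot.le)
    have hsup := Submodule.finrank_sup_add_finrank_inf_eq (embTangent X x) D
    rw [hinf, finrank_bot, h1.2, hD] at hsup
    exact ⟨(⟨embTangent X x ⊔ D, by omega⟩, x), ⟨hx, le_sup_left⟩, rfl⟩

theorem incFamily_nonempty (hnr : n + 1 ≤ r) (hrN : r ≤ N + 1) (hX : IsVariety X)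
    (hd : zdim X = (n : WithBot ℕ∞)) : (incFamily X r).Nonempty := by
  have hne := generic_neBot hX.2.1
  obtain ⟨x, hx⟩ := (eventually_mem_smoothLocus hX).exists
  rw [← image_snd_incFamily hnr hrN hd] at hx
  obtain ⟨z, hz, -⟩ := hx
  exact ⟨z, hz⟩

theorem isVariety_incidence (hnr : n + 1 ≤ r) (hrN : r ≤ N + 1) (hX : IsVariety X)
    (hd : zdim X = (n : WithBot ℕ∞)) : IsVariety (zclosure (incFamily X r)) :=
  isVariety_zclosure (isPreirreducible_incFamily hnr hX hd) (incFamily_nonempty hnr hrN hX hd)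

theorem vanishing_zclosure_incFamily :
    vanishing (zclosure (incFamily X r)) = vanishing (incFamily X r) :=
  (incRows k N r).vanishing_zclosure _

theorem imageVariety_snd_incidence (hnr : n + 1 ≤ r) (hrN : r ≤ N + 1) (hX : IsVariety X)
    (hd : zdim X = (n : WithBot ℕ∞)) :
    imageVariety Prod.snd (zclosure (incFamily X r)) = X := by
  rw [imageVariety_zclosure isPolyMap_snd, image_snd_incFamily hnr hrN hd]
  exact zclosure_eq_of_eventually hX smoothLocus_subset (eventually_mem_smoothLocus hX)

/-- The differential of the projection of the incidence variety to `X` is surjective. -/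
theorem exists_mem_coneTangent_incidence (hnr : n + 1 ≤ r) (hX : IsVariety X)
    (hd : zdim X = (n : WithBot ℕ∞)) {z : Gr k N r × PN k N} (hz : z ∈ incFamily X r)
    {v : (Fin r × Fin (N + 1)) ⊕ Fin (N + 1) → k} (hv : v ∈ coords z) {w : V k N}
    (hw : w ∈ coneTangent X (v ∘ Sum.inr)) :
    ∃ w' ∈ coneTangent (zclosure (incFamily X r)) v, w' ∘ Sum.inr = w := by
  have := IsAlgClosed.instInfinite (K := k)
  obtain ⟨T, hT, hcov, -⟩ := exists_localFamily_incFamily (r := r) hnr hd hz.1 hv.2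
  obtain ⟨s, hs⟩ := hcov z hz v hv hT
  rw [coneTangent_congr vanishing_zclosure_incFamily]
  rw [← coneTangent_congr (vanishing_smoothLocus hX)] at hw
  have h1 := T.exists_mem_coneTangent (incRows k N r)
    (by rw [hs]; exact hv) hT (isPt_of_mem hz.1 hv.2) hw
  rwa [hs] at h1

/-- Motions of `L` that keep the tangent space of `X` in `L` to first order are tangent to the
fibres of the projection to `X`. -/
theorem vertical_mem_coneTangent (hnr : n + 1 ≤ r) (hd : zdim X = (n : WithBot ℕ∞))
    {z : Gr k N r × PN k N} (hz : z ∈ incFamily X r)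
    {v : (Fin r × Fin (N + 1)) ⊕ Fin (N + 1) → k} (hv : v ∈ coords z)
    {F' : Fin r × Fin (N + 1) → k}
    (hF' : ∀ a, rowComb a (v ∘ Sum.inl) ∈ embTangent X z.2 → rowComb a F' ∈ z.1.1) :
    Sum.elim F' 0 ∈ coneTangent (zclosure (incFamily X r)) v := by
  have := IsAlgClosed.instInfinite (K := k)
  obtain ⟨T, hT, -, hvert⟩ := exists_localFamily_incFamily (r := r) hnr hd hz.1 hv.2
  obtain ⟨s, s', hs, hs'⟩ := hvert z hz v hv hT F' hF'
  rw [coneTangent_congr vanishing_zclosure_incFamily, ← tangentAt_eq_coneTangent]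
  have h1 := T.isPt_pt_dual (incRows k N r) (s' := s') (b := z) (by rw [hs]; exact hv) hT
    (isPt_dual.2 ⟨isPt_of_mem hz.1 hv.2, Submodule.zero_mem _⟩)
  rw [hs'] at h1
  exact (isPt_dual.1 h1).2

/-- The derivative of the polynomial `p` at `u` in the direction `w`. -/
def dirDeriv {σ : Type} [Fintype σ] (u w : σ → k) (p : MvPolynomial σ k) : k :=
  ∑ b, eval u (pderiv b p) * w b

theorem aeval_dual_eq {σ : Type} [Fintype σ] (u w : σ → k) (p : MvPolynomial σ k) :
    aeval (dual u w) p = TrivSqZeroExt.inl (eval u p) + TrivSqZeroExt.inr (dirDeriv u w p) := by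
  rw [aeval_dual]
  simp only [MvPolynomial.aeval_eq_eval, dirDeriv]

theorem isUnit_aeval_dual {σ : Type} [Fintype σ] {u w : σ → k} {p : MvPolynomial σ k}
    (h : eval u p ≠ 0) : IsUnit (aeval (dual u w) p) := by
  rw [TrivSqZeroExt.isUnit_iff_isUnit_fst, LocalFamily.fst_aeval_dual, MvPolynomial.aeval_eq_eval]
  exact isUnit_iff_ne_zero.2 h

theorem pderiv_comm {σ R : Type*} [CommRing R] (a b : σ) (p : MvPolynomial σ R) :
    pderiv a (pderiv b p) = pderiv b (pderiv a p) := by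
  classical
  have h : ⁅pderiv a, pderiv b⁆ = (0 : Derivation R (MvPolynomial σ R) (MvPolynomial σ R)) :=
    MvPolynomial.derivation_ext fun l => by
      rw [Derivation.commutator_apply, pderiv_X, pderiv_X]
      simp only [Pi.single_apply]
      split_ifs <;> simp
  have h2 := DFunLike.congr_fun h p
  rw [Derivation.commutator_apply] at h2
  exact sub_eq_zero.1 h2

/-- The second fundamental form is symmetric: the derivatives of sections of the tangent bundle
along each other agree modulo the tangent space. -/
theorem dirDeriv_sub_mem (hX : IsVariety X) (h : MvPolynomial (Fin (N + 1)) k)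
    {d : ℕ} (φ : Fin d → Fin (N + 1) → MvPolynomial (Fin (N + 1)) k)
    (hφ : ∀ x ∈ smoothLocus X, ∀ u ∈ coords x, eval u h ≠ 0 →
      Submodule.span k (Set.range fun i a => eval u (φ i a)) = coneTangent X u)
    {x : PN k N} (hx : x ∈ smoothLocus X) {u : V k N} (hu : u ∈ coords x) (hne : eval u h ≠ 0)
    (c c' : Fin d → k) :
    (fun a => ∑ i, c' i * dirDeriv u (∑ i, c i • fun a => eval u (φ i a)) (φ i a) -
      ∑ i, c i * dirDeriv u (∑ i, c' i • fun a => eval u (φ i a)) (φ i a)) ∈ coneTangent X u := by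
  intro p hp
  have hmem : ∀ c : Fin d → k, (∑ i, c i • fun a => eval u (φ i a)) ∈ coneTangent X u := by
    intro c
    rw [← hφ x hx u hu hne]
    exact Submodule.sum_mem _ fun i _ => Submodule.smul_mem _ _ (Submodule.subset_span ⟨i, rfl⟩)
  -- differentiate the identity `dp (φ i) = 0` on `X` in the direction `w`
  have key : ∀ w ∈ coneTangent X u, ∀ i,
      ∑ a, eval u (pderiv a p) * dirDeriv u w (φ i a) =
        - ∑ a, dirDeriv u w (pderiv a p) * eval u (φ i a) := by
    intro w hw i
    have hq : h * ∑ a, pderiv a p * φ i a ∈ vanishing X := by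
      rw [← vanishing_smoothLocus hX]
      intro y hy t ht
      rw [map_mul]
      by_cases h0 : eval t h = 0
      · rw [h0, zero_mul]
      · have h1 : (fun a => eval t (φ i a)) ∈ coneTangent X t := by
          rw [← hφ y hy t ht h0]; exact Submodule.subset_span ⟨i, rfl⟩
        have h2 := h1 p hp
        rw [map_sum]
        simp only [map_mul]
        rw [h2, mul_zero]
    have h3 := (isPt_dual.2 ⟨isPt_of_mem hx.1 hu, by rwa [tangentAt_eq_coneTangent]⟩ :
      IsPt X (dual u w)) _ hq
    rw [map_mul, (isUnit_aeval_dual hne).mul_right_eq_zero, map_sum] at h3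
    have h4 := congrArg TrivSqZeroExt.snd h3
    rw [TrivSqZeroExt.snd_sum] at h4
    simp only [map_mul, aeval_dual_eq, TrivSqZeroExt.snd_mul, TrivSqZeroExt.fst_add,
      TrivSqZeroExt.fst_inl, TrivSqZeroExt.fst_inr, add_zero, TrivSqZeroExt.snd_add,
      TrivSqZeroExt.snd_inl, TrivSqZeroExt.snd_inr, zero_add, TrivSqZeroExt.snd_zero,
      smul_eq_mul, MulOpposite.smul_eq_mul_unop, MulOpposite.unop_op,
      Finset.sum_add_distrib] at h4
    exact eq_neg_of_add_eq_zero_left h4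
  have key2 : ∀ c c' : Fin d → k,
      ∑ a, eval u (pderiv a p) *
          ∑ i, c' i * dirDeriv u (∑ i, c i • fun a => eval u (φ i a)) (φ i a) =
        - ∑ a, ∑ b, eval u (pderiv b (pderiv a p)) * (∑ i, c i * eval u (φ i b)) *
          ∑ i, c' i * eval u (φ i a) := by
    intro c c'
    have h1 : ∀ i, c' i * ∑ a, eval u (pderiv a p) *
        dirDeriv u (∑ i, c i • fun a => eval u (φ i a)) (φ i a) =
        c' i * - ∑ a, dirDeriv u (∑ i, c i • fun a => eval u (φ i a)) (pderiv a p) *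
          eval u (φ i a) := fun i => by rw [key _ (hmem c) i]
    have h2 := Finset.sum_congr rfl fun i (_ : i ∈ Finset.univ) => h1 i
    calc _ = ∑ i, c' i * ∑ a, eval u (pderiv a p) *
        dirDeriv u (∑ i, c i • fun a => eval u (φ i a)) (φ i a) := by
          simp only [Finset.mul_sum]
          rw [Finset.sum_comm]
          exact Finset.sum_congr rfl fun i _ => Finset.sum_congr rfl fun a _ => by ring
      _ = _ := h2
      _ = - ∑ a, dirDeriv u (∑ i, c i • fun a => eval u (φ i a)) (pderiv a p) *
          ∑ i, c' i * eval u (φ i a) := by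
          simp only [mul_neg, Finset.sum_neg_distrib, Finset.mul_sum]
          rw [Finset.sum_comm]
          congr 1
          exact Finset.sum_congr rfl fun i _ => Finset.sum_congr rfl fun a _ => by ring
      _ = _ := by
          congr 1
          refine Finset.sum_congr rfl fun a _ => ?_
          rw [dirDeriv, Finset.sum_mul]
          refine Finset.sum_congr rfl fun b _ => ?_
          simp
  -- second partial derivatives commute
  have hsymm : ∑ a, ∑ b, eval u (pderiv b (pderiv a p)) * (∑ i, c i * eval u (φ i b)) *
      ∑ i, c' i * eval u (φ i a) = ∑ a, ∑ b, eval u (pderiv b (pderiv a p)) *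
        (∑ i, c' i * eval u (φ i b)) * ∑ i, c i * eval u (φ i a) := by
    rw [Finset.sum_comm]
    refine Finset.sum_congr rfl fun a _ => Finset.sum_congr rfl fun b _ => ?_
    rw [pderiv_comm]
    ring
  simp only [mul_sub, Finset.sum_sub_distrib]
  rw [key2 c c', key2 c' c, hsymm, sub_self]

end IncidenceTangent

/-! ### First order motions in the incidence variety -/

section UniversalTangent

variable {k : Type*} [Field k] {N r : ℕ}

/-- First order motions in the universal family: if `v` stays in `L`, then its velocity is
determined modulo `L` by the velocity of `L`. -/
theorem exists_rowComb_of_isPt {B : Set (Gr k N r × PN k N)}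
    (hB : ∀ z ∈ B, z.2.submodule ≤ z.1.1) {L : Gr k N r} {F F' : Fin r × Fin (N + 1) → k}
    (hF : F ∈ coords L) {v w : V k N} (h : IsPt B (dual (Sum.elim F v) (Sum.elim F' w))) :
    ∃ a, v = rowComb a F ∧ w - rowComb a F' ∈ L.1 := by
  obtain ⟨J, hJ⟩ := exists_cols hF
  let XF : Fin r × Fin (N + 1) → MvPolynomial ((Fin r × Fin (N + 1)) ⊕ Fin (N + 1)) k :=
    fun a => X (Sum.inl a)
  let Xv : Fin (N + 1) → MvPolynomial ((Fin r × Fin (N + 1)) ⊕ Fin (N + 1)) k :=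
    fun a => X (Sum.inr a)
  have hq : ∀ {A : Type _} [CommRing A] [Algebra k A] (F : Fin r × Fin (N + 1) → A)
      (v : Fin (N + 1) → A) (j), aeval (Sum.elim F v) (defect J XF Xv j) = defect J F v j := by
    intro A _ _ F v j
    have := defect_map (aeval (Sum.elim F v) : _ →ₐ[k] A).toRingHom J XF Xv j
    refine this.symm.trans ?_
    simp [XF, Xv]
  have h0 : defect J (dual F F') (dual v w) = 0 := by
    funext j
    rw [← hq, LocalFamily.dual_sumElim]
    refine h _ fun z hz u hu => ?_
    rw [← Sum.elim_comp_inl_inr u, ← MvPolynomial.aeval_eq_eval, hq]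
    exact congrFun (defect_eq_zero hu.1 J ((submodule_le_iff hu.2 _).1 (hB z hz))) j
  obtain ⟨b, b', h1, h2⟩ := exists_of_defect_dual hJ h0
  refine ⟨b, h1, ?_⟩
  rw [h2, add_sub_cancel_left]
  exact rowComb_mem hF b'

end UniversalTangent

section IncidenceTangent

variable {k : Type*} [Field k] [IsAlgClosed k] {N r n : ℕ} {X : Set (PN k N)}

/-- The condition that the tangent space of `X` stays in `L`, to first order. -/
theorem exists_rowComb_frame (h : MvPolynomial (Fin (N + 1)) k)
    {d : ℕ} (φ : Fin d → Fin (N + 1) → MvPolynomial (Fin (N + 1)) k)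
    (hφ : ∀ x ∈ smoothLocus X, ∀ u ∈ coords x, eval u h ≠ 0 →
      Submodule.span k (Set.range fun i a => eval u (φ i a)) = coneTangent X u)
    {L : Gr k N r} {F F' : Fin r × Fin (N + 1) → k} (hF : F ∈ coords L) {u w : V k N}
    (hne : eval u h ≠ 0)
    (hpt : IsPt (incFamily X r) (dual (Sum.elim F u) (Sum.elim F' w))) (i : Fin d) :
    ∃ b, (fun a => eval u (φ i a)) = rowComb b F ∧
      (fun a => dirDeriv u w (φ i a)) - rowComb b F' ∈ L.1 := by
  have := IsAlgClosed.instInfinite (K := k)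
  obtain ⟨J, hJ⟩ := exists_cols hF
  let XF : Fin r × Fin (N + 1) → MvPolynomial ((Fin r × Fin (N + 1)) ⊕ Fin (N + 1)) k :=
    fun a => MvPolynomial.X (Sum.inl a)
  let q := fun j => rename Sum.inr h * defect J XF (fun a => rename Sum.inr (φ i a)) j
  have hq : ∀ {A : Type _} [CommRing A] [Algebra k A] (F : Fin r × Fin (N + 1) → A)
      (u : Fin (N + 1) → A) (j), aeval (Sum.elim F u) (q j) =
        aeval u h * defect J F (fun a => aeval u (φ i a)) j := by
    intro A _ _ F u j
    have := defect_map (aeval (Sum.elim F u) : _ →ₐ[k] A).toRingHom J XF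
      (fun a => rename Sum.inr (φ i a)) j
    simp only [q, map_mul, aeval_rename, Sum.elim_comp_inr]
    congr 1
    refine this.symm.trans ?_
    simp [XF, aeval_rename]
  have h0 : defect J (dual F F') (fun a => aeval (dual u w) (φ i a)) = 0 := by
    funext j
    have h1 : aeval (Sum.elim (dual F F') (dual u w)) (q j) = 0 := by
      rw [LocalFamily.dual_sumElim]
      refine hpt _ fun z hz t ht => ?_
      rw [← Sum.elim_comp_inl_inr t, ← MvPolynomial.aeval_eq_eval, hq]
      by_cases h2 : eval (t ∘ Sum.inr) h = 0
      · rw [MvPolynomial.aeval_eq_eval, h2, zero_mul]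
      · rw [defect_eq_zero ht.1 J, Pi.zero_apply, mul_zero]
        refine hz.2 ?_
        rw [← coneTangent_eq_embTangent hz.1.1 ht.2, ← hφ _ hz.1 _ ht.2 h2]
        simp only [MvPolynomial.aeval_eq_eval]
        exact Submodule.subset_span ⟨i, rfl⟩
    rw [hq] at h1
    exact ((isUnit_aeval_dual hne).mul_right_eq_zero).1 h1
  have h1 : (fun a => aeval (dual u w) (φ i a)) =
      dual (fun a => eval u (φ i a)) (fun a => dirDeriv u w (φ i a)) := by
    funext a
    rw [aeval_dual_eq]; rfl
  rw [h1] at h0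
  obtain ⟨b, b', h2, h3⟩ := exists_of_defect_dual hJ h0
  refine ⟨b, h2, ?_⟩
  rw [h3, add_sub_cancel_left]
  exact rowComb_mem hF b'

/-- If the tangent space of `X` stays in `L` to first order, then the derivative of a vector field
tangent to `X` is given, modulo `L`, by the motion of `L`. -/
theorem sub_rowComb_mem (h : MvPolynomial (Fin (N + 1)) k)
    {d : ℕ} (φ : Fin d → Fin (N + 1) → MvPolynomial (Fin (N + 1)) k)
    (hφ : ∀ x ∈ smoothLocus X, ∀ u ∈ coords x, eval u h ≠ 0 →
      Submodule.span k (Set.range fun i a => eval u (φ i a)) = coneTangent X u)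
    {L : Gr k N r} {F F' : Fin r × Fin (N + 1) → k} (hF : F ∈ coords L) {u w : V k N}
    (hne : eval u h ≠ 0)
    (hpt : IsPt (incFamily X r) (dual (Sum.elim F u) (Sum.elim F' w))) (c : Fin d → k)
    (a : Fin r → k) (hca : (∑ i, c i • fun a => eval u (φ i a)) = rowComb a F) :
    (fun a => ∑ i, c i * dirDeriv u w (φ i a)) - rowComb a F' ∈ L.1 := by
  choose b hb hb' using fun i => exists_rowComb_frame h φ hφ hF hne hpt i
  have hlin : ∀ F : Fin r × Fin (N + 1) → k, rowComb (∑ i, c i • b i) F =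
      ∑ i, c i • rowComb (b i) F := fun F =>
    (map_sum (rowCombL F) _ _).trans (Finset.sum_congr rfl fun i _ => map_smul (rowCombL F) _ _)
  have h1 : a = ∑ i, c i • b i := by
    apply rowComb_injective hF
    beta_reduce
    rw [← hca, hlin]
    exact Finset.sum_congr rfl fun i _ => by rw [hb i]
  have h2 : (fun a => ∑ i, c i * dirDeriv u w (φ i a)) - rowComb a F' =
      ∑ i, c i • ((fun a => dirDeriv u w (φ i a)) - rowComb (b i) F') := by
    rw [h1, hlin]
    funext j
    simp [mul_sub, Finset.sum_sub_distrib]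
  rw [h2]
  exact Submodule.sum_mem _ fun i _ => Submodule.smul_mem _ _ (hb' i)

theorem isPt_incFamily {v w : (Fin r × Fin (N + 1)) ⊕ Fin (N + 1) → k}
    {z : Gr k N r × PN k N} (hz : z ∈ zclosure (incFamily X r)) (hv : v ∈ coords z)
    (hw : w ∈ coneTangent (zclosure (incFamily X r)) v) :
    IsPt (incFamily X r) (dual (Sum.elim (v ∘ Sum.inl) (v ∘ Sum.inr))
      (Sum.elim (w ∘ Sum.inl) (w ∘ Sum.inr))) := by
  rw [Sum.elim_comp_inl_inr, Sum.elim_comp_inl_inr, ← (incRows k N r).isPt_zclosure, isPt_dual,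
    tangentAt_eq_coneTangent]
  exact ⟨isPt_of_mem hz hv, hw⟩

/-- The set of `(L, x)` with `𝕋_x X ⊆ L` is closed over the smooth locus of `X`. -/
theorem mem_incFamily_of_mem (hd : zdim X = (n : WithBot ℕ∞)) {z : Gr k N r × PN k N}
    (hz : z ∈ zclosure (incFamily X r)) (hz' : z.2 ∈ smoothLocus X) : z ∈ incFamily X r := by
  have := IsAlgClosed.instInfinite (K := k)
  refine ⟨hz', ?_⟩
  obtain ⟨v, hv⟩ := coords_nonempty z
  obtain ⟨h, φ, h0, hφ⟩ := exists_smoothFrame hd hz' hv.2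
  rw [← coneTangent_eq_embTangent hz'.1 hv.2, ← (hφ _ hz' _ hv.2 h0).2, Submodule.span_le]
  rintro _ ⟨i, rfl⟩
  obtain ⟨b, hb, -⟩ := exists_rowComb_frame h φ (fun x hx u hu hne => (hφ x hx u hu hne).2) hv.1 h0
    (isPt_incFamily hz hv (Submodule.zero_mem _)) i
  beta_reduce
  rw [hb]
  exact rowComb_mem hv.1 b

/-- Along the fibres of the projection to `X`, the tangent space of `X` stays in `L` to first
order. -/
theorem mem_of_vertical (hd : zdim X = (n : WithBot ℕ∞)) {z : Gr k N r × PN k N}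
    (hz : z ∈ incFamily X r) {v w : (Fin r × Fin (N + 1)) ⊕ Fin (N + 1) → k} (hv : v ∈ coords z)
    (hw : w ∈ coneTangent (zclosure (incFamily X r)) v) (hw0 : w ∘ Sum.inr = 0) (a : Fin r → k)
    (ha : rowComb a (v ∘ Sum.inl) ∈ embTangent X z.2) : rowComb a (w ∘ Sum.inl) ∈ z.1.1 := by
  have := IsAlgClosed.instInfinite (K := k)
  obtain ⟨h, φ, h0, hφ⟩ := exists_smoothFrame hd hz.1 hv.2
  rw [← coneTangent_eq_embTangent hz.1.1 hv.2, ← (hφ _ hz.1 _ hv.2 h0).2,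
    Submodule.mem_span_range_iff_exists_fun] at ha
  obtain ⟨c, hc⟩ := ha
  have h1 := sub_rowComb_mem h φ (fun x hx u hu hne => (hφ x hx u hu hne).2) hv.1 h0
    (isPt_incFamily (subset_zclosure _ hz) hv hw) c a hc
  have h2 : (fun a => ∑ i, c i * dirDeriv (v ∘ Sum.inr) (w ∘ Sum.inr) (φ i a)) = 0 := by
    rw [hw0]
    funext j
    simp [dirDeriv]
  rw [h2, zero_sub] at h1
  exact (Submodule.neg_mem_iff _).1 h1

/-- The symmetry of the second fundamental form of `X`, for tangent vectors of the incidence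
variety. -/
theorem rowComb_sub_mem (hX : IsVariety X) (hd : zdim X = (n : WithBot ℕ∞))
    {z : Gr k N r × PN k N} (hz : z ∈ incFamily X r)
    {v w w' : (Fin r × Fin (N + 1)) ⊕ Fin (N + 1) → k} (hv : v ∈ coords z)
    (hw : w ∈ coneTangent (zclosure (incFamily X r)) v)
    (hw' : w' ∈ coneTangent (zclosure (incFamily X r)) v)
    (ht : w ∘ Sum.inr ∈ embTangent X z.2) (ht' : w' ∘ Sum.inr ∈ embTangent X z.2)
    {a a' : Fin r → k} (ha : w ∘ Sum.inr = rowComb a (v ∘ Sum.inl))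
    (ha' : w' ∘ Sum.inr = rowComb a' (v ∘ Sum.inl)) :
    rowComb a' (w ∘ Sum.inl) - rowComb a (w' ∘ Sum.inl) ∈ z.1.1 := by
  have := IsAlgClosed.instInfinite (K := k)
  obtain ⟨h, φ, h0, hφ⟩ := exists_smoothFrame hd hz.1 hv.2
  have hφ' := fun x hx u hu hne => (hφ x hx u hu hne).2
  rw [← coneTangent_eq_embTangent hz.1.1 hv.2, ← (hφ _ hz.1 _ hv.2 h0).2,
    Submodule.mem_span_range_iff_exists_fun] at ht ht'
  obtain ⟨c, hc⟩ := ht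
  obtain ⟨c', hc'⟩ := ht'
  have hz' := subset_zclosure _ hz
  have h1 := sub_rowComb_mem h φ hφ' hv.1 h0 (isPt_incFamily hz' hv hw) c' a' (hc'.trans ha')
  have h2 := sub_rowComb_mem h φ hφ' hv.1 h0 (isPt_incFamily hz' hv hw') c a (hc.trans ha)
  have h3 := dirDeriv_sub_mem hX h φ hφ' hz.1 hv.2 h0 c c'
  rw [hc, hc', coneTangent_eq_embTangent hz.1.1 hv.2] at h3
  have h4 := hz.2 h3
  have h5 := Submodule.sub_mem _ (Submodule.sub_mem _ h4 h1) (Submodule.neg_mem _ h2)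
  convert! h5 using 1
  funext j
  simp only [Pi.sub_apply, Pi.neg_apply]
  ring

theorem submodule_le_of_mem_incFamily {z : Gr k N r × PN k N} (hz : z ∈ incFamily X r) :
    z.2.submodule ≤ z.1.1 := by
  have := IsAlgClosed.instInfinite (K := k)
  obtain ⟨v, hv⟩ := coords_nonempty z.2
  rw [submodule_le_iff hv]
  refine hz.2 ?_
  rw [← coneTangent_eq_embTangent hz.1.1 hv]
  exact self_mem_coneTangent hz.1.1 hv

/-- The motions of `L` that keep the subspace `T` in `L` to first order. -/
theorem finrank_keep {L : Gr k N r} {F : Fin r × Fin (N + 1) → k} (hF : F ∈ coords L)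
    {T : Submodule k (V k N)} (hT : T ≤ L.1) (W : Submodule k (Fin r × Fin (N + 1) → k))
    (hW : ∀ F', F' ∈ W ↔ ∀ a, rowComb a F ∈ T → rowComb a F' ∈ L.1) :
    Module.finrank k W + Module.finrank k T * (N + 1 - r) = r * (N + 1) := by
  let A : Submodule k (Fin r → k) := T.comap (rowCombL F)
  have hA : Module.finrank k A = Module.finrank k T := by
    have h1 : A.map (rowCombL F) = T := by
      rw [Submodule.map_comap_eq, inf_eq_right]
      intro t ht
      obtain ⟨c, hc⟩ := (mem_iff_rowComb hF).1 (hT ht)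
      exact ⟨c, hc.symm⟩
    rw [← h1]
    exact LinearEquiv.finrank_eq (Submodule.equivMapOfInjective _ (rowComb_injective hF) _)
  let toMap : (Fin r × Fin (N + 1) → k) →ₗ[k] (Fin r → k) →ₗ[k] V k N :=
    { toFun := rowCombL
      map_add' := fun F F' => LinearMap.ext fun c => rowComb_add_right c F F'
      map_smul' := fun a F => LinearMap.ext fun c => rowComb_smul_right a c F }
  -- `W` is the kernel of a surjection onto `Hom(A, V / L)`, where `A` is `T` in coordinates
  let Ψ : (Fin r × Fin (N + 1) → k) →ₗ[k] A →ₗ[k] V k N ⧸ L.1 :=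
    { toFun := fun F' => L.1.mkQ ∘ₗ toMap F' ∘ₗ A.subtype
      map_add' := fun F F' => by rw [map_add]; ext; simp
      map_smul' := fun a F => by rw [map_smul]; ext; simp }
  have hΨ : ∀ F' (a : A), Ψ F' a = L.1.mkQ (rowComb a.1 F') := fun _ _ => rfl
  have hker : LinearMap.ker Ψ = W := by
    ext F'
    rw [LinearMap.mem_ker, hW, LinearMap.ext_iff, Subtype.forall]
    refine forall₂_congr fun a ha => ?_
    rw [hΨ]
    simp
  have hsurj : LinearMap.range Ψ = ⊤ := by
    rw [LinearMap.range_eq_top]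
    intro g
    obtain ⟨g', hg'⟩ := g.exists_extend
    obtain ⟨g'', hg''⟩ := Module.projective_lifting_property L.1.mkQ g' (Submodule.mkQ_surjective _)
    refine ⟨fun ij => g'' (Pi.single ij.1 1) ij.2, LinearMap.ext fun a => ?_⟩
    rw [hΨ]
    have h1 : rowComb a.1 (fun ij : Fin r × Fin (N + 1) => g'' (Pi.single ij.1 1) ij.2) =
        g'' a.1 := by
      rw [rowComb_eq_sum]
      conv_rhs => rw [← Finset.univ_sum_single a.1, map_sum]
      refine Finset.sum_congr rfl fun i _ => ?_
      have : (Pi.single i (a.1 i) : Fin r → k) = a.1 i • Pi.single i 1 := by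
        rw [← Pi.single_smul, smul_eq_mul, mul_one]
      rw [this, map_smul]
    rw [h1]
    exact (LinearMap.congr_fun hg'' a.1).trans (LinearMap.congr_fun hg' a)
  have h := LinearMap.finrank_range_add_finrank_ker Ψ
  rw [hker, hsurj, finrank_top, Module.finrank_linearMap, hA, Module.finrank_fintype_fun_eq_card,
    Fintype.card_prod, Fintype.card_fin, Fintype.card_fin] at h
  have hq := Submodule.finrank_quotient_add_finrank L.1
  rw [L.2, Module.finrank_fintype_fun_eq_card, Fintype.card_fin] at hq
  rw [add_comm, ← h]
  congr 2
  omega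

end IncidenceTangent

/-! ### Dimension of the incidence variety -/

section Dimension

open TopologicalSpace Topology

/-- A closed subset of an irreducible space of finite dimension which has the same dimension is the
whole space. -/
theorem eq_of_subset_of_topologicalKrullDim_le {α : Type*} [TopologicalSpace α] {Z W : Set α}
    (hZ : IsClosed Z) (hW : IsIrreducible W) (h : Z ⊆ W) {d : ℕ}
    (hdZ : (d : WithBot ℕ∞) ≤ topologicalKrullDim Z)
    (hdW : topologicalKrullDim W ≤ (d : WithBot ℕ∞)) : Z = W := by
  by_contra hne
  obtain ⟨l, hl⟩ := Order.le_krullDim_iff.1 hdZ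
  have hi : IsInducing (Set.inclusion h) := (IsEmbedding.inclusion h).isInducing
  let l' := l.map _ (IrreducibleCloseds.map_strictMono_of_isInducing hi)
  have : IrreducibleSpace W := Subtype.irreducibleSpace hW
  -- a maximal chain in `Z` would be prolonged by `W`
  let t : IrreducibleCloseds W := ⟨Set.univ, IrreducibleSpace.isIrreducible_univ W, isClosed_univ⟩
  have hlt : l'.last < t := by
    refine lt_of_le_of_ne (fun x _ => trivial) fun heq => hne (h.antisymm fun x hx => ?_)
    have h1 : (l'.last : Set W) ⊆ Subtype.val ⁻¹' Z := by
      rw [LTSeries.last_map]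
      refine closure_minimal ?_ (hZ.preimage continuous_subtype_val)
      rintro _ ⟨y, -, rfl⟩
      exact y.2
    rw [heq] at h1
    exact h1 (show (⟨x, hx⟩ : W) ∈ (t : Set W) from trivial)
  have h2 := Order.le_krullDim_iff.2 ⟨l'.snoc t hlt, rfl⟩
  have h3 : (l'.snoc t hlt).length = d + 1 := by
    rw [RelSeries.snoc_length, ← hl]
    rfl
  rw [h3] at h2
  have h4 := h2.trans hdW
  norm_cast at h4
  omega

variable {k P : Type*} {ι : Type} [Field k] [IsAlgClosed k] [HomogCoords k P ι] [Fintype ι]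
  {R C : Type} [Fintype R] [DecidableEq R]

theorem eq_of_subset_of_dimN_le (ρ : Rows P R C) {Z W : Set P} (hZ : IsVariety Z)
    (hW : IsVariety W) (h : Z ⊆ W) (hd : Rows.dimN hW ≤ Rows.dimN hZ) : Z = W := by
  refine eq_of_subset_of_topologicalKrullDim_le hZ.1 hW.2 h (d := Rows.dimN hZ)
    (Rows.zdim_eq ρ hZ).ge ?_
  exact (Rows.zdim_eq ρ hW).le.trans (by exact_mod_cast hd)

end Dimension

section Incidence

variable {k : Type*} [Field k] [IsAlgClosed k] {N r n : ℕ} {X : Set (PN k N)}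

theorem eventually_mem_incFamily (hnr : n + 1 ≤ r) (hrN : r ≤ N + 1) (hX : IsVariety X)
    (hd : zdim X = (n : WithBot ℕ∞)) :
    ∀ᶠ z in generic (zclosure (incFamily X r)), z ∈ incFamily X r := by
  have h1 := (isPolyMap_snd (P := Gr k N r) (Q := PN k N)).tendsto
    (isVariety_incidence hnr hrN hX hd)
  rw [imageVariety_snd_incidence hnr hrN hX hd] at h1
  filter_upwards [eventually_mem (zclosure (incFamily X r)),
    h1.eventually (eventually_mem_smoothLocus hX)] with z hz hz'
  exact mem_incFamily_of_mem hd hz hz'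

theorem comp_inr_mem_embTangent (hnr : n + 1 ≤ r) (hrN : r ≤ N + 1) (hX : IsVariety X)
    (hd : zdim X = (n : WithBot ℕ∞)) {z : Gr k N r × PN k N} (hz : z ∈ incFamily X r)
    {v w : (Fin r × Fin (N + 1)) ⊕ Fin (N + 1) → k} (hv : v ∈ coords z)
    (hw : w ∈ coneTangent (zclosure (incFamily X r)) v) : w ∘ Sum.inr ∈ embTangent X z.2 := by
  have h1 := (Rows.sndMap (grRows k N r) (pnRows k N)).comp_mem_coneTangent
    (isPt_of_mem (subset_zclosure _ hz) hv) hw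
  rw [imageVariety_snd_incidence hnr hrN hX hd] at h1
  have := IsAlgClosed.instInfinite (K := k)
  rw [← coneTangent_eq_embTangent hz.1.1 hv.2]
  exact h1

theorem map_restr_snd_incidence (hnr : n + 1 ≤ r) (hrN : r ≤ N + 1) (hX : IsVariety X)
    (hd : zdim X = (n : WithBot ℕ∞)) {z : Gr k N r × PN k N} (hz : z ∈ incFamily X r)
    {v : (Fin r × Fin (N + 1)) ⊕ Fin (N + 1) → k} (hv : v ∈ coords z) :
    (coneTangent (zclosure (incFamily X r)) v).map
      ((Rows.sndMap (grRows k N r) (pnRows k N)).restr k) = coneTangent X (v ∘ Sum.inr) := by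
  have := IsAlgClosed.instInfinite (K := k)
  refine le_antisymm ?_ fun w hw => ?_
  · rintro _ ⟨w, hw, rfl⟩
    rw [coneTangent_eq_embTangent hz.1.1 hv.2]
    exact comp_inr_mem_embTangent hnr hrN hX hd hz hv hw
  · obtain ⟨w', hw', rfl⟩ := exists_mem_coneTangent_incidence hnr hX hd hz hv hw
    exact ⟨w', hw', rfl⟩

theorem isSeparableMorphism_snd_incidence (hnr : n + 1 ≤ r) (hrN : r ≤ N + 1) (hX : IsVariety X)
    (hd : zdim X = (n : WithBot ℕ∞)) :
    IsSeparableMorphism Prod.snd (zclosure (incFamily X r)) := by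
  rw [(Rows.sndMap (grRows k N r) (pnRows k N)).isSeparableMorphism_iff
    (isVariety_incidence hnr hrN hX hd)]
  filter_upwards [eventually_mem_incFamily hnr hrN hX hd] with z hz v hv
  rw [imageVariety_snd_incidence hnr hrN hX hd]
  exact map_restr_snd_incidence hnr hrN hX hd hz hv

/-- The incidence variety is fibred over `X` in the Grassmannians of the linear spaces that contain
`𝕋_x X`, of dimension `(r - (n + 1)) * (N + 1 - r)`. -/
theorem dimN_incidence (hnr : n + 1 ≤ r) (hrN : r ≤ N + 1) (hX : IsVariety X)
    (hd : zdim X = (n : WithBot ℕ∞)) :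
    Rows.dimN (isVariety_incidence hnr hrN hX hd) = n + (r - (n + 1)) * (N + 1 - r) := by
  have := IsAlgClosed.instInfinite (K := k)
  have hP := isVariety_incidence hnr hrN hX hd
  have hne := generic_neBot hP.2.1
  obtain ⟨z, hz, hdim⟩ := ((eventually_mem_incFamily hnr hrN hX hd).and
    (Rows.eventually_finrank_coneTangent (incRows k N r) hP)).exists
  obtain ⟨v, hv⟩ := coords_nonempty z
  have h1 := hdim v hv
  have h2 := (Rows.sndMap (grRows k N r) (pnRows k N)).finrank_map_restr_add
    (zclosure (incFamily X r)) v
  have h3 := ((mem_smoothLocus_iff hd hv.2).1 hz.1).2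
  rw [map_restr_snd_incidence hnr hrN hX hd hz hv, h3, h1, card_entries_incRows] at h2
  let G := (incRows k N r).tanRel (Set.range (Rows.sndMap (grRows k N r) (pnRows k N)).row)
    (zclosure (incFamily X r)) v
  have hG : ∀ {w}, w ∈ G ↔ w ∈ coneTangent (zclosure (incFamily X r)) v ∧ w ∘ Sum.inr = 0 :=
    Rows.mem_tanRel_snd_iff _ _
  let f := (LinearMap.funLeft k k Sum.inl : _ →ₗ[k] (Fin r × Fin (N + 1) → k)).domRestrict G
  have hf : Function.Injective f := by
    intro w w' hww
    apply Subtype.ext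
    rw [← Sum.elim_comp_inl_inr w.1, ← Sum.elim_comp_inl_inr w'.1, (hG.1 w.2).2, (hG.1 w'.2).2]
    congr 1
  have h4 := finrank_keep hv.1 hz.2 (LinearMap.range f) fun F' => by
    constructor
    · rintro ⟨w, rfl⟩ a ha
      exact mem_of_vertical hd hz hv (hG.1 w.2).1 (hG.1 w.2).2 a ha
    · intro h
      exact ⟨⟨Sum.elim F' 0, hG.2 ⟨vertical_mem_coneTangent hnr hd hz hv h, rfl⟩⟩, rfl⟩
  rw [LinearMap.finrank_range_of_inj hf, ← coneTangent_eq_embTangent hz.1.1 hv.2, h3] at h4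
  change n + 1 + Module.finrank k G = _ at h2
  obtain ⟨a, rfl⟩ := Nat.exists_eq_add_of_le hnr
  obtain ⟨b, hb⟩ := Nat.exists_eq_add_of_le hrN
  change Rows.dimN hP = _
  generalize Module.finrank k G = g at h2 h4
  generalize Rows.dimN hP = D at h2 ⊢
  rw [hb] at h4 ⊢
  simp only [Nat.add_sub_cancel_left] at h4 ⊢
  have h5 : D + ((n + 1 + a) * (n + 1 + a) + 1) + (n + 1) * b =
      n + 1 + (n + 1 + a) * (n + 1 + a + b) := by
    rw [← h2, add_assoc, h4]
  have h6 : D + ((n + 1 + a) * (n + 1 + a) + 1 + (n + 1) * b) =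
      n + a * b + ((n + 1 + a) * (n + 1 + a) + 1 + (n + 1) * b) := by
    rw [← add_assoc, h5]
    ring
  exact Nat.add_right_cancel h6

end Incidence

section Duality

variable {k : Type*} [Field k] [IsAlgClosed k] {N r n : ℕ} {X : Set (PN k N)}
  {Y : Set (Gr k N r)}

theorem comp_inl_mem_coneTangent {Z : Set (Gr k N r × PN k N)} (hZ : imageVariety Prod.fst Z = Y)
    {z : Gr k N r × PN k N} (hz : z ∈ Z) {v w : (Fin r × Fin (N + 1)) ⊕ Fin (N + 1) → k}
    (hv : v ∈ coords z) (hw : w ∈ coneTangent Z v) :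
    w ∘ Sum.inl ∈ coneTangent Y (v ∘ Sum.inl) := by
  have h1 := (Rows.fstMap (grRows k N r) (pnRows k N)).comp_mem_coneTangent (isPt_of_mem hz hv) hw
  rw [hZ] at h1
  exact h1

/-- If every motion of `L` in `Y` lifts to the incidence variety, then the point of contact stays
in `L` to first order, since its velocity is in the tangent space of `X`. -/
theorem mem_shrinkFamily_of_map_restr (hnr : n + 1 ≤ r) (hrN : r ≤ N + 1) (hX : IsVariety X)
    (hd : zdim X = (n : WithBot ℕ∞)) {z : Gr k N r × PN k N} (hz : z ∈ incFamily X r)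
    (hzY : z.1 ∈ shrinkDomain Y) {v : (Fin r × Fin (N + 1)) ⊕ Fin (N + 1) → k} (hv : v ∈ coords z)
    (hlift : coneTangent Y (v ∘ Sum.inl) ≤ (coneTangent (zclosure (incFamily X r)) v).map
      ((Rows.fstMap (grRows k N r) (pnRows k N)).restr k)) : z ∈ shrinkFamily Y := by
  have := IsAlgClosed.instInfinite (K := k)
  refine ⟨hzY, (submodule_le_iff hv.2 _).2 ?_⟩
  obtain ⟨a, ha⟩ := (mem_iff_rowComb hv.1).1
    ((submodule_le_iff hv.2 _).1 (submodule_le_of_mem_incFamily hz))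
  rw [ha, mem_kerPhi_iff (shrinkDomain_subset hzY) hv.1]
  intro F' hF'
  obtain ⟨w, hw, rfl⟩ := hlift hF'
  obtain ⟨a', ha', h1⟩ := exists_rowComb_of_isPt (fun z hz => submodule_le_of_mem_incFamily hz) hv.1
    (isPt_incFamily (subset_zclosure _ hz) hv hw)
  obtain rfl : a = a' := rowComb_injective hv.1 (ha.symm.trans ha')
  exact (Submodule.sub_mem_iff_right _
    (hz.2 (comp_inr_mem_embTangent hnr hrN hX hd hz hv hw))).1 h1

/-- The kernel of `Φ` is contained in the tangent space of `X`: there are enough motions of `L` with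
fixed point of contact. -/
theorem kerPhi_le_embTangent (hnr : n + 1 ≤ r) (hrN : r < N + 1)
    (hd : zdim X = (n : WithBot ℕ∞)) (hYP : imageVariety Prod.fst (zclosure (incFamily X r)) = Y)
    {z : Gr k N r × PN k N} (hz : z ∈ incFamily X r) (hzY : z.1 ∈ Y) :
    kerPhi Y z.1 ≤ embTangent X z.2 := by
  have := IsAlgClosed.instInfinite (K := k)
  intro w hw
  obtain ⟨v, hv⟩ := coords_nonempty z
  obtain ⟨b, rfl⟩ := (mem_iff_rowComb hv.1).1 (kerPhi_le _ _ hw)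
  by_contra hb
  -- a motion of rank one of `L` that fixes the tangent space of `X` and moves `w` out of `L`
  obtain ⟨l, hlb, hl⟩ := Submodule.exists_le_ker_of_notMem
    (p := (embTangent X z.2).comap (rowCombL (v ∘ Sum.inl))) (v := b) hb
  obtain ⟨y, hy⟩ : ∃ y, y ∉ z.1.1 := by
    by_contra! hcon
    have h1 := z.1.2
    rw [(Submodule.eq_top_iff').2 hcon, finrank_top, Module.finrank_fintype_fun_eq_card,
      Fintype.card_fin] at h1
    omega
  have hF' : ∀ a : Fin r → k, rowComb a (fun ij : Fin r × Fin (N + 1) =>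
      l (Pi.single ij.1 1) * y ij.2) = l a • y := by
    intro a
    have h1 : l a = ∑ i, a i * l (Pi.single i 1) := by
      conv_lhs => rw [← Finset.univ_sum_single a, map_sum]
      refine Finset.sum_congr rfl fun i _ => ?_
      rw [← smul_eq_mul, ← map_smul, ← Pi.single_smul, smul_eq_mul, mul_one]
    rw [rowComb_eq_sum, h1, Finset.sum_smul]
    refine Finset.sum_congr rfl fun i _ => ?_
    funext j
    simp [mul_assoc]
  have h1 := vertical_mem_coneTangent hnr hd hz hv
    (F' := fun ij : Fin r × Fin (N + 1) => l (Pi.single ij.1 1) * y ij.2) fun a ha => by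
      rw [hF', LinearMap.mem_ker.1 (hl (show a ∈ Submodule.comap _ _ from ha)), zero_smul]
      exact Submodule.zero_mem _
  have h2 := comp_inl_mem_coneTangent hYP (subset_zclosure _ hz) hv h1
  rw [Sum.elim_comp_inl] at h2
  have h3 := (mem_kerPhi_iff hzY hv.1 b).1 hw _ h2
  rw [hF'] at h3
  exact hy ((Submodule.smul_mem_iff _ hlb).1 h3)

/-- The kernel of `Φ` is tangent to the contact locus of `L`. This is where the symmetry of the
second fundamental form is used. -/
theorem elim_zero_mem_coneTangent (hnr : n + 1 ≤ r) (hrN : r < N + 1) (hX : IsVariety X)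
    (hd : zdim X = (n : WithBot ℕ∞)) (hYP : imageVariety Prod.fst (zclosure (incFamily X r)) = Y)
    {z : Gr k N r × PN k N} (hz : z ∈ incFamily X r) (hzY : z.1 ∈ Y)
    {v : (Fin r × Fin (N + 1)) ⊕ Fin (N + 1) → k} (hv : v ∈ coords z) {w : V k N}
    (hw : w ∈ kerPhi Y z.1) : Sum.elim (0 : Fin r × Fin (N + 1) → k) w ∈
        coneTangent (zclosure (incFamily X r)) v := by
  have := IsAlgClosed.instInfinite (K := k)
  have hz' := subset_zclosure _ hz
  have hT := coneTangent_eq_embTangent hz.1.1 hv.2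
  have hwT := kerPhi_le_embTangent hnr hrN hd hYP hz hzY hw
  obtain ⟨b, hb⟩ := (mem_iff_rowComb hv.1).1 (kerPhi_le _ _ hw)
  -- a lift `w₀` of `w`; its component along the Grassmannian is tangent to the fibres over `X`, by
  -- symmetry, and may be subtracted
  obtain ⟨w₀, hw₀, rfl⟩ := exists_mem_coneTangent_incidence hnr hX hd hz hv (hT.symm ▸ hwT)
  have h1 : Sum.elim (w₀ ∘ Sum.inl) 0 ∈ coneTangent (zclosure (incFamily X r)) v := by
    refine vertical_mem_coneTangent hnr hd hz hv fun a ha => ?_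
    obtain ⟨w₁, hw₁, hw₁a⟩ := exists_mem_coneTangent_incidence hnr hX hd hz hv (hT.symm ▸ ha)
    have h2 := rowComb_sub_mem hX hd hz hv hw₀ hw₁ hwT (hw₁a ▸ ha) hb hw₁a
    rw [hb] at hw
    exact (Submodule.sub_mem_iff_left _ ((mem_kerPhi_iff hzY hv.1 b).1 hw _
      (comp_inl_mem_coneTangent hYP hz' hv hw₁))).1 h2
  convert! Submodule.sub_mem _ hw₀ h1 using 1
  funext i
  rcases i with i | i <;> simp

/-- If the Gauss map with image `Y` is separable, then the incidence variety is the family of the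
kernels of `Φ`. -/
theorem incidence_eq_shrinkPullback (hnr : n + 1 ≤ r) (hrN : r < N + 1) (hX : IsVariety X)
    (hd : zdim X = (n : WithBot ℕ∞)) (hY : IsVariety Y)
    (hYP : imageVariety Prod.fst (zclosure (incFamily X r)) = Y)
    (hsep : IsSeparableMorphism Prod.fst (zclosure (incFamily X r))) :
    zclosure (incFamily X r) = shrinkPullback Y := by
  have hP := isVariety_incidence hnr hrN.le hX hd
  have hne := generic_neBot hP.2.1
  have htend := (isPolyMap_fst (P := Gr k N r) (Q := PN k N)).tendsto hP
  rw [(Rows.fstMap (grRows k N r) (pnRows k N)).isSeparableMorphism_iff hP] at hsep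
  rw [hYP] at htend hsep
  have hmem : ∀ᶠ z in generic (zclosure (incFamily X r)), z ∈ shrinkFamily Y := by
    filter_upwards [eventually_mem_incFamily hnr hrN.le hX hd,
      htend.eventually (eventually_mem_shrinkDomain hY), hsep] with z hz hzY hs
    obtain ⟨v, hv⟩ := coords_nonempty z
    exact mem_shrinkFamily_of_map_restr hnr hrN.le hX hd hz hzY hv (hs v hv).ge
  have hS : IsVariety (shrinkPullback Y) := by
    obtain ⟨z, hz⟩ := hmem.exists
    exact isVariety_shrinkPullback hY ⟨z, hz⟩
  have hsub : zclosure (incFamily X r) ⊆ shrinkPullback Y := by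
    refine subset_of_eventually hS (hmem.mono fun z hz => ?_)
    rw [shrinkPullback_eq]
    exact subset_zclosure _ hz
  refine eq_of_subset_of_dimN_le (incRows k N r) hP hS hsub ?_
  -- compare dimensions over `Y`: the tangent spaces of the fibres of the incidence variety contain
  -- the kernel of `Φ`
  obtain ⟨z, hz, hzY, hs, h1, h2⟩ := ((eventually_mem_incFamily hnr hrN.le hX hd).and
    ((htend.eventually (eventually_mem_shrinkDomain hY)).and (hsep.and
    ((Rows.eventually_finrank_coneTangent (incRows k N r) hP).and
    (htend.eventually (Rows.eventually_finrank_coneTangent (grRows k N r) hY)))))).exists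
  obtain ⟨v, hv⟩ := coords_nonempty z
  have h3 := (Rows.fstMap (grRows k N r) (pnRows k N)).finrank_map_restr_add
    (zclosure (incFamily X r)) v
  rw [hs v hv, h1 v hv, card_entries_incRows] at h3
  have h4 := h2 _ hv.1
  rw [card_entries_gr] at h4
  have h5 := dimN_shrinkPullback_le hY hS
  let G := (incRows k N r).tanRel (Set.range (Rows.fstMap (grRows k N r) (pnRows k N)).row)
    (zclosure (incFamily X r)) v
  have hG : ∀ {w}, w ∈ G ↔ w ∈ coneTangent (zclosure (incFamily X r)) v ∧ w ∘ Sum.inl = 0 :=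
    Rows.mem_tanRel_fst_iff _ _
  have h6 : (kerPhi Y z.1) ≤ G.map (LinearMap.funLeft k k Sum.inr) := fun w hw =>
    ⟨Sum.elim 0 w, hG.2 ⟨elim_zero_mem_coneTangent hnr hrN hX hd hYP hz (shrinkDomain_subset hzY)
      hv hw, rfl⟩, rfl⟩
  have h7 := (Submodule.finrank_mono h6).trans (Submodule.finrank_map_le _ _)
  rw [hzY.2] at h7
  change Module.finrank k (coneTangent Y (v ∘ Sum.inl)) + Module.finrank k G = _ at h3
  omega

/-- If the family of the kernels of `Φ` is separable over `X`, then its members are tangent to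
`X`. -/
theorem shrinkPullback_subset_incidence (hX : IsVariety X) (hY : IsVariety Y)
    (hS : IsVariety (shrinkPullback Y))
    (hXS : imageVariety Prod.snd (shrinkPullback Y) = X)
    (hsep : IsSeparableMorphism Prod.snd (shrinkPullback Y))
    (hP : IsVariety (zclosure (incFamily X r))) :
    shrinkPullback Y ⊆ zclosure (incFamily X r) := by
  have := IsAlgClosed.instInfinite (K := k)
  have htend := (isPolyMap_snd (P := Gr k N r) (Q := PN k N)).tendsto hS
  rw [(Rows.sndMap (grRows k N r) (pnRows k N)).isSeparableMorphism_iff hS] at hsep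
  rw [hXS] at htend hsep
  have hYS := imageVariety_fst_shrinkPullback hY (shrinkFamily_nonempty_of_shrinkPullback hS.2.1)
  refine subset_of_eventually hP ?_
  filter_upwards [eventually_mem_shrinkFamily hY hS, eventually_mem (shrinkPullback Y),
    htend.eventually (eventually_mem_smoothLocus hX), hsep] with z hz hzS hzX hs
  refine subset_zclosure _ ⟨hzX, ?_⟩
  obtain ⟨v, hv⟩ := coords_nonempty z
  rw [← coneTangent_eq_embTangent hzX.1 hv.2]
  intro t ht
  obtain ⟨w, hw, rfl⟩ := (hs v hv).ge ht
  have h1 : IsPt (shrinkFamily Y) (dual (Sum.elim (v ∘ Sum.inl) (v ∘ Sum.inr))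
      (Sum.elim (w ∘ Sum.inl) (w ∘ Sum.inr))) := by
    rw [Sum.elim_comp_inl_inr, Sum.elim_comp_inl_inr, ← (incRows k N r).isPt_zclosure,
      ← shrinkPullback_eq, isPt_dual, tangentAt_eq_coneTangent]
    exact ⟨isPt_of_mem hzS hv, hw⟩
  obtain ⟨a, ha, h2⟩ := exists_rowComb_of_isPt (fun z hz => hz.2.trans (kerPhi_le _ _)) hv.1 h1
  have h3 := (submodule_le_iff hv.2 _).1 hz.2
  rw [ha, mem_kerPhi_iff (shrinkDomain_subset hz.1) hv.1] at h3
  exact (Submodule.sub_mem_iff_left _ (h3 _ (comp_inl_mem_coneTangent hYS hzS hv hw))).1 h2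

end Duality

end GaussMap

end

open GaussMap

theorem mainTheorem4 {k : Type*} [Field k] [IsAlgClosed k] (N n m : ℕ) (hnm : n ≤ m) (hmN : m < N)
    (X : Set (PN k N)) (hX : IsVariety X) (hdim : zdim X = (n : WithBot ℕ∞))
    (Y : Set (Gr k N (m + 1))) (hY : IsVariety Y) :
    List.TFAE [
      IsSeparableMorphism Prod.fst (incidence X m) ∧ Y = Prod.fst '' incidence X m,
      incidence X m = shrinkPullback Y,
      zdim (shrinkPullback Y) = ((n + (m - n) * (N - m) : ℕ) : WithBot ℕ∞) ∧
        IsSeparableMorphism Prod.snd (shrinkPullback Y) ∧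
        Prod.snd '' shrinkPullback Y = X] := by
  have hnr : n + 1 ≤ m + 1 := by omega
  have hrN : m + 1 < N + 1 := by omega
  have hP := isVariety_incidence hnr hrN.le hX hdim
  have hdimP : Rows.dimN hP = n + (m - n) * (N - m) := by
    rw [dimN_incidence hnr hrN.le hX hdim, Nat.add_sub_add_right, Nat.add_sub_add_right]
  have hfst : ∀ {Z : Set (Gr k N (m + 1) × PN k N)}, IsVariety Z →
      Prod.fst '' Z = imageVariety Prod.fst Z := fun hZ =>
    image_eq_imageVariety (Rows.isClosed_fst_image (grRows k N (m + 1)) (pnRows k N)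
      (fun _ _ => rfl) hZ)
  have hsnd : ∀ {Z : Set (Gr k N (m + 1) × PN k N)}, IsVariety Z →
      Prod.snd '' Z = imageVariety Prod.snd Z := fun hZ =>
    image_eq_imageVariety (Rows.isClosed_snd_image (grRows k N (m + 1)) (pnRows k N)
      (fun _ _ => rfl) hZ)
  rw [incidence_eq]
  tfae_have 1 → 2 := by
    rintro ⟨hsep, hYP⟩
    exact incidence_eq_shrinkPullback hnr hrN hX hdim hY (by rw [← hfst hP, hYP]) hsep
  tfae_have 2 → 1 := by
    intro h
    have hS : IsVariety (shrinkPullback Y) := h ▸ hP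
    rw [h, hfst hS, imageVariety_fst_shrinkPullback hY
      (shrinkFamily_nonempty_of_shrinkPullback hS.2.1)]
    exact ⟨isSeparableMorphism_fst_shrinkPullback hY hS, rfl⟩
  tfae_have 2 → 3 := by
    intro h
    rw [← h, hsnd hP, Rows.zdim_eq (incRows k N (m + 1)) hP, hdimP]
    exact ⟨by norm_cast, isSeparableMorphism_snd_incidence hnr hrN.le hX hdim,
      imageVariety_snd_incidence hnr hrN.le hX hdim⟩
  tfae_have 3 → 2 := by
    rintro ⟨hd, hsep, hXS⟩
    obtain ⟨-, hS, -⟩ := id hsep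
    rw [hsnd hS] at hXS
    refine (eq_of_subset_of_dimN_le (incRows k N (m + 1)) hS hP
      (shrinkPullback_subset_incidence hX hY hS hXS hsep hP) ?_).symm
    rw [Rows.zdim_eq (incRows k N (m + 1)) hS] at hd
    rw [hdimP]
    exact_mod_cast hd.ge
  tfae_finish
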